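/- Let $G$ be a finite group, written multiplicatively. A sequence over $G$ is a finite unordered sequence of elements of $G$ with repetition allowed, i.e. an element of the free abelian monoid $\mathcal F(G)$ with basis $G$; it is a product-one sequence if its terms can be ordered so that their product is the identity (the empty sequence is a product-one sequence). The product-one sequences form a submonoid $\mathcal B(G)\subset\mathcal F(G)$. An atom of $\mathcal B(G)$ is a non-empty product-one sequence that is not the concatenation of two non-empty product-one sequences. The large Davenport constant $\mathsf D(G)$ is the supremum of the lengths of the atoms of $\mathcal B(G)$. For non-empty $S\in\mathcal B(G)$ let $\mathsf L(S)$ be the set of all $k\in\mathbb N$ such that $S$ is a concatenation of $k$ atoms, let $\mathsf L(S)=\{0\}$ for the empty sequence $S$, and put $\mathcal L(G)=\{\mathsf L(S) : S\in\mathcal B(G)\}$. Theorem 4.7. Let $G$ be a finite group with $\mathsf D(G)=6$. If $G^*$ is a finite group with $\mathcal L(G^*)=\mathcal L(G)$, then $G^*\cong G$. -/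

import Mathlib

/-- A sequence over `G` (a finite unordered sequence, repetitions allowed: an element of the free
abelian monoid with basis `G`) is a `Multiset G`. It is a product-one sequence if its terms can be
ordered such that their product is the identity. The empty sequence has product one. -/
def IsProductOne {G : Type*} [Group G] (S : Multiset G) : Prop :=
  ∃ l : List G, (l : Multiset G) = S ∧ l.prod = 1

/-- The monoid `𝓑(G)` of product-one sequences over `G`; its operation, juxtaposition of
sequences, is written additively. -/
def productOneMonoid (G : Type*) [Group G] : AddSubmonoid (Multiset G) where
  carrier := {S | IsProductOne S}
  zero_mem' := ⟨[], rfl, rfl⟩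
  add_mem' := by
    rintro _ _ ⟨l, rfl, hl⟩ ⟨m, rfl, hm⟩
    exact ⟨l ++ m, rfl, by rw [List.prod_append, hl, hm, one_mul]⟩

open Classical in
/-- The set of lengths `L(a)` of an element `a` of a commutative monoid `H` (written additively):
`{0}` if `a` is a unit, and otherwise the set of all `k` such that `a` is a sum of `k` atoms. -/
def setOfLengths {H : Type*} [AddCommMonoid H] (a : H) : Set ℕ :=
  if IsAddUnit a then {0}
  else {k | ∃ s : Multiset H, (∀ u ∈ s, AddIrreducible u) ∧ s.sum = a ∧ s.card = k}

/-- The system of sets of lengths `𝓛(H) = {L(a) | a ∈ H}` of a commutative monoid `H`. -/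
def systemOfSetsOfLengths (H : Type*) [AddCommMonoid H] : Set (Set ℕ) :=
  Set.range fun a : H => setOfLengths a

/-- The system of sets of lengths `𝓛(G) = 𝓛(𝓑(G))` of a group `G`. -/
def groupSystemOfSetsOfLengths (G : Type*) [Group G] : Set (Set ℕ) :=
  systemOfSetsOfLengths (productOneMonoid G)

/-- The large Davenport constant `D(G) ∈ ℕ ∪ {∞}`: the supremum of the lengths of the atoms
of `𝓑(G)`. -/
noncomputable def largeDavenport (G : Type*) [Group G] : ℕ∞ :=
  ⨆ S ∈ {S : productOneMonoid G | AddIrreducible S}, ((S : Multiset G).card : ℕ∞)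

/-! The system of sets of lengths determines the large Davenport constant $D$ as soon as $D \ge 3$.
For an atom $U$, the sequence $U U^{-1}$ has the lengths $2$ and $|U|$. Conversely, if $2$ and $k
\ge 3$ are lengths of $S$, then $1$ is not a term of $S$, so $2k \le |S|$ and one of the two atoms
composing $S$ has at least $k$ terms. Hence $D(G^*) = 6$ as well (`largeDavenport_eq_of_system_eq`),
and it suffices to list the groups with $D = 6$ and to tell them apart by their sets of lengths.

The list (`classification`) is $C_6$, $C_2^5$, $C_4 \times C_2^2$, $D_3$, $D_4$ (of orders six and
eight) and $Q_8$. The main tool is that a product-one free sequence with $n$ terms gives an atom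
with $n+1$ terms. A free sequence over a subgroup $K$ can be lengthened by a term outside $K$, and
by two terms $x, y$ if $xKy$ misses $K$. So four free terms over $K$ make $K$ transitive on the
other cosets, which leaves few values for the index (`index_eq_of_transitive_on_complement`).
Element orders are at most six, order six forces $C_6$, and order five is impossible. An element of
order three forces $D_3$: nine does not divide $|G|$, Burnside's transfer theorem and a seven-term
atom exclude self-normalizing subgroups of order three, and an inverting involution generates $G$
together with the given element. The remaining groups are 2-groups of exponent at most four. There
$C_4 \times C_2$ is excluded by the group ring bound `IsProductOneFree.card_le_of_two_generators`,
and the non-abelian groups of order sixteen by two explicit seven-term atoms.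

The separation rests on sequences with lengths $2$ and $6$. They are products of two six-term atoms
and also of six pairs $x, x^{-1}$, hence symmetric under inversion, and this nearly determines them.
For $C_6$ and $C_2^5$ the set of lengths is then $\{2,6\}$. For $D_4$ and $Q_8$ it always contains
$3$. For $D_3$ both $\{2,3,6\} \subseteq L$ and $\{2,6\} \subseteq L \not\ni 3$ occur, but $4$
forces $3$. Only $C_4 \times C_2^2$ has $\{2,4,6\} \subseteq L \not\ni 3$. Finally $\{3,9\}
\subseteq L$ occurs for $C_2^5$ and not for $C_6$, and $2,5 \in L$ with $3,4 \notin L$ occurs for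
$D_4$ and not for $Q_8$. -/

/-- An atom of the monoid of product-one sequences, as a bare multiset. -/
def IsProductOneAtom {G : Type*} [Group G] (S : Multiset G) : Prop :=
  IsProductOne S ∧ S ≠ 0 ∧
    ∀ T₁ T₂, IsProductOne T₁ → IsProductOne T₂ → S = T₁ + T₂ → T₁ = 0 ∨ T₂ = 0

/-- `S` is a concatenation of `k` atoms. -/
def HasFactorizationLength {G : Type*} [Group G] (S : Multiset G) (k : ℕ) : Prop :=
  ∃ s : Multiset (Multiset G), (∀ u ∈ s, IsProductOneAtom u) ∧ s.sum = S ∧ s.card = k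

/-! ### Product-one sequences, atoms and factorization lengths -/

section Basic

variable {G : Type*} [Group G] {H : Type*} [Group H]

theorem IsProductOne.add {S T : Multiset G} (hS : IsProductOne S) (hT : IsProductOne T) :
    IsProductOne (S + T) := (productOneMonoid G).add_mem hS hT

/-- A product equal to one remains so under cyclic rotation, so any chosen term can be brought to
the front. -/
theorem isProductOne_cons_iff {a : G} {S : Multiset G} :
    IsProductOne (a ::ₘ S) ↔ ∃ l : List G, (l : Multiset G) = S ∧ a * l.prod = 1 := by
  constructor
  · rintro ⟨l, hl, h1⟩
    have ha : a ∈ l := by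
      have : a ∈ (l : Multiset G) := by rw [hl]; exact Multiset.mem_cons_self a S
      simpa using this
    obtain ⟨l₁, l₂, rfl⟩ := List.append_of_mem ha
    refine ⟨l₂ ++ l₁, ?_, ?_⟩
    · have : (a ::ₘ ((l₂ ++ l₁ : List G) : Multiset G)) = a ::ₘ S := by
        rw [← hl, Multiset.cons_coe, Multiset.coe_eq_coe]
        calc a :: (l₂ ++ l₁) = (a :: l₂) ++ l₁ := rfl
          _ |>.Perm (l₁ ++ a :: l₂) := List.perm_append_comm
      exact (Multiset.cons_inj_right a).1 this
    · rw [List.prod_append, List.prod_cons] at h1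
      rw [List.prod_append, ← mul_assoc]
      exact mul_eq_one_comm.1 h1
  · rintro ⟨l, rfl, h⟩
    exact ⟨a :: l, rfl, by simpa using h⟩

theorem IsProductOne.of_list {l : List G} (h : l.prod = 1) : IsProductOne (l : Multiset G) :=
  ⟨l, rfl, h⟩

theorem IsProductOne.map {S : Multiset G} (hS : IsProductOne S) (f : G →* H) :
    IsProductOne (S.map f) := by
  obtain ⟨l, rfl, hl⟩ := hS
  exact ⟨l.map f, rfl, by rw [← map_list_prod, hl, map_one]⟩

theorem isProductOne_singleton {a : G} : IsProductOne {a} ↔ a = 1 := by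
  rw [← Multiset.cons_zero, isProductOne_cons_iff]
  simp

theorem isProductOne_pair {a b : G} : IsProductOne {a, b} ↔ a * b = 1 := by
  change IsProductOne (a ::ₘ {b}) ↔ _
  rw [isProductOne_cons_iff]
  simp [Multiset.coe_eq_singleton]

theorem isProductOne_iff_prod_eq_one {A : Type*} [CommGroup A] {S : Multiset A} :
    IsProductOne S ↔ S.prod = 1 := by
  constructor
  · rintro ⟨l, rfl, h⟩; simpa using h
  · intro h
    induction S using Quotient.inductionOn with
    | _ l => exact ⟨l, rfl, by simpa using h⟩

theorem IsProductOne.inv {S : Multiset G} (hS : IsProductOne S) :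
    IsProductOne (S.map fun x => x⁻¹) := by
  obtain ⟨l, rfl, hl⟩ := hS
  refine ⟨(l.map fun x => x⁻¹).reverse, ?_, ?_⟩
  · simp
  · have := List.prod_inv_reverse l
    rw [hl, inv_one] at this
    rw [this]

theorem isProductOne_map_iff {S : Multiset G} (e : G ≃* H) :
    IsProductOne (S.map e) ↔ IsProductOne S := by
  refine ⟨fun h => ?_, fun h => h.map e.toMonoidHom⟩
  have := h.map e.symm.toMonoidHom
  simpa [Multiset.map_map, Function.comp_def] using this

theorem IsProductOneAtom.map_equiv {S : Multiset G} (e : G ≃* H) (hS : IsProductOneAtom S) :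
    IsProductOneAtom (S.map e) := by
  refine ⟨(isProductOne_map_iff e).2 hS.1, by simpa using hS.2.1, fun T₁ T₂ h₁ h₂ h => ?_⟩
  have h' : S = T₁.map e.symm + T₂.map e.symm := by
    rw [← Multiset.map_add, ← h, Multiset.map_map]; simp
  have := hS.2.2 _ _ ((isProductOne_map_iff e.symm).2 h₁) ((isProductOne_map_iff e.symm).2 h₂) h'
  simpa using this

theorem IsProductOneAtom.inv {S : Multiset G} (hS : IsProductOneAtom S) :
    IsProductOneAtom (S.map fun x => x⁻¹) := by
  refine ⟨hS.1.inv, by simpa using hS.2.1, fun T₁ T₂ h₁ h₂ h => ?_⟩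
  have h' : S = (T₁.map fun x => x⁻¹) + T₂.map fun x => x⁻¹ := by
    rw [← Multiset.map_add, ← h, Multiset.map_map]; simp
  have := hS.2.2 _ _ h₁.inv h₂.inv h'
  simpa using this

theorem HasFactorizationLength.map_equiv {S : Multiset G} {k : ℕ} (e : G ≃* H)
    (hS : HasFactorizationLength S k) : HasFactorizationLength (S.map e) k := by
  obtain ⟨s, hs, rfl, rfl⟩ := hS
  refine ⟨s.map fun u => u.map e, ?_, ?_, by simp⟩
  · intro u hu
    obtain ⟨v, hv, rfl⟩ := Multiset.mem_map.1 hu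
    exact (hs v hv).map_equiv e
  · exact (map_multiset_sum (Multiset.mapAddMonoidHom e) s).symm

theorem isAddUnit_productOneMonoid {S : productOneMonoid G} : IsAddUnit S ↔ (S : Multiset G) = 0 := by
  constructor
  · rintro ⟨u, rfl⟩
    have h : ((u : productOneMonoid G) : Multiset G) + ((-u : AddUnits _) : productOneMonoid G) = 0 :=
      congrArg Subtype.val u.add_neg
    exact (add_eq_zero.1 h).1
  · intro h
    have : S = 0 := Subtype.ext h
    rw [this]; exact isAddUnit_zero

theorem addIrreducible_iff_isProductOneAtom {S : productOneMonoid G} :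
    AddIrreducible S ↔ IsProductOneAtom (S : Multiset G) := by
  constructor
  · intro h
    refine ⟨S.2, fun h0 => h.not_isAddUnit (isAddUnit_productOneMonoid.2 h0), ?_⟩
    intro T₁ T₂ h₁ h₂ hS
    have := @h.isAddUnit_or_isAddUnit ⟨T₁, h₁⟩ ⟨T₂, h₂⟩ (Subtype.ext hS)
    simpa only [isAddUnit_productOneMonoid] using this
  · rintro ⟨-, h0, h⟩
    refine ⟨fun hu => h0 (isAddUnit_productOneMonoid.1 hu), ?_⟩
    intro a b hab
    simpa only [isAddUnit_productOneMonoid] using h a b a.2 b.2 (congrArg Subtype.val hab)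

theorem hasFactorizationLength_zero {k : ℕ} :
    HasFactorizationLength (0 : Multiset G) k ↔ k = 0 := by
  constructor
  · rintro ⟨s, hs, h0, rfl⟩
    rw [Multiset.card_eq_zero, Multiset.eq_zero_iff_forall_notMem]
    intro u hu
    obtain ⟨s', rfl⟩ := Multiset.exists_cons_of_mem hu
    rw [Multiset.sum_cons, add_eq_zero] at h0
    exact (hs u hu).2.1 h0.1
  · rintro rfl
    exact ⟨0, by simp, by simp, by simp⟩

/-- The empty sequence fits the general description: atoms are non-empty, so its only factorization
is the empty one. -/
theorem mem_setOfLengths_iff {S : productOneMonoid G} {k : ℕ} :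
    k ∈ setOfLengths S ↔ HasFactorizationLength (S : Multiset G) k := by
  unfold setOfLengths
  split_ifs with h
  · rw [isAddUnit_productOneMonoid] at h
    rw [h, hasFactorizationLength_zero, Set.mem_singleton_iff]
  · constructor
    · rintro ⟨s, hs, rfl, rfl⟩
      refine ⟨s.map Subtype.val, ?_, ?_, by simp⟩
      · intro u hu
        obtain ⟨v, hv, rfl⟩ := Multiset.mem_map.1 hu
        exact addIrreducible_iff_isProductOneAtom.1 (hs v hv)
      · exact (map_multiset_sum (productOneMonoid G).subtype s).symm
    · rintro ⟨s, hs, hS, rfl⟩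
      have hs' : ∀ u ∈ s, u ∈ productOneMonoid G := fun u hu => (hs u hu).1
      refine ⟨s.pmap (fun u hu => (⟨u, hu⟩ : productOneMonoid G)) hs', ?_, ?_,
        Multiset.card_pmap _ _ _⟩
      · intro u hu
        obtain ⟨v, hv, rfl⟩ := Multiset.mem_pmap.1 hu
        exact addIrreducible_iff_isProductOneAtom.2 (hs v hv)
      · apply Subtype.ext
        rw [← hS]
        refine (map_multiset_sum (productOneMonoid G).subtype _).trans ?_
        exact congrArg Multiset.sum ((Multiset.map_pmap _ _ _ _).trans
          ((Multiset.pmap_eq_map _ _ _ hs').trans (Multiset.map_id s)))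

theorem mem_groupSystemOfSetsOfLengths_iff {L : Set ℕ} :
    L ∈ groupSystemOfSetsOfLengths G ↔
      ∃ S : Multiset G, IsProductOne S ∧ L = {k | HasFactorizationLength S k} := by
  constructor
  · rintro ⟨S, rfl⟩
    exact ⟨S, S.2, Set.ext fun k => mem_setOfLengths_iff⟩
  · rintro ⟨S, hS, rfl⟩
    exact ⟨⟨S, hS⟩, Set.ext fun k => mem_setOfLengths_iff⟩

theorem groupSystemOfSetsOfLengths_subset_of_mulEquiv (e : G ≃* H) :
    groupSystemOfSetsOfLengths G ⊆ groupSystemOfSetsOfLengths H := by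
  intro L hL
  rw [mem_groupSystemOfSetsOfLengths_iff] at hL ⊢
  obtain ⟨S, hS, rfl⟩ := hL
  refine ⟨S.map e, (isProductOne_map_iff e).2 hS, Set.ext fun k => ⟨fun h => h.map_equiv e, ?_⟩⟩
  intro h
  have := HasFactorizationLength.map_equiv e.symm h
  simpa [Multiset.map_map, Function.comp_def] using this

theorem groupSystemOfSetsOfLengths_congr (e : G ≃* H) :
    groupSystemOfSetsOfLengths G = groupSystemOfSetsOfLengths H :=
  (groupSystemOfSetsOfLengths_subset_of_mulEquiv e).antisymm
    (groupSystemOfSetsOfLengths_subset_of_mulEquiv e.symm)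

theorem IsProductOne.of_one_cons {S : Multiset G} (h : IsProductOne (1 ::ₘ S)) :
    IsProductOne S := by
  obtain ⟨l, rfl, hl⟩ := isProductOne_cons_iff.1 h
  exact ⟨l, rfl, by simpa using hl⟩

theorem IsProductOneAtom.eq_one_of_mem {S : Multiset G} (hS : IsProductOneAtom S) (h : 1 ∈ S) :
    S = {1} := by
  obtain ⟨T, rfl⟩ := Multiset.exists_cons_of_mem h
  rcases hS.2.2 {1} T (isProductOne_singleton.2 rfl) hS.1.of_one_cons
    (Multiset.singleton_add 1 T).symm with h | h
  · simp at h
  · rw [h]; rfl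

theorem IsProductOneAtom.two_le_card {S : Multiset G} (hS : IsProductOneAtom S) (h : 1 ∉ S) :
    2 ≤ S.card := by
  by_contra hlt
  have h0 : S.card ≠ 0 := fun h => hS.2.1 (Multiset.card_eq_zero.1 h)
  obtain ⟨a, rfl⟩ := Multiset.card_eq_one.1 (show S.card = 1 by omega)
  have := isProductOne_singleton.1 hS.1
  simp [this] at h

theorem IsProductOneAtom.hasFactorizationLength {S : Multiset G} (hS : IsProductOneAtom S) :
    HasFactorizationLength S 1 :=
  ⟨{S}, by simpa using hS, by simp, by simp⟩

theorem HasFactorizationLength.add {S T : Multiset G} {k l : ℕ} (hS : HasFactorizationLength S k)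
    (hT : HasFactorizationLength T l) : HasFactorizationLength (S + T) (k + l) := by
  obtain ⟨s, hs, rfl, rfl⟩ := hS
  obtain ⟨t, ht, rfl, rfl⟩ := hT
  refine ⟨s + t, fun u hu => ?_, by simp, by simp⟩
  rcases Multiset.mem_add.1 hu with hu | hu
  exacts [hs u hu, ht u hu]

theorem HasFactorizationLength.isProductOne {S : Multiset G} {k : ℕ}
    (hS : HasFactorizationLength S k) : IsProductOne S := by
  obtain ⟨s, hs, rfl, -⟩ := hS
  exact (productOneMonoid G).multiset_sum_mem s fun u hu => (hs u hu).1

theorem hasFactorizationLength_succ {S : Multiset G} {k : ℕ} :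
    HasFactorizationLength S (k + 1) ↔
      ∃ U T, IsProductOneAtom U ∧ HasFactorizationLength T k ∧ S = U + T := by
  constructor
  · rintro ⟨s, hs, rfl, hk⟩
    obtain ⟨U, s', rfl⟩ : ∃ U s', s = U ::ₘ s' := by
      obtain ⟨U, hU⟩ := Multiset.card_pos_iff_exists_mem.1 (show 0 < s.card by omega)
      exact ⟨U, Multiset.exists_cons_of_mem hU⟩
    refine ⟨U, s'.sum, hs U (by simp), ⟨s', fun u hu => hs u (by simp [hu]), rfl, ?_⟩, by simp⟩
    simpa using hk
  · rintro ⟨U, T, hU, hT, rfl⟩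
    rw [add_comm k]
    exact hU.hasFactorizationLength.add hT

theorem hasFactorizationLength_one {S : Multiset G} :
    HasFactorizationLength S 1 ↔ IsProductOneAtom S := by
  refine ⟨fun h => ?_, fun h => h.hasFactorizationLength⟩
  obtain ⟨s, hs, rfl, h⟩ := h
  obtain ⟨U, rfl⟩ := Multiset.card_eq_one.1 h
  simpa using hs

theorem hasFactorizationLength_two {S : Multiset G} :
    HasFactorizationLength S 2 ↔
      ∃ U V, IsProductOneAtom U ∧ IsProductOneAtom V ∧ S = U + V := by
  rw [hasFactorizationLength_succ]
  simp only [hasFactorizationLength_one]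

theorem hasFactorizationLength_three {S : Multiset G} :
    HasFactorizationLength S 3 ↔ ∃ U V W, IsProductOneAtom U ∧ IsProductOneAtom V ∧
      IsProductOneAtom W ∧ S = U + (V + W) := by
  rw [hasFactorizationLength_succ]
  simp only [hasFactorizationLength_two]
  constructor
  · rintro ⟨U, T, hU, ⟨V, W, hV, hW, rfl⟩, rfl⟩
    exact ⟨U, V, W, hU, hV, hW, rfl⟩
  · rintro ⟨U, V, W, hU, hV, hW, rfl⟩
    exact ⟨U, _, hU, ⟨V, W, hV, hW, rfl⟩, rfl⟩

theorem HasFactorizationLength.ne_zero {S : Multiset G} {k : ℕ}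
    (h : HasFactorizationLength S (k + 1)) : S ≠ 0 := by
  rintro rfl
  have := hasFactorizationLength_zero.1 h
  omega

theorem IsProductOneAtom.length_eq_one {S : Multiset G} {k : ℕ} (hS : IsProductOneAtom S)
    (h : HasFactorizationLength S k) : k = 1 := by
  match k, h with
  | 0, h =>
    obtain ⟨s, -, rfl, hk⟩ := h
    rw [Multiset.card_eq_zero.1 hk] at hS
    exact absurd rfl hS.2.1
  | 1, _ => rfl
  | k + 2, h =>
    obtain ⟨U, T, hU, hT, rfl⟩ := hasFactorizationLength_succ.1 h
    rcases hS.2.2 U T hU.1 hT.isProductOne rfl with h | h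
    · exact absurd h hU.2.1
    · exact absurd h hT.ne_zero

theorem HasFactorizationLength.two_mul_le {S : Multiset G} {k : ℕ}
    (h : HasFactorizationLength S k) (h1 : 1 ∉ S) : 2 * k ≤ S.card := by
  induction k generalizing S with
  | zero => simp
  | succ k ih =>
    obtain ⟨U, T, hU, hT, rfl⟩ := hasFactorizationLength_succ.1 h
    rw [Multiset.mem_add, not_or] at h1
    have := ih hT h1.2
    have := hU.two_le_card h1.1
    rw [Multiset.card_add]
    omega

theorem HasFactorizationLength.card_le {S : Multiset G} {k D : ℕ}
    (hD : ∀ U : Multiset G, IsProductOneAtom U → U.card ≤ D)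
    (h : HasFactorizationLength S k) : S.card ≤ k * D := by
  induction k generalizing S with
  | zero =>
    obtain ⟨s, -, rfl, hk⟩ := h
    simp [Multiset.card_eq_zero.1 hk]
  | succ k ih =>
    obtain ⟨U, T, hU, hT, rfl⟩ := hasFactorizationLength_succ.1 h
    have := ih hT
    have := hD U hU
    rw [Multiset.card_add]
    linarith

theorem HasFactorizationLength.of_one_cons {S : Multiset G} {k : ℕ}
    (h : HasFactorizationLength (1 ::ₘ S) k) : ∃ l, k = l + 1 ∧ HasFactorizationLength S l := by
  obtain ⟨s, hs, hS, rfl⟩ := h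
  have : (1 : G) ∈ s.sum := by rw [hS]; simp
  obtain ⟨U, hU, h1⟩ := Multiset.mem_join.1 this
  obtain ⟨s', rfl⟩ := Multiset.exists_cons_of_mem hU
  have hU1 := (hs U hU).eq_one_of_mem h1
  subst hU1
  refine ⟨s'.card, by simp, s', fun u hu => hs u (by simp [hu]), ?_, rfl⟩
  rw [Multiset.sum_cons, Multiset.singleton_add] at hS
  exact (Multiset.cons_inj_right 1).1 hS

/-- If `S` is a concatenation of two atoms and of `k ≥ 3` atoms, the identity is not a term. -/
theorem HasFactorizationLength.one_notMem {S : Multiset G} {k : ℕ} (hk : 3 ≤ k)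
    (h2 : HasFactorizationLength S 2) (h : HasFactorizationLength S k) : 1 ∉ S := by
  intro h1
  obtain ⟨T, rfl⟩ := Multiset.exists_cons_of_mem h1
  -- Cancelling the atom `{1}` from both factorizations leaves an atom that is also a concatenation
  -- of $k - 1 \ge 2$ atoms.
  obtain ⟨l, hl, hT⟩ := h2.of_one_cons
  obtain rfl : l = 1 := by omega
  obtain ⟨m, hm, hT'⟩ := h.of_one_cons
  have := (hasFactorizationLength_one.1 hT).length_eq_one hT'
  omega

/-- A non-empty product-one sequence not containing the identity is a concatenation of between
one and `|S| / 2` atoms. -/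
theorem IsProductOne.exists_hasFactorizationLength {S : Multiset G} (hS : IsProductOne S)
    (h0 : S ≠ 0) (h1 : 1 ∉ S) : ∃ k, 1 ≤ k ∧ 2 * k ≤ S.card ∧ HasFactorizationLength S k := by
  induction hn : S.card using Nat.strong_induction_on generalizing S with
  | _ n ih =>
    by_cases hA : IsProductOneAtom S
    · exact ⟨1, le_rfl, by have := hA.two_le_card h1; omega, hA.hasFactorizationLength⟩
    · have : ∃ T₁ T₂, IsProductOne T₁ ∧ IsProductOne T₂ ∧ S = T₁ + T₂ ∧ T₁ ≠ 0 ∧ T₂ ≠ 0 := by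
        by_contra hc
        push Not at hc
        refine hA ⟨hS, h0, fun T₁ T₂ h₁ h₂ h => ?_⟩
        by_contra hne
        rw [not_or] at hne
        exact hne.2 (hc T₁ T₂ h₁ h₂ h hne.1)
      obtain ⟨T₁, T₂, h₁, h₂, rfl, n₁, n₂⟩ := this
      rw [Multiset.mem_add, not_or] at h1
      rw [Multiset.card_add] at hn
      have c₁ := Multiset.card_pos.2 n₁
      have c₂ := Multiset.card_pos.2 n₂
      obtain ⟨k₁, a₁, b₁, f₁⟩ := ih T₁.card (by omega) h₁ n₁ h1.1 rfl
      obtain ⟨k₂, a₂, b₂, f₂⟩ := ih T₂.card (by omega) h₂ n₂ h1.2 rfl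
      exact ⟨k₁ + k₂, by omega, by omega, f₁.add f₂⟩

/-- Each pair $a, a^{-1}$ with $a \ne 1$ is an atom. For an atom $S$ this is the second
factorization of $S S^{-1}$. -/
theorem hasFactorizationLength_pairs (S : Multiset G) (h1 : 1 ∉ S) :
    HasFactorizationLength (S + S.map fun x => x⁻¹) S.card := by
  induction S using Multiset.induction_on with
  | empty => simpa using hasFactorizationLength_zero.2 rfl
  | cons a S ih =>
    rw [Multiset.mem_cons, not_or] at h1
    rw [Multiset.card_cons, hasFactorizationLength_succ]
    refine ⟨{a, a⁻¹}, _, ?_, ih h1.2, ?_⟩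
    · have hp : IsProductOne ({a, a⁻¹} : Multiset G) := isProductOne_pair.2 (by simp)
      obtain ⟨k, hk, hk', h⟩ := hp.exists_hasFactorizationLength (by simp)
        (by simpa [eq_comm] using h1.1)
      have h2 : Multiset.card ({a, a⁻¹} : Multiset G) = 2 := by simp
      obtain rfl : k = 1 := by omega
      exact hasFactorizationLength_one.1 h
    · rw [Multiset.map_cons, Multiset.cons_add, Multiset.add_cons, Multiset.insert_eq_cons,
        Multiset.cons_add, Multiset.singleton_add]

/-- A factorization of `S` into `|S| / 2` atoms consists of pairs of mutually inverse elements. -/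
theorem HasFactorizationLength.exists_pairs {S : Multiset G} {k : ℕ}
    (h : HasFactorizationLength S k) (h1 : 1 ∉ S) (hc : S.card = 2 * k) :
    ∃ T : Multiset G, T.card = k ∧ S = T + T.map fun x => x⁻¹ := by
  induction k generalizing S with
  | zero => exact ⟨0, rfl, by simpa using hc⟩
  | succ k ih =>
    obtain ⟨U, T, hU, hT, rfl⟩ := hasFactorizationLength_succ.1 h
    rw [Multiset.mem_add, not_or] at h1
    have h2 := hU.two_le_card h1.1
    have h3 := hT.two_mul_le h1.2
    rw [Multiset.card_add] at hc
    obtain ⟨T', rfl, hT'⟩ := ih hT h1.2 (by omega)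
    obtain ⟨a, b, rfl⟩ := Multiset.card_eq_two.1 (show U.card = 2 by omega)
    obtain rfl : b = a⁻¹ := by
      have := isProductOne_pair.1 hU.1
      exact (inv_eq_of_mul_eq_one_right this).symm
    refine ⟨a ::ₘ T', by simp, ?_⟩
    nth_rw 1 [hT']
    rw [Multiset.map_cons, Multiset.cons_add, Multiset.add_cons, Multiset.insert_eq_cons,
      Multiset.cons_add, Multiset.singleton_add]

theorem Multiset.count_map_inv [DecidableEq G] (T : Multiset G) (x : G) :
    (T.map fun x => x⁻¹).count x = T.count x⁻¹ := by
  conv_lhs => rw [← inv_inv x]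
  exact Multiset.count_map_eq_count' _ T inv_injective x⁻¹

/-- Whenever a factorization length is the largest possible, this symmetry relates the two atoms of
a factorization of length two. -/
theorem count_inv_eq_of_pairs [DecidableEq G] {S T : Multiset G}
    (h : S = T + T.map fun x => x⁻¹) (x : G) : S.count x⁻¹ = S.count x := by
  rw [h, Multiset.count_add, Multiset.count_add, Multiset.count_map_inv, Multiset.count_map_inv,
    inv_inv, add_comm]

theorem even_count_of_pairs [DecidableEq G] {S T : Multiset G}
    (h : S = T + T.map fun x => x⁻¹) {x : G} (hx : x⁻¹ = x) : Even (S.count x) := by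
  rw [h, Multiset.count_add, Multiset.count_map_inv, hx]
  exact ⟨_, rfl⟩

/-- Every atom has at most `|G|` terms. -/
theorem IsProductOneAtom.card_le_natCard [Finite G] {S : Multiset G} (hS : IsProductOneAtom S) :
    S.card ≤ Nat.card G := by
  obtain ⟨l, rfl, hl⟩ := hS.1
  by_contra hlt
  push Not at hlt
  rw [Multiset.coe_card] at hlt
  have := Fintype.ofFinite G
  -- By pigeonhole two proper prefixes have the same product. The segment between them and the rest
  -- of the list are then complementary non-empty product-one sequences.
  obtain ⟨i, j, hij, h⟩ : ∃ i j : Fin l.length, i < j ∧ (l.take i).prod = (l.take j).prod := by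
    obtain ⟨i, j, hij, h⟩ := Fintype.exists_ne_map_eq_of_card_lt
      (fun i : Fin l.length => (l.take i).prod) (by
        rw [Fintype.card_fin, ← Nat.card_eq_fintype_card]; exact hlt)
    rcases lt_or_gt_of_ne hij with h' | h'
    exacts [⟨i, j, h', h⟩, ⟨j, i, h', h.symm⟩]
  have hj := j.2
  have hij' : (i : ℕ) < j := hij
  have e1 : l.take j = l.take i ++ (l.take j).drop i := by
    have := List.take_append_drop i (l.take j)
    rw [List.take_take, min_eq_left hij'.le] at this
    exact this.symm
  have e2 : l = l.take i ++ ((l.take j).drop i ++ l.drop j) := by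
    rw [← List.append_assoc, ← e1, List.take_append_drop]
  have p1 : ((l.take j).drop i).prod = 1 := by
    rw [e1, List.prod_append] at h
    exact mul_eq_left.1 h.symm
  have p2 : (l.take i ++ l.drop j).prod = 1 := by
    rw [e2] at hl
    rw [List.prod_append, List.prod_append, p1, one_mul] at hl
    rw [List.prod_append]
    exact hl
  rcases hS.2.2 _ _ (IsProductOne.of_list p1) (IsProductOne.of_list p2) (by
    conv_lhs => rw [e2]
    simp only [Multiset.coe_add, Multiset.coe_eq_coe]
    rw [← List.append_assoc, ← List.append_assoc]
    exact List.perm_append_comm.append_right _) with h0 | h0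
  · have := congrArg Multiset.card h0
    simp at this
    omega
  · have := congrArg Multiset.card h0
    simp at this
    omega

/-- A finite non-zero supremum of lengths is attained, since otherwise $n - 1$ would be an upper
bound. -/
theorem largeDavenport_eq_iff {n : ℕ} (hn : n ≠ 0) :
    largeDavenport G = n ↔ (∀ U : Multiset G, IsProductOneAtom U → U.card ≤ n) ∧
      ∃ U : Multiset G, IsProductOneAtom U ∧ U.card = n := by
  have key : ∀ m : ℕ, largeDavenport G ≤ m ↔ ∀ U : Multiset G, IsProductOneAtom U → U.card ≤ m := by
    intro m
    unfold largeDavenport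
    simp only [iSup_le_iff, Set.mem_ofPred_eq, Nat.cast_le, addIrreducible_iff_isProductOneAtom]
    exact ⟨fun h U hU => h ⟨U, hU.1⟩ hU, fun h S hS => h S hS⟩
  constructor
  · intro h
    have hle := (key n).1 h.le
    refine ⟨hle, ?_⟩
    by_contra hc
    push Not at hc
    have : largeDavenport G ≤ (n - 1 : ℕ) := (key (n - 1)).2 fun U hU => by
      have := hle U hU
      have := hc U hU
      omega
    rw [h, Nat.cast_le] at this
    omega
  · rintro ⟨hle, U, hU, hc⟩
    refine le_antisymm ((key n).2 hle) ?_
    by_contra hlt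
    push Not at hlt
    have : largeDavenport G ≤ (n - 1 : ℕ) := by
      obtain ⟨m, hm⟩ := ENat.ne_top_iff_exists.1 hlt.ne_top
      rw [← hm, Nat.cast_lt] at hlt
      rw [← hm, Nat.cast_le]
      omega
    have := (key (n - 1)).1 this U hU
    omega

end Basic

/-! ### The Davenport constant from lengths, and product-one free sequences -/

section Davenport

variable {G : Type*} [Group G] {H : Type*} [Group H]

theorem exists_factorizationLengths_of_atom {U : Multiset G} (hU : IsProductOneAtom U)
    (h1 : 1 ∉ U) : ∃ L ∈ groupSystemOfSetsOfLengths G, 2 ∈ L ∧ U.card ∈ L := by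
  refine ⟨{k | HasFactorizationLength (U + U.map fun x => x⁻¹) k},
    mem_groupSystemOfSetsOfLengths_iff.2 ⟨_, hU.1.add hU.inv.1, rfl⟩, ?_, ?_⟩
  · exact hasFactorizationLength_two.2 ⟨_, _, hU, hU.inv, rfl⟩
  · exact hasFactorizationLength_pairs U h1

/-- Without the identity, $k$ atoms have at least $2k$ terms in total, so one of two atoms with the
same concatenation has at least $k$. The bound $k \ge 3$ is what excludes the identity. -/
theorem exists_atom_of_factorizationLengths {L : Set ℕ} {k : ℕ}
    (hL : L ∈ groupSystemOfSetsOfLengths G) (h2 : 2 ∈ L) (hk : k ∈ L) (h3 : 3 ≤ k) :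
    ∃ U : Multiset G, IsProductOneAtom U ∧ 1 ∉ U ∧ k ≤ U.card := by
  obtain ⟨S, -, rfl⟩ := mem_groupSystemOfSetsOfLengths_iff.1 hL
  have h1 := HasFactorizationLength.one_notMem h3 h2 hk
  have hc := HasFactorizationLength.two_mul_le hk h1
  obtain ⟨U, V, hU, hV, rfl⟩ := hasFactorizationLength_two.1 h2
  rw [Multiset.mem_add, not_or] at h1
  rw [Multiset.card_add] at hc
  by_cases h : k ≤ U.card
  · exact ⟨U, hU, h1.1, h⟩
  · exact ⟨V, hV, h1.2, by omega⟩

theorem IsProductOneAtom.one_notMem {U : Multiset G} (hU : IsProductOneAtom U)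
    (hc : 2 ≤ U.card) : 1 ∉ U := by
  intro h
  rw [hU.eq_one_of_mem h] at hc
  simp at hc

/-- The constant is the largest $k$ occurring together with $2$ in a set of lengths, which is a
property of the system alone. -/
theorem largeDavenport_eq_of_system_eq {n : ℕ} (hn : 3 ≤ n) (hG : largeDavenport G = n)
    (hL : groupSystemOfSetsOfLengths H = groupSystemOfSetsOfLengths G) :
    largeDavenport H = n := by
  obtain ⟨hle, U, hU, hc⟩ := (largeDavenport_eq_iff (by omega)).1 hG
  have hle' : ∀ V : Multiset H, IsProductOneAtom V → V.card ≤ n := by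
    intro V hV
    by_contra hlt
    obtain ⟨L, hLm, h2, hk⟩ := exists_factorizationLengths_of_atom hV (hV.one_notMem (by omega))
    rw [hL] at hLm
    obtain ⟨W, hW, -, hWc⟩ := exists_atom_of_factorizationLengths hLm h2 hk (by omega)
    have := hle W hW
    omega
  refine (largeDavenport_eq_iff (by omega)).2 ⟨hle', ?_⟩
  obtain ⟨L, hLm, h2, hk⟩ := exists_factorizationLengths_of_atom hU (hU.one_notMem (by omega))
  rw [← hL, hc] at *
  obtain ⟨V, hV, -, hVc⟩ := exists_atom_of_factorizationLengths hLm h2 hk hn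
  exact ⟨V, hV, le_antisymm (hle' V hV) hVc⟩

/-- No non-empty subsequence of `T` is a product-one sequence. -/
def IsProductOneFree (T : Multiset G) : Prop :=
  ∀ T' ≤ T, IsProductOne T' → T' = 0

theorem Multiset.le_cons_cases {α : Type*} {a : α} {S T : Multiset α} (h : T ≤ a ::ₘ S) :
    T ≤ S ∨ ∃ T', T = a ::ₘ T' ∧ T' ≤ S := by
  by_cases ha : a ∈ T
  · obtain ⟨T', rfl⟩ := Multiset.exists_cons_of_mem ha
    exact Or.inr ⟨T', rfl, (Multiset.cons_le_cons_iff a).1 h⟩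
  · exact Or.inl ((Multiset.le_cons_of_notMem ha).1 h)

theorem Multiset.exists_add_of_le_add {α : Type*} {S T U : Multiset α} (h : U ≤ S + T) :
    ∃ S' ≤ S, ∃ T' ≤ T, U = S' + T' := by
  classical
  exact ⟨U ∩ S, Multiset.inter_le_right, U - S, by rwa [Multiset.sub_le_iff_le_add, add_comm],
    by rw [add_comm, Multiset.sub_add_inter]⟩

/-- Append the inverse of the product in some order. In any splitting, the part avoiding the new
term is a product-one subsequence of the free sequence, hence empty. -/
theorem IsProductOneFree.exists_atom {T : Multiset G} (hT : IsProductOneFree T) :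
    ∃ U : Multiset G, IsProductOneAtom U ∧ U.card = T.card + 1 := by
  induction T using Quotient.inductionOn with
  | _ l =>
    refine ⟨l.prod⁻¹ ::ₘ l, ⟨⟨l.prod⁻¹ :: l, rfl, by simp⟩, by simp, ?_⟩, by simp⟩
    have aux : ∀ T₁ T₂ : Multiset G, IsProductOne T₁ → IsProductOne T₂ →
        l.prod⁻¹ ::ₘ (l : Multiset G) = T₁ + T₂ → l.prod⁻¹ ∈ T₁ → T₂ = 0 := by
      intro T₁ T₂ _ h₂ h hm
      obtain ⟨T', rfl⟩ := Multiset.exists_cons_of_mem hm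
      rw [Multiset.cons_add, Multiset.cons_inj_right] at h
      exact hT T₂ (by change T₂ ≤ (l : Multiset G); rw [h]; exact Multiset.le_add_left _ _) h₂
    intro T₁ T₂ h₁ h₂ h
    have hm : l.prod⁻¹ ∈ T₁ + T₂ := by rw [← h]; simp
    rcases Multiset.mem_add.1 hm with hm | hm
    · exact Or.inr (aux T₁ T₂ h₁ h₂ h hm)
    · exact Or.inl (aux T₂ T₁ h₂ h₁ (by rw [h, add_comm]) hm)

theorem Subgroup.multiset_list_prod_mem (K : Subgroup G) {T : Multiset G} (hT : ∀ t ∈ T, t ∈ K)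
    {l : List G} (hl : (l : Multiset G) ≤ T) : l.prod ∈ K :=
  K.list_prod_mem fun x hx => hT x (Multiset.mem_of_le hl (by simpa using hx))

/-- A product-one subsequence through $x$ would express $x$ as the inverse of a product of elements
of $K$. -/
theorem IsProductOneFree.cons {T : Multiset G} (hT : IsProductOneFree T) {K : Subgroup G}
    (hK : ∀ t ∈ T, t ∈ K) {x : G} (hx : x ∉ K) : IsProductOneFree (x ::ₘ T) := by
  intro T' hle h
  rcases Multiset.le_cons_cases hle with hle' | ⟨T'', rfl, hle'⟩
  · exact hT _ hle' h
  · obtain ⟨l, rfl, hl⟩ := isProductOne_cons_iff.1 h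
    refine absurd ?_ hx
    rw [eq_inv_of_mul_eq_one_left hl]
    exact K.inv_mem (K.multiset_list_prod_mem hK hle')

/-- A product-one subsequence through both new terms reads $x h y h' = 1$ with $h, h' \in K$, after
rotation. -/
theorem IsProductOneFree.cons_cons {T : Multiset G} (hT : IsProductOneFree T) {K : Subgroup G}
    (hK : ∀ t ∈ T, t ∈ K) {x y : G} (hx : x ∉ K) (hy : y ∉ K)
    (hxy : ∀ h ∈ K, x * h * y ∉ K) : IsProductOneFree (x ::ₘ y ::ₘ T) := by
  intro T' hle h
  rcases Multiset.le_cons_cases hle with hle₁ | ⟨T₁, rfl, hle₁⟩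
  · exact hT.cons hK hy _ hle₁ h
  rcases Multiset.le_cons_cases hle₁ with hle₂ | ⟨T₂, rfl, hle₂⟩
  · exact hT.cons hK hx _ ((Multiset.cons_le_cons_iff x).2 hle₂) h
  · obtain ⟨l, hl, h1⟩ := isProductOne_cons_iff.1 h
    have hy' : y ∈ l := by
      have : y ∈ (l : Multiset G) := by rw [hl]; simp
      simpa using this
    obtain ⟨l₁, l₂, rfl⟩ := List.append_of_mem hy'
    have hl' : ((l₁ ++ l₂ : List G) : Multiset G) = T₂ := by
      rw [← Multiset.cons_inj_right y, ← hl, Multiset.cons_coe, Multiset.coe_eq_coe]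
      exact List.perm_middle.symm
    rw [← hl'] at hle₂
    have m₁ := K.multiset_list_prod_mem hK
      (le_trans (Multiset.coe_le.2 (List.sublist_append_left l₁ l₂).subperm) hle₂)
    have m₂ := K.multiset_list_prod_mem hK
      (le_trans (Multiset.coe_le.2 (List.sublist_append_right l₁ l₂).subperm) hle₂)
    refine absurd ?_ (hxy _ m₁)
    rw [List.prod_append, List.prod_cons, ← mul_assoc, ← mul_assoc] at h1
    rw [eq_inv_of_mul_eq_one_left h1]
    exact K.inv_mem m₂

theorem Multiset.le_replicate_iff_eq {α : Type*} {a : α} {n : ℕ} {T : Multiset α}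
    (h : T ≤ Multiset.replicate n a) : ∃ k ≤ n, T = Multiset.replicate k a := by
  refine ⟨T.card, by simpa using Multiset.card_le_card h, ?_⟩
  exact Multiset.eq_replicate_card.2 fun b hb => Multiset.eq_of_mem_replicate (Multiset.mem_of_le h hb)

theorem isProductOne_replicate {g : G} {k : ℕ} :
    IsProductOne (Multiset.replicate k g) ↔ g ^ k = 1 := by
  constructor
  · rintro ⟨l, hl, h⟩
    rw [← Multiset.coe_replicate, Multiset.coe_eq_coe, List.perm_replicate] at hl
    rw [hl, List.prod_replicate] at h
    exact h
  · intro h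
    exact ⟨List.replicate k g, Multiset.coe_replicate k g, by simpa using h⟩

theorem isProductOneFree_replicate {g : G} {n : ℕ} (hn : ∀ k, 0 < k → k ≤ n → g ^ k ≠ 1) :
    IsProductOneFree (Multiset.replicate n g) := by
  intro T' hle h
  obtain ⟨k, hk, rfl⟩ := Multiset.le_replicate_iff_eq hle
  rcases Nat.eq_zero_or_pos k with rfl | h0
  · rfl
  · exact absurd (isProductOne_replicate.1 h) (hn k h0 hk)

theorem isProductOneFree_replicate_of_lt_orderOf {g : G} {n : ℕ} (hn : n < orderOf g) :
    IsProductOneFree (Multiset.replicate n g) :=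
  isProductOneFree_replicate fun k h0 hk => pow_ne_one_of_lt_orderOf h0.ne' (by omega)

theorem IsProductOneFree.card_add_one_le {T : Multiset G} (hT : IsProductOneFree T) {D : ℕ}
    (hD : ∀ U : Multiset G, IsProductOneAtom U → U.card ≤ D) : T.card + 1 ≤ D := by
  obtain ⟨U, hU, hc⟩ := hT.exists_atom
  have := hD U hU
  omega

theorem orderOf_le_of_atom_card_le [Finite G] {D : ℕ}
    (hD : ∀ U : Multiset G, IsProductOneAtom U → U.card ≤ D) (g : G) : orderOf g ≤ D := by
  have h0 := orderOf_pos g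
  have := (isProductOneFree_replicate_of_lt_orderOf
    (show orderOf g - 1 < orderOf g by omega)).card_add_one_le hD
  rw [Multiset.card_replicate] at this
  omega

/-- Adjoining to a product-one free sequence over a subgroup of prime-power order one element for
each step of a chain of subgroups. -/
theorem IsProductOneFree.exists_of_card_eq_pow [Finite G] {p : ℕ} [Fact p.Prime] {T : Multiset G}
    (hT : IsProductOneFree T) {K : Subgroup G} (hK : ∀ t ∈ T, t ∈ K) {a : ℕ}
    (ha : Nat.card K = p ^ a) (j : ℕ) (hj : p ^ (a + j) ∣ Nat.card G) :
    ∃ (K' : Subgroup G) (T' : Multiset G), Nat.card K' = p ^ (a + j) ∧ (∀ t ∈ T', t ∈ K') ∧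
      IsProductOneFree T' ∧ T'.card = T.card + j := by
  induction j generalizing T K a with
  | zero => exact ⟨K, T, ha, hK, hT, rfl⟩
  | succ j ih =>
    obtain ⟨K', hK', hle⟩ := Sylow.exists_subgroup_card_pow_succ (p := p)
      (dvd_trans (pow_dvd_pow p (by omega)) hj) ha
    obtain ⟨x, hx, hx'⟩ : ∃ x ∈ K', x ∉ K := by
      by_contra hc
      push Not at hc
      have : K = K' := le_antisymm hle hc
      rw [this, hK'] at ha
      have := Nat.pow_right_injective (Fact.out : p.Prime).two_le ha
      omega
    obtain ⟨K'', T', h0, hm, h1, h2⟩ := ih (hT.cons hK hx') (K := K') (a := a + 1) (by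
      intro t ht
      rcases Multiset.mem_cons.1 ht with rfl | ht
      exacts [hx, hle (hK t ht)]) hK' (by rwa [show a + 1 + j = a + (j + 1) by omega])
    exact ⟨K'', T', by rw [h0, show a + 1 + j = a + (j + 1) by omega], hm, h1,
      by rw [h2, Multiset.card_cons]; omega⟩

theorem isProductOneFree_zero : IsProductOneFree (0 : Multiset G) := fun _ h _ =>
  Multiset.le_zero.1 h

/-- The hypothesis says that $K$ permutes the cosets other than $K$ transitively. By
orbit–stabilizer the index of $K$ exceeds by one a divisor of $|K|$. -/
theorem index_eq_of_transitive_on_complement [Finite G] {K : Subgroup G}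
    (hK : ∀ x ∉ K, ∀ y ∉ K, ∃ h ∈ K, x * h * y ∈ K) {x : G} (hx : x ∉ K) :
    K.index = 1 + (MulAction.stabilizer K (x : G ⧸ K)).index := by
  classical
  rw [MulAction.index_stabilizer, Subgroup.index]
  have hmem : ((1 : G) : G ⧸ K) ∉ MulAction.orbit K (x : G ⧸ K) := by
    rintro ⟨k, hk⟩
    have hk' : (((k : G) * x : G) : G ⧸ K) = ((1 : G) : G ⧸ K) := hk
    rw [QuotientGroup.eq] at hk'
    apply hx
    have := K.mul_mem (K.inv_mem k.2) (K.inv_mem hk')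
    simpa using this
  have huniv : (Set.univ : Set (G ⧸ K)) =
      insert ((1 : G) : G ⧸ K) (MulAction.orbit K (x : G ⧸ K)) := by
    refine (Set.eq_univ_of_forall fun q => ?_).symm
    induction q using QuotientGroup.induction_on with
    | H y =>
      by_cases hy : y ∈ K
      · left
        exact (QuotientGroup.eq.2 (by simpa using hy)).symm
      · right
        -- The condition $y^{-1} h x \in K$ says precisely $h x K = y K$.
        obtain ⟨h, hh, hm⟩ := hK y⁻¹ (fun h => hy (by simpa using K.inv_mem h)) x hx
        refine ⟨⟨h, hh⟩, ?_⟩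
        change ((h * x : G) : G ⧸ K) = y
        rw [QuotientGroup.eq]
        have := K.inv_mem hm
        simpa [mul_assoc] using this
  rw [← Set.ncard_univ, huniv, Set.ncard_insert_of_notMem hmem (Set.toFinite _), add_comm]

end Davenport

/-! ### Atoms with two terms outside a subgroup -/

section OddOrder

variable {G : Type*} [Group G]

theorem isProductOne_pair_cons {x y : G} {T : Multiset G} (h : IsProductOne (x ::ₘ y ::ₘ T)) :
    ∃ l₁ l₂ : List G, ((l₁ ++ l₂ : List G) : Multiset G) = T ∧
      x * l₁.prod * y * l₂.prod = 1 := by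
  obtain ⟨l, hl, h1⟩ := isProductOne_cons_iff.1 h
  have hy' : y ∈ l := by
    have : y ∈ (l : Multiset G) := by rw [hl]; simp
    simpa using this
  obtain ⟨l₁, l₂, rfl⟩ := List.append_of_mem hy'
  refine ⟨l₁, l₂, ?_, ?_⟩
  · rw [← Multiset.cons_inj_right y, ← hl, Multiset.cons_coe, Multiset.coe_eq_coe]
    exact List.perm_middle.symm
  · rwa [List.prod_append, List.prod_cons, ← mul_assoc, ← mul_assoc] at h1

theorem not_isProductOne_cons {K : Subgroup G} {x : G} {T : Multiset G} (hT : ∀ t ∈ T, t ∈ K)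
    (hx : x ∉ K) : ¬ IsProductOne (x ::ₘ T) := by
  intro h
  obtain ⟨l, rfl, hl⟩ := isProductOne_cons_iff.1 h
  refine hx ?_
  rw [eq_inv_of_mul_eq_one_left hl]
  exact K.inv_mem (K.list_prod_mem fun t ht => hT t (by simpa using ht))

/-- To check that a product-one sequence with two distinguished terms outside a subgroup
containing the other terms is an atom, it suffices to split off subsequences over the subgroup. -/
theorem isProductOneAtom_cons_cons {K : Subgroup G} {x y : G} {T : Multiset G}
    (hT : ∀ t ∈ T, t ∈ K) (hx : x ∉ K) (h1 : IsProductOne (x ::ₘ y ::ₘ T))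
    (h : ∀ T₁ T₂, T = T₁ + T₂ → IsProductOne (x ::ₘ y ::ₘ T₁) → IsProductOne T₂ → T₂ = 0) :
    IsProductOneAtom (x ::ₘ y ::ₘ T) := by
  refine ⟨h1, by simp, ?_⟩
  have aux : ∀ T₁ T₂ : Multiset G, IsProductOne T₁ → IsProductOne T₂ →
      x ::ₘ y ::ₘ T = T₁ + T₂ → x ∈ T₁ → T₂ = 0 := by
    intro T₁ T₂ h₁ h₂ hs hm
    obtain ⟨T', rfl⟩ := Multiset.exists_cons_of_mem hm
    rw [Multiset.cons_add, Multiset.cons_inj_right] at hs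
    have hm' : y ∈ T' + T₂ := by rw [← hs]; simp
    rcases Multiset.mem_add.1 hm' with hm' | hm'
    · obtain ⟨T'', rfl⟩ := Multiset.exists_cons_of_mem hm'
      rw [Multiset.cons_add, Multiset.cons_inj_right] at hs
      exact h T'' T₂ hs h₁ h₂
    · obtain ⟨T'', rfl⟩ := Multiset.exists_cons_of_mem hm'
      rw [Multiset.add_cons, Multiset.cons_inj_right] at hs
      exact absurd h₁ (not_isProductOne_cons (fun t ht => hT t (by rw [hs]; simp [ht])) hx)
  intro T₁ T₂ h₁ h₂ hs
  have hm : x ∈ T₁ + T₂ := by rw [← hs]; simp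
  rcases Multiset.mem_add.1 hm with hm | hm
  · exact Or.inr (aux T₁ T₂ h₁ h₂ hs hm)
  · exact Or.inl (aux T₂ T₁ h₂ h₁ (by rw [hs, add_comm]) hm)

/-- Replacing a term `u` of an atom over a subgroup by two factors `y`, `y⁻¹ u` outside. -/
theorem IsProductOneAtom.split_term {K : Subgroup G} {u y : G} {W : Multiset G}
    (hA : IsProductOneAtom (u ::ₘ W)) (hu : u ∈ K) (hW : ∀ w ∈ W, w ∈ K) (hy : y ∉ K)
    (hc : ∀ w ∈ K, y * w * y⁻¹ ∈ K → y * w * y⁻¹ = w) :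
    IsProductOneAtom (y ::ₘ (y⁻¹ * u) ::ₘ W) := by
  refine isProductOneAtom_cons_cons hW hy ?_ ?_
  · obtain ⟨l, rfl, hl⟩ := isProductOne_cons_iff.1 hA.1
    exact ⟨y :: (y⁻¹ * u) :: l, rfl, by simpa [mul_assoc] using hl⟩
  · intro T₁ T₂ hs h₁ h₂
    obtain ⟨l₁, l₂, rfl, h⟩ := isProductOne_pair_cons h₁
    have m₁ : l₁.prod ∈ K := K.list_prod_mem fun t ht => hW t (by rw [hs]; simp [ht])
    have m₂ : l₂.prod ∈ K := K.list_prod_mem fun t ht => hW t (by rw [hs]; simp [ht])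
    -- From $y\, l_1\, y^{-1} u\, l_2 = 1$ the conjugate of $l_1$ lies in $K$, so it equals $l_1$.
    -- Hence $l_1 u\, l_2 = 1$, and the splitting becomes one of the original atom.
    have hmem : y * l₁.prod * y⁻¹ ∈ K := by
      have : y * l₁.prod * y⁻¹ = (u * l₂.prod)⁻¹ := by
        rw [eq_inv_iff_mul_eq_one]
        simpa [mul_assoc] using h
      rw [this]
      exact K.inv_mem (K.mul_mem hu m₂)
    have h' : l₁.prod * (u * l₂.prod) = 1 := by
      rw [← hc _ m₁ hmem]
      simpa [mul_assoc] using h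
    rcases hA.2.2 (u ::ₘ ((l₁ ++ l₂ : List G) : Multiset G)) T₂
      ⟨l₁ ++ u :: l₂, by rw [Multiset.cons_coe, Multiset.coe_eq_coe]; exact List.perm_middle,
        by simpa using h'⟩ h₂ (by rw [hs, Multiset.cons_add]) with h0 | h0
    · simp at h0
    · exact h0

theorem notMem_zpowers_of_inverts {g τ : G} {n : ℕ} (hg : orderOf g = n) (hn : 3 ≤ n)
    (hinv : τ * g * τ⁻¹ = g⁻¹) : τ ∉ Subgroup.zpowers g := by
  rintro ⟨i, rfl⟩
  have h2 : g = g⁻¹ := by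
    rw [← hinv]
    simp only [← zpow_neg]
    group
  have h3 : g ^ 2 = 1 := by
    rw [pow_two]
    nth_rw 1 [h2]
    simp
  have := Nat.le_of_dvd (by norm_num) (orderOf_dvd_of_pow_eq_one h3)
  omega

/-- One ordering is $\tau g^{m+1} \tau g^{m+1}$. The only non-empty part over $\langle g \rangle$
that could be split off is $g^{2m+1}$, which leaves $\tau, \tau, g$ without product one. The
six-term atom $m = 1$ serves for $D_3$, the eight-term atom $m = 2$ excludes $D_5$. -/
theorem isProductOneAtom_dihedral {g τ : G} {m : ℕ} (hm : 1 ≤ m) (hg : orderOf g = 2 * m + 1)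
    (hτ : τ * τ = 1) (hinv : τ * g * τ⁻¹ = g⁻¹) :
    IsProductOneAtom (τ ::ₘ τ ::ₘ Multiset.replicate (2 * m + 2) g) := by
  have hτ' : τ⁻¹ = τ := inv_eq_of_mul_eq_one_left hτ
  have hconj : ∀ k : ℕ, τ * g ^ k * τ = (g ^ k)⁻¹ := by
    intro k
    have := congrArg (· ^ k) hinv
    simp only [conj_pow, inv_pow] at this
    rwa [hτ'] at this
  have hK : ∀ t ∈ Multiset.replicate (2 * m + 2) g, t ∈ Subgroup.zpowers g := by
    intro t ht
    rw [Multiset.eq_of_mem_replicate ht]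
    exact Subgroup.mem_zpowers g
  have hnot := notMem_zpowers_of_inverts hg (by omega) hinv
  refine isProductOneAtom_cons_cons hK hnot ?_ ?_
  · refine ⟨τ :: List.replicate (m + 1) g ++ τ :: List.replicate (m + 1) g, ?_, ?_⟩
    · rw [← Multiset.coe_replicate, Multiset.cons_coe, Multiset.cons_coe, Multiset.coe_eq_coe,
        show 2 * m + 2 = (m + 1) + (m + 1) by ring, List.replicate_add (m + 1) (m + 1)]
      exact List.perm_middle (l₁ := τ :: List.replicate (m + 1) g)
    · rw [List.cons_append, List.prod_cons, List.prod_append, List.prod_cons, List.prod_replicate,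
        ← mul_assoc, ← mul_assoc, hconj, inv_mul_cancel]
  · intro T₁ T₂ hs h₁ h₂
    obtain ⟨k, hk, rfl⟩ := Multiset.le_replicate_iff_eq (show T₂ ≤ Multiset.replicate (2 * m + 2) g by
      rw [hs]; exact Multiset.le_add_left _ _)
    obtain ⟨j, hj, rfl⟩ := Multiset.le_replicate_iff_eq (show T₁ ≤ Multiset.replicate (2 * m + 2) g by
      rw [hs]; exact Multiset.le_add_right _ _)
    have hjk : 2 * m + 2 = j + k := by simpa using congrArg Multiset.card hs
    have hdvd := orderOf_dvd_of_pow_eq_one (isProductOne_replicate.1 h₂)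
    rw [hg] at hdvd
    obtain ⟨c, rfl⟩ := hdvd
    rcases Nat.eq_zero_or_pos c with rfl | hc
    · simp
    exfalso
    have hc1 : c = 1 := by
      by_contra hne
      have : 2 ≤ c := by omega
      have := Nat.mul_le_mul_left (2 * m + 1) this
      omega
    subst hc1
    obtain rfl : j = 1 := by omega
    obtain ⟨l₁, l₂, hl, h⟩ := isProductOne_pair_cons h₁
    have hl' : l₁ ++ l₂ = [g] := by
      rw [Multiset.replicate_one, Multiset.coe_eq_singleton] at hl
      exact hl
    have hg1 : g = 1 := by
      rcases List.append_eq_singleton_iff.1 hl' with ⟨rfl, rfl⟩ | ⟨rfl, rfl⟩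
      · simpa [hτ] using h
      · simp only [List.prod_singleton, List.prod_nil, mul_one] at h
        have := hconj 1
        rw [pow_one, h] at this
        exact inv_eq_one.1 this.symm
    rw [hg1, orderOf_one] at hg
    omega

end OddOrder

/-! ### Elements of order five and six -/

section DavenportSix

/-- All atoms over `G` have at most `n` terms. -/
abbrev AtomCardLE (G : Type*) [Group G] (n : ℕ) : Prop :=
  ∀ U : Multiset G, IsProductOneAtom U → U.card ≤ n

variable {G : Type*} [Group G]

/-- Otherwise five copies of $g$ and one element outside $\langle g \rangle$ form a free sequence of
six terms, giving an atom of seven. -/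
theorem zpowers_eq_top_of_orderOf_eq_six (hD : AtomCardLE G 6) {g : G} (hg : orderOf g = 6) :
    Subgroup.zpowers g = ⊤ := by
  by_contra hne
  obtain ⟨x, hx⟩ : ∃ x, x ∉ Subgroup.zpowers g := by
    by_contra hc
    push Not at hc
    exact hne (Subgroup.eq_top_iff' _ |>.2 hc)
  have := ((isProductOneFree_replicate_of_lt_orderOf (g := g) (n := 5) (by omega)).cons
    (fun t ht => by rw [Multiset.eq_of_mem_replicate ht]; exact Subgroup.mem_zpowers g)
    hx).card_add_one_le hD
  simp at this

/-- Two elements $x, y$ with $xKy$ disjoint from $K$ would lengthen the free sequence to at least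
six terms. -/
theorem transitive_on_complement (hD : AtomCardLE G 6) {K : Subgroup G} {T : Multiset G}
    (hT : IsProductOneFree T) (hK : ∀ t ∈ T, t ∈ K) (h4 : 4 ≤ T.card) :
    ∀ x ∉ K, ∀ y ∉ K, ∃ h ∈ K, x * h * y ∈ K := by
  intro x hx y hy
  by_contra hc
  push Not at hc
  have := (hT.cons_cons hK hx hy hc).card_add_one_le hD
  simp at this
  omega

/-- The element $k \cdot \tau k \tau^{-1}$ is fixed under conjugation by $\tau$, hence trivial. -/
theorem inverts_of_no_fixed {K : Subgroup G} {τ : G} (hτ : τ * τ = 1)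
    (hn : ∀ k ∈ K, τ * k * τ⁻¹ ∈ K) (hcomm : ∀ a ∈ K, ∀ b ∈ K, a * b = b * a)
    (hfix : ∀ k ∈ K, τ * k * τ⁻¹ = k → k = 1) {k : G} (hk : k ∈ K) : τ * k * τ⁻¹ = k⁻¹ := by
  have h := hfix _ (K.mul_mem hk (hn k hk)) (by
    rw [hcomm _ hk _ (hn k hk)]
    have hτ' : τ⁻¹ = τ := inv_eq_of_mul_eq_one_left hτ
    rw [hτ']
    calc τ * (τ * k * τ * k) * τ = (τ * τ) * k * (τ * k * τ) := by group
      _ = k * (τ * k * τ) := by rw [hτ, one_mul]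
      _ = τ * k * τ * k := by
        have := hcomm _ hk _ (hn k hk)
        rwa [hτ'] at this)
  exact eq_inv_of_mul_eq_one_right h

/-- Burnside's transfer theorem: $\langle g \rangle$ is an abelian self-normalizing Sylow subgroup,
hence central in its normalizer, and the kernel of the transfer is a normal complement. -/
theorem exists_normal_complement [Finite G] {g : G} {p : ℕ} [hp : Fact p.Prime]
    (hg : orderOf g = p) (hcard : ¬ p ^ 2 ∣ Nat.card G)
    (hN : ∀ x : G, x * g * x⁻¹ ∈ Subgroup.zpowers g → x ∈ Subgroup.zpowers g) :
    ∃ K : Subgroup G, K.Normal ∧ Nat.card G = Nat.card K * p := by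
  have hdvd : p ∣ Nat.card G := hg ▸ orderOf_dvd_natCard g
  have hP : Nat.card (Subgroup.zpowers g) = p ^ (Nat.card G).factorization p := by
    have h1 : (Nat.card G).factorization p = 1 := by
      apply le_antisymm
      · by_contra hlt
        push Not at hlt
        exact hcard ((hp.out.pow_dvd_iff_le_factorization Nat.card_pos.ne').2 hlt)
      · exact (hp.out.dvd_iff_one_le_factorization Nat.card_pos.ne').1 hdvd
    rw [h1, pow_one, Nat.card_zpowers, hg]
  let P : Sylow p G := Sylow.ofCard (Subgroup.zpowers g) hP
  have hle : Subgroup.normalizer (P : Set G) ≤ Subgroup.centralizer (P : Set G) := by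
    intro x hx
    have hx' : x ∈ Subgroup.zpowers g := hN x (by
      have := (Subgroup.mem_normalizer_iff.1 hx g).1 (Subgroup.mem_zpowers g)
      exact this)
    rw [Subgroup.mem_centralizer_iff]
    intro y hy
    have hy' : y ∈ Subgroup.zpowers g := hy
    obtain ⟨i, rfl⟩ := hx'
    obtain ⟨j, rfl⟩ := hy'
    exact zpow_mul_comm g j i
  refine ⟨(MonoidHom.transferSylow P hle).ker, inferInstance, ?_⟩
  have := (MonoidHom.ker_transferSylow_isComplement' P hle).card_mul_card
  rw [← this]
  exact congrArg _ ((Nat.card_zpowers g).trans hg)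

theorem orderOf_mul_eq_six {x g : G} (hg : orderOf g = 3) (hx : orderOf x = 2)
    (hc : x * g = g * x) : orderOf (x * g) = 6 := by
  rw [Commute.orderOf_mul_eq_mul_orderOf_of_coprime (show Commute x g from hc)
    (by rw [hx, hg]; norm_num), hx, hg]

/-- A group all of whose atoms have at most six terms has no element of order five, unless it is
cyclic of order five. -/
theorem orderOf_ne_five [Finite G] (hD : AtomCardLE G 6) (hcard : 6 ≤ Nat.card G) (g : G) :
    orderOf g ≠ 5 := by
  intro hg
  set K := Subgroup.zpowers g with hKdef
  have hKc : Nat.card K = 5 := by rw [hKdef, Nat.card_zpowers, hg]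
  have hcommK : ∀ a ∈ K, ∀ b ∈ K, a * b = b * a := by
    rintro _ ⟨i, rfl⟩ _ ⟨j, rfl⟩
    exact zpow_mul_comm g i j
  obtain ⟨x, hx⟩ : ∃ x, x ∉ K := by
    by_contra hc
    push Not at hc
    have : K = ⊤ := (Subgroup.eq_top_iff' _).2 hc
    rw [this, Subgroup.card_top] at hKc
    omega
  have htr := transitive_on_complement hD
    (isProductOneFree_replicate_of_lt_orderOf (g := g) (n := 4) (by omega)) (K := K)
    (fun t ht => by rw [Multiset.eq_of_mem_replicate ht]; exact Subgroup.mem_zpowers g) (by simp)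
  have hidx := index_eq_of_transitive_on_complement htr hx
  have hd : (MulAction.stabilizer K (x : G ⧸ K)).index ∣ 5 := hKc ▸ Subgroup.index_dvd_card _
  have hmul := K.card_mul_index
  rw [hKc] at hmul
  -- The index of $K$ is two or six. In the first case an involution inverts $g$, and the dihedral
  -- atom has eight terms; in the second case $|G| = 30$.
  rcases (Nat.dvd_prime Nat.prime_five).1 hd with h1 | h5
  · have hidx2 : K.index = 2 := by omega
    have hnorm : K.Normal := Subgroup.normal_of_index_eq_two hidx2
    obtain ⟨τ, hτ⟩ := exists_prime_orderOf_dvd_card' (G := G) 2 (by rw [← hmul, hidx2]; norm_num)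
    have hττ : τ * τ = 1 := by rw [← pow_two, ← hτ]; exact pow_orderOf_eq_one τ
    have hinv : τ * g * τ⁻¹ = g⁻¹ := by
      refine inverts_of_no_fixed (K := K) hττ (fun k hk => hnorm.conj_mem k hk τ) hcommK ?_
        (Subgroup.mem_zpowers g)
      intro k hk hfix
      -- A non-trivial fixed element has order five and commutes with $\tau$, which would give an
      -- element of order ten.
      by_contra hk1
      have hk5 : orderOf k = 5 := by
        have hdv : orderOf k ∣ 5 := by
          have := Subgroup.orderOf_dvd_natCard K hk
          rwa [hKc] at this
        rcases (Nat.dvd_prime Nat.prime_five).1 hdv with h | h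
        · exact absurd (orderOf_eq_one_iff.1 h) hk1
        · exact h
      have h10 : orderOf (τ * k) = 10 := by
        rw [Commute.orderOf_mul_eq_mul_orderOf_of_coprime
          (show Commute τ k from mul_inv_eq_iff_eq_mul.1 hfix) (by rw [hτ, hk5]; norm_num), hτ, hk5]
      have := orderOf_le_of_atom_card_le hD (τ * k)
      omega
    have := hD _ (isProductOneAtom_dihedral (m := 2) (by norm_num) hg hττ hinv)
    simp at this
  · have hidx6 : K.index = 6 := by omega
    have hG : Nat.card G = 30 := by rw [← hmul, hidx6]
    have : Fact (Nat.Prime 5) := ⟨Nat.prime_five⟩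
    -- An element $y \notin K$ normalizing $K$ would make $yK$ a fixed coset, so that transitivity
    -- gives index two instead of six.
    obtain ⟨L, hL, hLc⟩ := exists_normal_complement hg (by rw [hG]; norm_num) (by
      intro y hy
      by_contra hyK
      have hidy := index_eq_of_transitive_on_complement htr hyK
      have htop : MulAction.stabilizer K (y : G ⧸ K) = ⊤ := by
        rw [Subgroup.eq_top_iff']
        rintro ⟨k, hk⟩
        rw [MulAction.mem_stabilizer_iff]
        change ((k * y : G) : G ⧸ K) = y
        rw [QuotientGroup.eq]
        obtain ⟨i, rfl⟩ := hk
        have hmem : y⁻¹ * g * y ∈ K := by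
          have hmap : K.map (MulAut.conj y).toMonoidHom = K := by
            apply Subgroup.eq_of_le_of_card_ge
            · rw [hKdef, MonoidHom.map_zpowers, Subgroup.zpowers_le]
              exact hy
            · rw [Subgroup.card_map_of_injective (MulAut.conj y).injective]
          obtain ⟨k, hk, hk'⟩ : g ∈ K.map (MulAut.conj y).toMonoidHom := by
            rw [hmap]; exact Subgroup.mem_zpowers g
          have : y⁻¹ * g * y = k := by
            rw [← hk']
            simp [mul_assoc]
          rw [this]
          exact hk
        have h2 := K.zpow_mem hmem (-i)
        have h3 : (y⁻¹ * g * y) ^ (-i) = (g ^ i * y)⁻¹ * y := by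
          have := conj_zpow (i := -i) (a := y⁻¹) (b := g)
          rw [inv_inv] at this
          rw [this]
          group
        rwa [h3] at h2
      rw [htop, Subgroup.index_top] at hidy
      omega)
    have hL6 : Nat.card L = 6 := by omega
    have h3 : Fact (Nat.Prime 3) := ⟨Nat.prime_three⟩
    obtain ⟨b, hb⟩ := exists_prime_orderOf_dvd_card' (G := L) 3 (by rw [hL6]; norm_num)
    have hidxb : (Subgroup.zpowers b).index = 2 := by
      have := (Subgroup.zpowers b).card_mul_index
      rw [Nat.card_zpowers, hb, hL6] at this
      omega
    let c : L := ⟨g * b * g⁻¹, hL.conj_mem b b.2 g⟩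
    have hc3 : c ^ 3 = 1 := by
      apply Subtype.ext
      have h1 : ((b : G)) ^ 3 = 1 := by
        have := pow_orderOf_eq_one b
        rw [hb] at this
        exact_mod_cast congrArg Subtype.val this
      change (g * (b : G) * g⁻¹) ^ 3 = 1
      rw [conj_pow, h1]
      simp
    -- The subgroup $\langle b \rangle$ has index two in $L$, so it contains all squares, in
    -- particular $c = c^4$. Thus $g$ normalizes $\langle b \rangle$.
    have hcmem : c ∈ Subgroup.zpowers b := by
      have h4 : c = (c * c) * (c * c) := by
        calc c = c ^ 3 * c := by rw [hc3, one_mul]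
          _ = (c * c) * (c * c) := by simp only [pow_succ, pow_zero, one_mul, mul_assoc]
      rw [h4]
      exact Subgroup.mul_mem _ (Subgroup.mul_self_mem_of_index_two hidxb c)
        (Subgroup.mul_self_mem_of_index_two hidxb c)
    have hb3 : orderOf (b : G) = 3 := by rw [Subgroup.orderOf_coe]; exact hb
    have hno15 : g * b ≠ b * g := by
      intro hcm
      have : orderOf (g * b) = 15 := by
        rw [Commute.orderOf_mul_eq_mul_orderOf_of_coprime (show Commute g (b : G) from hcm)
          (by rw [hg, hb3]; norm_num), hg, hb3]
      have := orderOf_le_of_atom_card_le hD (g * b)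
      omega
    obtain ⟨i, hi⟩ := hcmem
    have hi' : g * (b : G) * g⁻¹ = (b : G) ^ (i : ℤ) := by
      have := congrArg Subtype.val hi
      simpa [c] using this.symm
    have hpow : ∀ k : ℕ, g ^ k * (b : G) * (g ^ k)⁻¹ = (b : G) ^ (i ^ k) := by
      intro k
      induction k with
      | zero => simp
      | succ k ih =>
        calc g ^ (k + 1) * (b : G) * (g ^ (k + 1))⁻¹
            = g * (g ^ k * (b : G) * (g ^ k)⁻¹) * g⁻¹ := by rw [pow_succ']; group
          _ = (g * (b : G) * g⁻¹) ^ (i ^ k) := by rw [ih, conj_zpow]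
          _ = _ := by rw [hi', ← zpow_mul, pow_succ']
    have h5' := hpow 5
    have hg5 : g ^ 5 = 1 := by rw [← hg]; exact pow_orderOf_eq_one g
    rw [hg5] at h5'
    -- Conjugation by $g$ raises $b$ to the power $i$, and $g^5 = 1$ gives $i^5 \equiv 1$, hence $i
    -- \equiv 1$ modulo three. So $g$ commutes with $b$ and $gb$ has order fifteen.
    have hmod : (3 : ℤ) ∣ i ^ 5 - 1 := by
      have : (b : G) ^ (i ^ 5 - 1) = 1 := by rw [zpow_sub_one, ← h5']; simp
      have := orderOf_dvd_iff_zpow_eq_one.2 this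
      rwa [hb3] at this
    have hmod' : (3 : ℤ) ∣ i - 1 := by
      have h3 : i % 3 = 0 ∨ i % 3 = 1 ∨ i % 3 = 2 := by omega
      have e : (i ^ 5 - 1) % 3 = 0 := Int.emod_eq_zero_of_dvd hmod
      rcases h3 with h | h | h <;> simp [Int.sub_emod, pow_succ, Int.mul_emod, h] at e ⊢
      omega
    apply hno15
    have : (b : G) ^ (i - 1) = 1 := by
      apply orderOf_dvd_iff_zpow_eq_one.1
      rwa [hb3]
    have hbi : (b : G) ^ i = b := by
      rw [zpow_sub_one, mul_inv_eq_one] at this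
      exact this
    rw [hbi] at hi'
    exact mul_inv_eq_iff_eq_mul.1 hi'

end DavenportSix

/-! ### The group ring bound for abelian $p$-groups of rank at most two -/

section GroupRing

variable {A : Type*} [CommGroup A] {R : Type*} [CommRing R] {k : Type*} [CommRing k]

/-- The functional reads off the coefficient at the identity. Every group element in the expansion
is $c$ times a subproduct, and none of these is the identity. -/
theorem functional_mul_prod_sub_one_eq_zero (ρ : A →* R) (ε : R →+ k)
    (hε : ∀ c, c ≠ 1 → ε (ρ c) = 0) (l : List A) (c : A)
    (hc : ∀ l' : List A, l'.Sublist l → c * l'.prod ≠ 1) :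
    ε (ρ c * (l.map fun g => ρ g - 1).prod) = 0 := by
  induction l generalizing c with
  | nil => simpa using hε c (by simpa using hc [] (List.Sublist.refl _))
  | cons g l ih =>
    have e : ρ c * ((g :: l).map fun g => ρ g - 1).prod =
        ρ (c * g) * (l.map fun g => ρ g - 1).prod - ρ c * (l.map fun g => ρ g - 1).prod := by
      rw [List.map_cons, List.prod_cons, map_mul]
      ring
    rw [e, map_sub, ih c fun l' h => hc l' (h.cons g), ih (c * g) fun l' h => ?_, sub_zero]
    simpa [mul_assoc] using hc (g :: l') (h.cons_cons g)

/-- Only the empty subproduct contributes to the coefficient at the identity. For a product-one free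
sequence, the product of the $g - 1$ is therefore non-zero. -/
theorem functional_prod_sub_one (ρ : A →* R) (ε : R →+ k) (h1 : ε 1 = 1)
    (hε : ∀ c, c ≠ 1 → ε (ρ c) = 0) (l : List A)
    (hl : ∀ l' : List A, l'.Sublist l → l' ≠ [] → l'.prod ≠ 1) :
    ε (l.map fun g => ρ g - 1).prod = (-1) ^ l.length := by
  induction l with
  | nil => simpa using h1
  | cons g l ih =>
    rw [List.map_cons, List.prod_cons, sub_mul, one_mul, map_sub,
      functional_mul_prod_sub_one_eq_zero ρ ε hε l g fun l' h => ?_,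
      ih fun l' h hne => hl l' (h.cons g) hne, List.length_cons, pow_succ]
    · ring
    · simpa using hl (g :: l') (h.cons_cons g) (by simp)

/-- In each term of the binomial expansion the exponent of $I$ exceeds $n$ or that of $J$ exceeds
$m$. -/
theorem Ideal.sup_pow_add_add_one_le (I J : Ideal R) (n m : ℕ) :
    (I ⊔ J) ^ (n + m + 1) ≤ I ^ (n + 1) ⊔ J ^ (m + 1) := by
  rw [← Ideal.add_eq_sup, ← Ideal.add_eq_sup, add_pow, Ideal.sum_eq_sup]
  apply Finset.sup_le
  intro i _
  by_cases hn : n + 1 ≤ i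
  · exact (Ideal.mul_le_left.trans (Ideal.mul_le_left.trans
      ((Ideal.pow_le_pow_right hn).trans le_sup_left)))
  · refine (Ideal.mul_le_left.trans (Ideal.mul_le_right.trans
      ((Ideal.pow_le_pow_right ?_).trans le_sup_right)))
    omega

/-- A product-one free sequence over an abelian `p`-group generated by elements `a` and `b` with
`a ^ p ^ m = b ^ p ^ n = 1` has at most `p ^ m + p ^ n - 2` terms. -/
theorem IsProductOneFree.card_le_of_two_generators {p : ℕ} [hp : Fact p.Prime] {a b : A} {m n : ℕ}
    (ha : a ^ p ^ m = 1) (hb : b ^ p ^ n = 1) (hab : ∀ g : A, ∃ i j : ℕ, g = a ^ i * b ^ j)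
    {T : Multiset A} (hT : IsProductOneFree T) : T.card + 2 ≤ p ^ m + p ^ n := by
  classical
  by_contra hlt
  push Not at hlt
  induction T using Quotient.inductionOn with
  | _ l =>
  change l.length + 2 > _ at hlt
  let ρ : A →* MonoidAlgebra (ZMod p) A := MonoidAlgebra.of (ZMod p) A
  let ε : MonoidAlgebra (ZMod p) A →+ ZMod p :=
    { toFun := fun f => f.coeff 1, map_zero' := rfl, map_add' := fun _ _ => rfl }
  have hρ : ∀ c, ε (ρ c) = if c = 1 then 1 else 0 := fun c => by
    change (MonoidAlgebra.single c (1 : ZMod p)).coeff 1 = _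
    exact Finsupp.single_apply
  have h1 : ε 1 = 1 := by rw [← map_one ρ, hρ, if_pos rfl]
  have key := functional_prod_sub_one ρ ε h1 (fun c hc => by rw [hρ, if_neg hc]) l (by
    intro l' hl' hne hprod
    refine hne ?_
    have := hT (l' : Multiset A) (Multiset.coe_le.2 hl'.subperm) (IsProductOne.of_list hprod)
    simpa using this)
  have : CharP (MonoidAlgebra (ZMod p) A) p := by
    refine (Algebra.charP_iff (ZMod p) (MonoidAlgebra (ZMod p) A) p).1 inferInstance
  set I : Ideal (MonoidAlgebra (ZMod p) A) := Ideal.span {ρ a - 1}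
  set J : Ideal (MonoidAlgebra (ZMod p) A) := Ideal.span {ρ b - 1}
  -- In characteristic $p$, $(a - 1)^{p^m} = a^{p^m} - 1 = 0$.
  have hI : I ^ (p ^ m) = ⊥ := by
    rw [Ideal.span_singleton_pow, sub_pow_char_pow, one_pow, ← map_pow, ha, map_one, sub_self]
    simp
  have hJ : J ^ (p ^ n) = ⊥ := by
    rw [Ideal.span_singleton_pow, sub_pow_char_pow, one_pow, ← map_pow, hb, map_one, sub_self]
    simp
  have hpow : ∀ (c : A) (i : ℕ), ρ (c ^ i) - 1 ∈ Ideal.span {ρ c - 1} := by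
    intro c i
    rw [Ideal.mem_span_singleton, map_pow]
    exact sub_one_dvd_pow_sub_one _ _
  have hmem : ∀ g, ρ g - 1 ∈ I ⊔ J := by
    intro g
    obtain ⟨i, j, rfl⟩ := hab g
    have e : ρ (a ^ i * b ^ j) - 1 = (ρ (a ^ i) - 1) * ρ (b ^ j) + (ρ (b ^ j) - 1) := by
      rw [map_mul]; ring
    rw [e]
    exact Ideal.add_mem _ (Ideal.mem_sup_left (Ideal.mul_mem_right _ _ (hpow a i)))
      (Ideal.mem_sup_right (hpow b j))
  have hprod : ∀ l : List A, (l.map fun g => ρ g - 1).prod ∈ (I ⊔ J) ^ l.length := by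
    intro l
    induction l with
    | nil => simp
    | cons g l ih =>
      rw [List.map_cons, List.prod_cons, List.length_cons, pow_succ']
      exact Ideal.mul_mem_mul (hmem g) ih
  have hm := (pow_pos hp.out.pos m : 0 < p ^ m)
  have hn := (pow_pos hp.out.pos n : 0 < p ^ n)
  -- The negated bound says that the length is at least $(p^m - 1) + (p^n - 1) + 1$, where the
  -- powers of $I \sqcup J$ vanish.
  have hzero : (I ⊔ J) ^ l.length ≤ ⊥ := by
    have h := Ideal.sup_pow_add_add_one_le I J (p ^ m - 1) (p ^ n - 1)
    rw [Nat.sub_add_cancel hm, Nat.sub_add_cancel hn, hI, hJ, sup_idem] at h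
    exact (Ideal.pow_le_pow_right (by omega)).trans h
  have h0 : (l.map fun g => ρ g - 1).prod = 0 := by simpa using hzero (hprod l)
  rw [h0, map_zero] at key
  exact (pow_ne_zero _ (neg_ne_zero.2 one_ne_zero)) key.symm

/-- Removing a term from an atom over an abelian group leaves a product-one free sequence. -/
theorem IsProductOneAtom.isProductOneFree_of_cons {a : A} {T : Multiset A}
    (h : IsProductOneAtom (a ::ₘ T)) : IsProductOneFree T := by
  intro T' hle h'
  obtain ⟨T'', rfl⟩ := Multiset.le_iff_exists_add.1 hle
  have h'' : IsProductOne (a ::ₘ T'') := by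
    have h1 := isProductOne_iff_prod_eq_one.1 h.1
    rw [isProductOne_iff_prod_eq_one] at h' ⊢
    rwa [Multiset.prod_cons, Multiset.prod_add, h', one_mul, ← Multiset.prod_cons] at h1
  rcases h.2.2 T' (a ::ₘ T'') h' h'' (by rw [Multiset.add_cons]) with h0 | h0
  · exact h0
  · simp at h0

/-- For $C_3^2$ and for $C_4 \times C_2$ this bounds atoms by five terms, which rules both groups
out. -/
theorem IsProductOneAtom.card_lt_of_two_generators {p : ℕ} [hp : Fact p.Prime] {a b : A} {m n : ℕ}
    (ha : a ^ p ^ m = 1) (hb : b ^ p ^ n = 1) (hab : ∀ g : A, ∃ i j : ℕ, g = a ^ i * b ^ j)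
    {U : Multiset A} (hU : IsProductOneAtom U) : U.card < p ^ m + p ^ n := by
  obtain ⟨u, hu⟩ := Multiset.exists_mem_of_ne_zero hU.2.1
  obtain ⟨T, rfl⟩ := Multiset.exists_cons_of_mem hu
  have := hU.isProductOneFree_of_cons.card_le_of_two_generators ha hb hab
  rw [Multiset.card_cons]
  omega

end GroupRing

/-! ### Elements of order three and inverting involutions -/

section OrderThree

variable {G : Type*} [Group G]

/-- An involution commuting with $g$ would produce an element of order six. If $x$ had order four,
$x^2$ would be such an involution. -/
theorem pow_three_eq_one_of_commute (hord : ∀ x : G, 0 < orderOf x ∧ orderOf x ≤ 4) {x g : G}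
    (hg : orderOf g = 3) (hc : x * g = g * x) : x ^ 3 = 1 := by
  have h2 : ∀ t : G, orderOf t = 2 → t * g ≠ g * t := fun t ht h => by
    have := orderOf_mul_eq_six hg ht h
    have := (hord (t * g)).2
    omega
  have h0 := hord x
  have : orderOf x = 1 ∨ orderOf x = 2 ∨ orderOf x = 3 ∨ orderOf x = 4 := by omega
  rcases this with h | h | h | h
  · rw [orderOf_eq_one_iff.1 h, one_pow]
  · exact absurd hc (h2 x h)
  · rw [← h]; exact pow_orderOf_eq_one x
  · refine absurd ?_ (h2 (x ^ 2) ?_)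
    · exact (show Commute x g from hc).pow_left 2
    · rw [orderOf_pow' x (by norm_num), h]; rfl

theorem card_eq_pow_three_of_commute [Finite G] (hord : ∀ x : G, 0 < orderOf x ∧ orderOf x ≤ 4)
    {g : G} (hg : orderOf g = 3) : ∃ n, Nat.card (Subgroup.centralizer ({g} : Set G)) = 3 ^ n := by
  have : Fact (Nat.Prime 3) := ⟨Nat.prime_three⟩
  refine IsPGroup.iff_card.1 fun z => ⟨1, ?_⟩
  apply Subtype.ext
  have hz := Subgroup.mem_centralizer_singleton_iff.1 z.2
  simpa using pow_three_eq_one_of_commute hord hg hz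

theorem exists_subgroup_of_inverts {g τ : G} (hτ : τ * τ = 1) (hinv : τ * g * τ⁻¹ = g⁻¹) :
    ∃ H : Subgroup G, ∀ x, x ∈ H ↔ x ∈ Subgroup.zpowers g ∨ τ * x ∈ Subgroup.zpowers g := by
  have hτ' : τ⁻¹ = τ := inv_eq_of_mul_eq_one_left hτ
  have hc : ∀ k ∈ Subgroup.zpowers g, τ * k * τ ∈ Subgroup.zpowers g := by
    rintro _ ⟨i, rfl⟩
    have : τ * g ^ i * τ = (g ^ i)⁻¹ := by
      have := congrArg (· ^ i) hinv
      simp only [conj_zpow, inv_zpow] at this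
      rwa [hτ'] at this
    change τ * g ^ i * τ ∈ _
    rw [this]
    exact inv_mem (Subgroup.zpow_mem_zpowers g i)
  refine ⟨{ carrier := {x | x ∈ Subgroup.zpowers g ∨ τ * x ∈ Subgroup.zpowers g}
            mul_mem' := ?_
            one_mem' := Or.inl (one_mem _)
            inv_mem' := ?_ }, fun x => Iff.rfl⟩
  · rintro x y (hx | hx) (hy | hy)
    · exact Or.inl (mul_mem hx hy)
    · refine Or.inr ?_
      have : τ * (x * y) = (τ * x * τ) * (τ * y) := by
        calc τ * (x * y) = τ * x * 1 * y := by group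
          _ = _ := by rw [← hτ]; group
      rw [this]
      exact mul_mem (hc x hx) hy
    · refine Or.inr ?_
      rw [← mul_assoc]
      exact mul_mem hx hy
    · refine Or.inl ?_
      have : x * y = (τ * (τ * x) * τ) * (τ * y) := by
        calc x * y = 1 * x * 1 * y := by group
          _ = _ := by rw [← hτ]; group
      rw [this]
      exact mul_mem (hc _ hx) hy
  · rintro x (hx | hx)
    · exact Or.inl (inv_mem hx)
    · refine Or.inr ?_
      have : τ * x⁻¹ = τ * (τ * x)⁻¹ * τ := by
        rw [mul_inv_rev, hτ', mul_assoc, mul_assoc, hτ, mul_one]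
      change τ * x⁻¹ ∈ _
      rw [this]
      exact hc _ (inv_mem hx)

/-- A subgroup isomorphic to the symmetric group of degree three is the whole group, or every
element outside of it conjugates some element of it to a different one. -/
theorem false_of_inverts_of_notMem (hD : AtomCardLE G 6) {g τ y : G} (hg : orderOf g = 3)
    (hτ : τ * τ = 1) (hinv : τ * g * τ⁻¹ = g⁻¹) {H : Subgroup G}
    (hH : ∀ x, x ∈ H ↔ x ∈ Subgroup.zpowers g ∨ τ * x ∈ Subgroup.zpowers g) (hy : y ∉ H)
    (hc : ∀ w ∈ H, y * w * y⁻¹ ∈ H → y * w * y⁻¹ = w) : False := by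
  have hτH : τ ∈ H := (hH τ).2 (Or.inr (by rw [hτ]; exact one_mem _))
  have hgH : g ∈ H := (hH g).2 (Or.inl (Subgroup.mem_zpowers g))
  -- Replacing one term $\tau$ of the six-term atom $\tau^2 g^4$ by $y$ and $y^{-1}\tau$ gives an
  -- atom with seven terms.
  have hA := isProductOneAtom_dihedral (m := 1) le_rfl hg hτ hinv
  have := hD _ (hA.split_term hτH (fun w hw => by
    rcases Multiset.mem_cons.1 hw with rfl | hw
    · exact hτH
    · rw [Multiset.eq_of_mem_replicate hw]; exact hgH) hy hc)
  simp at this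

/-- A subgroup $K$ of order nine is abelian of exponent three. It is not all of $G$ by the group
ring bound. Otherwise four free terms over $K$ restrict the index to $2$, $4$ or $10$, and each
value is contradictory. -/
theorem not_nine_dvd_card [Finite G] (hD : AtomCardLE G 6)
    (h6 : ∃ U : Multiset G, IsProductOneAtom U ∧ U.card = 6)
    (hord : ∀ x : G, 0 < orderOf x ∧ orderOf x ≤ 4) : ¬ 9 ∣ Nat.card G := by
  intro h9
  have h3 : Fact (Nat.Prime 3) := ⟨Nat.prime_three⟩
  obtain ⟨K, hKc⟩ := Sylow.exists_subgroup_card_pow_prime (G := G) 3 (n := 2) (by simpa using h9)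
  have hcomm : ∀ a ∈ K, ∀ b ∈ K, a * b = b * a := by
    intro a ha b hb
    have := (IsPGroup.isMulCommutative_of_card_eq_prime_sq hKc).is_comm.comm ⟨a, ha⟩ ⟨b, hb⟩
    exact congrArg Subtype.val this
  have hcube : ∀ k ∈ K, k ^ 3 = 1 := by
    intro k hk
    have hdv : orderOf k ∣ 3 ^ 2 := hKc ▸ Subgroup.orderOf_dvd_natCard K hk
    obtain ⟨i, hi, hio⟩ := (Nat.dvd_prime_pow Nat.prime_three).1 hdv
    have : i ≤ 1 := by
      by_contra hlt
      have : i = 2 := by omega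
      subst this
      have := (hord k).2
      omega
    exact orderOf_dvd_iff_pow_eq_one.1 (hio ▸ pow_dvd_pow 3 this)
  have hord3 : ∀ k ∈ K, k ≠ 1 → orderOf k = 3 := fun k hk h1 =>
    orderOf_eq_prime (hcube k hk) h1
  obtain ⟨a, haK, ha1⟩ : ∃ a ∈ K, a ≠ 1 := by
    by_contra hc
    push Not at hc
    rw [(Subgroup.eq_bot_iff_forall K).2 hc, Subgroup.card_bot] at hKc
    omega
  have ha := hord3 a haK ha1
  have hAK : Subgroup.zpowers a ≤ K := (Subgroup.zpowers_le).2 haK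
  obtain ⟨b, hbK, hbA⟩ : ∃ b ∈ K, b ∉ Subgroup.zpowers a := by
    by_contra hc
    push Not at hc
    have : K = Subgroup.zpowers a := le_antisymm hc hAK
    rw [this, Nat.card_zpowers, ha] at hKc
    omega
  have hb3 := hcube b hbK
  by_cases htop : K = ⊤
  · obtain ⟨U, hU, hUc⟩ := h6
    let inst : CommGroup G :=
      { ‹Group G› with
        mul_comm := fun x y =>
          hcomm x (htop ▸ Subgroup.mem_top x) y (htop ▸ Subgroup.mem_top y) }
    have hsup : Subgroup.zpowers a ⊔ Subgroup.zpowers b = ⊤ := by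
      apply Subgroup.eq_top_of_card_eq
      have hG : Nat.card G = 3 ^ 2 := by rw [← hKc, htop, Subgroup.card_top]
      have hdv : Nat.card ↥(Subgroup.zpowers a ⊔ Subgroup.zpowers b) ∣ 3 ^ 2 := by
        rw [← hG]; exact Subgroup.card_subgroup_dvd_card _
      obtain ⟨i, hi, hio⟩ := (Nat.dvd_prime_pow Nat.prime_three).1 hdv
      rw [hG, hio]
      have hlt : Nat.card (Subgroup.zpowers a) <
          Nat.card ↥(Subgroup.zpowers a ⊔ Subgroup.zpowers b) := by
        by_contra hle
        push Not at hle
        have := Subgroup.eq_of_le_of_card_ge (show Subgroup.zpowers a ≤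
          Subgroup.zpowers a ⊔ Subgroup.zpowers b from le_sup_left) hle
        apply hbA
        rw [this]
        exact Subgroup.mem_sup_right (Subgroup.mem_zpowers b)
      rw [Nat.card_zpowers, ha, hio] at hlt
      have : i ≠ 0 := by rintro rfl; simp at hlt
      have : i ≠ 1 := by rintro rfl; simp at hlt
      obtain rfl : i = 2 := by omega
      rfl
    have hab : ∀ x : G, ∃ i j : ℕ, x = a ^ i * b ^ j := by
      intro x
      have hx : x ∈ Subgroup.zpowers a ⊔ Subgroup.zpowers b := hsup ▸ Subgroup.mem_top x
      obtain ⟨y, hy, z, hz, rfl⟩ := Subgroup.mem_sup.1 hx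
      obtain ⟨i, rfl⟩ := mem_powers_iff_mem_zpowers.2 hy
      obtain ⟨j, rfl⟩ := mem_powers_iff_mem_zpowers.2 hz
      exact ⟨i, j, rfl⟩
    have := IsProductOneAtom.card_lt_of_two_generators (A := G) (p := 3) (m := 1) (n := 1)
      (a := a) (b := b) (by simpa using hcube a haK) (by simpa using hb3) hab hU
    omega
  obtain ⟨x, hx⟩ : ∃ x, x ∉ K := by
    by_contra hc
    push Not at hc
    exact htop ((Subgroup.eq_top_iff' K).2 hc)
  have hbb : ∀ h ∈ Subgroup.zpowers a, b * h * b ∉ Subgroup.zpowers a := by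
    intro h hh hm
    rw [hcomm b hbK h (hAK hh), mul_assoc] at hm
    have hb2 : b * b ∈ Subgroup.zpowers a := by
      have := mul_mem (inv_mem hh) hm
      simpa using this
    apply hbA
    have : b = (b * b) * (b * b) := by
      calc b = b ^ 3 * b := by rw [hb3, one_mul]
        _ = _ := by simp only [pow_succ, pow_zero, one_mul, mul_assoc]
    rw [this]
    exact mul_mem hb2 hb2
  -- The four terms $b, b, a, a$ form a free sequence because neither $b$ nor $b^2$ lies in $\langle
  -- a \rangle$.
  have hfree := (isProductOneFree_replicate_of_lt_orderOf (g := a) (n := 2) (by omega)).cons_cons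
    (K := Subgroup.zpowers a)
    (fun t ht => by rw [Multiset.eq_of_mem_replicate ht]; exact Subgroup.mem_zpowers a) hbA hbA hbb
  have htr := transitive_on_complement hD hfree (K := K) (fun t ht => by
    rcases Multiset.mem_cons.1 ht with rfl | ht
    · exact hbK
    rcases Multiset.mem_cons.1 ht with rfl | ht
    · exact hbK
    rw [Multiset.eq_of_mem_replicate ht]; exact haK) (by simp)
  have hidx := index_eq_of_transitive_on_complement htr hx
  have hd : (MulAction.stabilizer K (x : G ⧸ K)).index ∣ 3 ^ 2 := hKc ▸ Subgroup.index_dvd_card _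
  have hmul := K.card_mul_index
  rw [hKc] at hmul
  -- The index is $1 + 3^i$, so $|G|$ is $18$, $36$ or $90$. The last order requires an element of
  -- order five.
  obtain ⟨i, hi, hio⟩ := (Nat.dvd_prime_pow Nat.prime_three).1 hd
  have hi3 : i = 0 ∨ i = 1 ∨ i = 2 := by omega
  rcases hi3 with rfl | rfl | rfl
  · have hidx2 : K.index = 2 := by omega
    have hnorm : K.Normal := Subgroup.normal_of_index_eq_two hidx2
    obtain ⟨τ, hτ⟩ := exists_prime_orderOf_dvd_card' (G := G) 2 (by rw [← hmul, hidx2]; norm_num)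
    have hττ : τ * τ = 1 := by rw [← pow_two, ← hτ]; exact pow_orderOf_eq_one τ
    have hτK : τ ∉ K := fun h => by
      by_cases h1 : τ = 1
      · rw [h1, orderOf_one] at hτ; omega
      · have := hord3 τ h h1
        omega
    have hinv : ∀ k ∈ K, τ * k * τ⁻¹ = k⁻¹ := fun k hk =>
      inverts_of_no_fixed (K := K) hττ (fun k hk => hnorm.conj_mem k hk τ) hcomm (by
        intro k hk hfix
        by_contra hk1
        have := orderOf_mul_eq_six (hord3 k hk hk1) hτ (mul_inv_eq_iff_eq_mul.1 hfix)
        have := (hord (τ * k)).2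
        omega) hk
    obtain ⟨H, hH⟩ := exists_subgroup_of_inverts hττ (hinv a haK)
    have hτ' : τ⁻¹ = τ := inv_eq_of_mul_eq_one_left hττ
    refine false_of_inverts_of_notMem hD ha hττ (hinv a haK) hH (y := b) ?_ ?_
    · rw [hH]
      rintro (h | h)
      · exact hbA h
      · exact hτK (by simpa using mul_mem (hAK h) (inv_mem hbK))
    · intro w hw hw'
      rw [hH] at hw hw'
      rcases hw with hw | hw
      · rw [hcomm b hbK w (hAK hw)]; simp
      exfalso
      -- Since $\tau$ inverts $b$, conjugating $w \in \tau\langle a \rangle$ by $b$ multiplies $\tau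
      -- w$ by $b^{-2} = b \notin \langle a \rangle$, so the conjugate leaves the subgroup.
      have e : b * w * b⁻¹ = τ * (τ * w * b) := by
        have h1 : τ * b⁻¹ = b * τ := by
          calc τ * b⁻¹ = τ * (τ * b * τ⁻¹) := by rw [hinv b hbK]
            _ = (τ * τ) * (b * τ⁻¹) := by group
            _ = b * τ := by rw [hττ, one_mul, hτ']
        calc b * w * b⁻¹ = b * (τ * τ) * w * b⁻¹ := by rw [hττ, mul_one]
          _ = (b * τ) * (τ * w) * b⁻¹ := by group
          _ = τ * (b⁻¹ * (τ * w)) * b⁻¹ := by rw [← h1]; group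
          _ = τ * ((τ * w) * b⁻¹) * b⁻¹ := by rw [hcomm _ (inv_mem hbK) _ (hAK hw)]
          _ = τ * (τ * w * (b⁻¹ * b⁻¹)) := by group
          _ = τ * (τ * w * b) := by
            congr 2
            have : b⁻¹ * b⁻¹ * b ^ 3 = b := by group
            rw [hb3, mul_one] at this
            exact this
      rw [e] at hw'
      rcases hw' with h | h
      · refine hτK ?_
        exact (mul_mem_cancel_right (mul_mem (hAK hw) hbK)).1 (hAK h)
      · rw [← mul_assoc, hττ, one_mul] at h
        exact hbA ((mul_mem_cancel_left hw).1 h)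
  · have hG : Nat.card G = 36 := by omega
    have hst : Nat.card (MulAction.stabilizer K (x : G ⧸ K)) = 3 := by
      have := (MulAction.stabilizer K (x : G ⧸ K)).card_mul_index
      rw [hio, hKc] at this
      omega
    obtain ⟨c, hc, hc1⟩ : ∃ c ∈ MulAction.stabilizer K (x : G ⧸ K), c ≠ 1 := by
      by_contra hcon
      push Not at hcon
      rw [(Subgroup.eq_bot_iff_forall _).2 hcon, Subgroup.card_bot] at hst
      omega
    have hmem : x⁻¹ * c * x ∈ K := by
      have h1 : (((c : G) * x : G) : G ⧸ K) = x := hc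
      rw [QuotientGroup.eq] at h1
      have := inv_mem h1
      simpa [mul_assoc] using this
    have hc3 : orderOf (c : G) = 3 := hord3 c c.2 (fun h => hc1 (Subtype.ext h))
    obtain ⟨n, hn⟩ := card_eq_pow_three_of_commute hord hc3
    have hKC : K ≤ Subgroup.centralizer ({(c : G)} : Set G) := fun k hk =>
      Subgroup.mem_centralizer_singleton_iff.2 (hcomm k hk c c.2)
    have hn2 : n ≤ 2 := by
      by_contra hlt
      have h27 : 3 ^ 3 ∣ 36 := by
        rw [← hG]
        exact (pow_dvd_pow 3 (by omega)).trans (hn ▸ Subgroup.card_subgroup_dvd_card _)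
      omega
    have hKCeq : K = Subgroup.centralizer ({(c : G)} : Set G) :=
      Subgroup.eq_of_le_of_card_ge hKC (by
        rw [hn, hKc]; exact Nat.pow_le_pow_right (by norm_num) hn2)
    have htop' : MulAction.stabilizer K (x : G ⧸ K) = ⊤ := by
      -- As $x^{-1} c x \in K$ commutes with $K$, the conjugate $xKx^{-1}$ centralizes $c$ and so
      -- lies in $C(c) = K$. Then $K$ fixes the coset $xK$, although its stabilizer has index three.
      have hconj : K.map (MulAut.conj x).toMonoidHom = K := by
        apply Subgroup.eq_of_le_of_card_ge
        · rintro _ ⟨k, hk, rfl⟩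
          rw [hKCeq, Subgroup.mem_centralizer_singleton_iff]
          have h1 := hcomm k hk _ hmem
          change x * k * x⁻¹ * c = c * (x * k * x⁻¹)
          calc x * k * x⁻¹ * c = x * (k * (x⁻¹ * c * x)) * x⁻¹ := by group
            _ = x * ((x⁻¹ * c * x) * k) * x⁻¹ := by rw [h1]
            _ = _ := by group
        · rw [Subgroup.card_map_of_injective (MulAut.conj x).injective]
      rw [Subgroup.eq_top_iff']
      rintro ⟨k, hk⟩
      rw [MulAction.mem_stabilizer_iff]
      change ((k * x : G) : G ⧸ K) = x
      rw [QuotientGroup.eq]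
      rw [← hconj] at hk
      obtain ⟨k', hk', rfl⟩ := hk
      have := inv_mem hk'
      convert this using 1
      change (x * k' * x⁻¹ * x)⁻¹ * x = _
      group
    rw [htop', Subgroup.index_top] at hio
    omega
  · have hG : Nat.card G = 90 := by omega
    have : Fact (Nat.Prime 5) := ⟨Nat.prime_five⟩
    obtain ⟨t, ht⟩ := exists_prime_orderOf_dvd_card' (G := G) 5 (by rw [hG]; norm_num)
    have := (hord t).2
    omega

/-- The centralizer is a 3-group, and since nine does not divide $|G|$ it is no larger than $\langle
g \rangle$. -/
theorem zpowers_eq_centralizer [Finite G] (hord : ∀ x : G, 0 < orderOf x ∧ orderOf x ≤ 4)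
    (h9 : ¬ 9 ∣ Nat.card G) {g : G} (hg : orderOf g = 3) {x : G} (hx : x * g = g * x) :
    x ∈ Subgroup.zpowers g := by
  obtain ⟨n, hn⟩ := card_eq_pow_three_of_commute hord hg
  have hle : Subgroup.zpowers g ≤ Subgroup.centralizer ({g} : Set G) := by
    rw [Subgroup.zpowers_le, Subgroup.mem_centralizer_singleton_iff]
  have hn1 : n ≤ 1 := by
    by_contra hlt
    apply h9
    exact (pow_dvd_pow 3 (show 2 ≤ n by omega)).trans (hn ▸ Subgroup.card_subgroup_dvd_card _)
  have := Subgroup.eq_of_le_of_card_ge hle (by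
    rw [hn, Nat.card_zpowers, hg]
    exact (Nat.pow_le_pow_right (by norm_num) hn1).trans (by norm_num))
  rw [this]
  exact Subgroup.mem_centralizer_singleton_iff.2 hx

/-- An element of order three that is conjugate to its inverse is inverted by an involution. -/
theorem exists_involution_inverting [Finite G] (hord : ∀ x : G, 0 < orderOf x ∧ orderOf x ≤ 4)
    (h9 : ¬ 9 ∣ Nat.card G) {g : G} (hg : orderOf g = 3) {x : G}
    (hx : x * g * x⁻¹ ∈ Subgroup.zpowers g) (hxg : x ∉ Subgroup.zpowers g) :
    x * x = 1 ∧ x * g * x⁻¹ = g⁻¹ := by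
  have hcent := @zpowers_eq_centralizer G _ _ hord h9 g hg
  have hg3 : g ^ 3 = 1 := by rw [← hg]; exact pow_orderOf_eq_one g
  have hinv : x * g * x⁻¹ = g⁻¹ := by
    classical
    obtain ⟨i, hi, hi'⟩ := (mem_zpowers_iff_mem_range_orderOf.1 hx) |> Finset.mem_image.1
    rw [hg, Finset.mem_range] at hi
    have : i = 0 ∨ i = 1 ∨ i = 2 := by omega
    rcases this with rfl | rfl | rfl
    · rw [pow_zero] at hi'
      have := conj_eq_one_iff.1 hi'.symm
      rw [this, orderOf_one] at hg
      omega
    · rw [pow_one] at hi'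
      exact absurd (hcent (mul_inv_eq_iff_eq_mul.1 hi'.symm)) hxg
    · rw [← hi', eq_inv_iff_mul_eq_one, ← pow_succ]
      exact hg3
  refine ⟨?_, hinv⟩
  -- The square centralizes $g$, so $x^6 = 1$. Among the admissible orders, order three would give
  -- $x = (x^2)^2 \in \langle g \rangle$, and order two remains.
  have hsq : x * x ∈ Subgroup.zpowers g := by
    apply hcent
    have : x * x * g * (x * x)⁻¹ = g := by
      calc x * x * g * (x * x)⁻¹ = x * (x * g * x⁻¹) * x⁻¹ := by group
        _ = x * g⁻¹ * x⁻¹ := by rw [hinv]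
        _ = (x * g * x⁻¹)⁻¹ := by group
        _ = g := by rw [hinv, inv_inv]
    exact mul_inv_eq_iff_eq_mul.1 this
  have hcube : (x * x) ^ 3 = 1 := by
    have := Subgroup.orderOf_dvd_natCard _ hsq
    rw [Nat.card_zpowers, hg] at this
    exact orderOf_dvd_iff_pow_eq_one.1 this
  have h6 : orderOf x ∣ 6 := orderOf_dvd_of_pow_eq_one (by rw [← hcube, ← pow_two, ← pow_mul])
  have hle := hord x
  have : orderOf x = 1 ∨ orderOf x = 2 ∨ orderOf x = 3 ∨ orderOf x = 4 := by omega
  rcases this with h | h | h | h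
  · exact absurd (orderOf_eq_one_iff.1 h ▸ one_mem _) hxg
  · rw [← pow_two, ← h]; exact pow_orderOf_eq_one x
  · refine absurd ?_ hxg
    have hx3 : x ^ 3 = 1 := by rw [← h]; exact pow_orderOf_eq_one x
    have : x = (x * x) * (x * x) := by
      calc x = x ^ 3 * x := by rw [hx3, one_mul]
        _ = _ := by simp only [pow_succ, pow_zero, one_mul, mul_assoc]
    rw [this]
    exact mul_mem hsq hsq
  · rw [h] at h6; omega

/-- If an element of order three is inverted by an involution, together they generate `G`. -/
theorem mem_zpowers_or_of_inverts [Finite G] (hD : AtomCardLE G 6)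
    (hord : ∀ x : G, 0 < orderOf x ∧ orderOf x ≤ 4) (h9 : ¬ 9 ∣ Nat.card G) {g τ : G}
    (hg : orderOf g = 3) (hτ : τ * τ = 1) (hinv : τ * g * τ⁻¹ = g⁻¹) (x : G) :
    x ∈ Subgroup.zpowers g ∨ τ * x ∈ Subgroup.zpowers g := by
  obtain ⟨H, hH⟩ := exists_subgroup_of_inverts hτ hinv
  rw [← hH]
  by_contra hxH
  have hcent := @zpowers_eq_centralizer G _ _ hord h9 g hg
  have hτ' : τ⁻¹ = τ := inv_eq_of_mul_eq_one_left hτ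
  have hle : ∀ k ∈ Subgroup.zpowers g, k ∈ H := fun k hk => (hH k).2 (Or.inl hk)
  have hcube : ∀ k ∈ Subgroup.zpowers g, k ^ 3 = 1 := by
    intro k hk
    have := Subgroup.orderOf_dvd_natCard _ hk
    rw [Nat.card_zpowers, hg] at this
    exact orderOf_dvd_iff_pow_eq_one.1 this
  have hconj : ∀ k ∈ Subgroup.zpowers g, τ * k * τ = k⁻¹ := by
    rintro _ ⟨i, rfl⟩
    have := congrArg (· ^ i) hinv
    simp only [conj_zpow, inv_zpow] at this
    rwa [hτ'] at this
  have hsq : ∀ w ∈ H, w ∉ Subgroup.zpowers g → w * w = 1 := by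
    intro w hw hw'
    have h1 := hconj _ (((hH w).1 hw).resolve_left hw')
    rw [← mul_assoc, hτ, one_mul, eq_inv_iff_mul_eq_one] at h1
    calc w * w = w * (τ * τ) * w := by rw [hτ, mul_one]
      _ = w * τ * (τ * w) := by group
      _ = 1 := h1
  -- A conjugate of $g$ inside $H$ has order three and so lies in $\langle g \rangle$. Then $y \in
  -- \langle g \rangle$, or $y$ inverts $g$ and $\tau y$ centralizes it.
  have hA : ∀ y : G, y * g * y⁻¹ ∈ H → y ∈ H := by
    intro y hy
    have h3 : orderOf (y * g * y⁻¹) = 3 := by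
      rw [← hg]; exact orderOf_injective (MulAut.conj y).toMonoidHom (MulAut.conj y).injective g
    have hz : y * g * y⁻¹ ∈ Subgroup.zpowers g := by
      by_contra hz
      have h1 := hsq _ hy hz
      rw [← pow_two] at h1
      have := Nat.le_of_dvd (by norm_num) (orderOf_dvd_of_pow_eq_one h1)
      omega
    by_cases hyg : y ∈ Subgroup.zpowers g
    · exact hle y hyg
    have hyinv := (exists_involution_inverting hord h9 hg hz hyg).2
    refine (hH y).2 (Or.inr (hcent ?_))
    have : τ * y * g * (τ * y)⁻¹ = g := by
      calc τ * y * g * (τ * y)⁻¹ = τ * (y * g * y⁻¹) * τ⁻¹ := by group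
        _ = τ * g⁻¹ * τ⁻¹ := by rw [hyinv]
        _ = (τ * g * τ⁻¹)⁻¹ := by group
        _ = g := by rw [hinv, inv_inv]
    exact mul_inv_eq_iff_eq_mul.1 this
  have hB : ∀ y ∉ H, ∀ w ∈ Subgroup.zpowers g, y * w * y⁻¹ ∈ H → w = 1 := by
    intro y hy w hw hyw
    by_contra hw1
    apply hy
    apply hA
    classical
    obtain ⟨i, hi, rfl⟩ := (mem_zpowers_iff_mem_range_orderOf.1 hw) |> Finset.mem_image.1
    rw [hg, Finset.mem_range] at hi
    have : i = 0 ∨ i = 1 ∨ i = 2 := by omega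
    have hg3 := hcube g (Subgroup.mem_zpowers g)
    rcases this with rfl | rfl | rfl
    · simp at hw1
    · simpa using hyw
    · have hg2 : g ^ 2 = g⁻¹ := by rw [eq_inv_iff_mul_eq_one, ← pow_succ]; exact hg3
      rw [hg2] at hyw
      have := inv_mem hyw
      rwa [show (y * g⁻¹ * y⁻¹)⁻¹ = y * g * y⁻¹ by group] at this
  -- The aim is an element outside $H$ that fixes every element of $H$ whose conjugate stays in $H$.
  -- If $x$ sends an involution of $H$ into $H$, it is first corrected by a rotation; otherwise $x$
  -- itself serves.
  by_cases hcase : ∃ w ∈ H, w ∉ Subgroup.zpowers g ∧ x * w * x⁻¹ ∈ H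
  · obtain ⟨w₀, hw₀, hw₀', hw₁⟩ := hcase
    have hτw₀ := ((hH w₀).1 hw₀).resolve_left hw₀'
    have hw₁' : x * w₀ * x⁻¹ ∉ Subgroup.zpowers g := by
      intro h
      have h1 : (x * w₀ * x⁻¹) ^ 3 = 1 := hcube _ h
      rw [conj_pow, conj_eq_one_iff, pow_succ, pow_two, hsq w₀ hw₀ hw₀', one_mul] at h1
      exact hw₀' (h1 ▸ one_mem _)
    have hτw₁ := ((hH _).1 hw₁).resolve_left hw₁'
    set w₁ := x * w₀ * x⁻¹ with hw₁def
    -- Conjugation by a rotation $k$ turns $\tau r$ into $\tau r k^{-2} = \tau r k$, so this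
    -- quotient of rotation parts carries $w_1$ back to $w_0$.
    set k := (τ * w₁)⁻¹ * (τ * w₀) with hk
    have hkz : k ∈ Subgroup.zpowers g := mul_mem (inv_mem hτw₁) hτw₀
    have hcommz : ∀ a ∈ Subgroup.zpowers g, ∀ b ∈ Subgroup.zpowers g, a * b = b * a := by
      rintro _ ⟨i, rfl⟩ _ ⟨j, rfl⟩
      exact zpow_mul_comm g i j
    have hkw : k * w₁ * k⁻¹ = w₀ := by
      have e1 : w₁ = τ * (τ * w₁) := by rw [← mul_assoc, hτ, one_mul]
      have e0 : τ * (τ * w₀) = w₀ := by rw [← mul_assoc, hτ, one_mul]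
      have e2 : k * τ = τ * k⁻¹ := by
        rw [← hconj k hkz, ← mul_assoc, ← mul_assoc, hτ, one_mul]
      have e3 : k⁻¹ * k⁻¹ = k := by
        have : k⁻¹ * k⁻¹ * k ^ 3 = k := by group
        rwa [hcube k hkz, mul_one] at this
      calc k * w₁ * k⁻¹ = k * (τ * (τ * w₁)) * k⁻¹ := by rw [← e1]
        _ = k * τ * ((τ * w₁) * k⁻¹) := by group
        _ = τ * k⁻¹ * (k⁻¹ * (τ * w₁)) := by rw [e2, hcommz _ hτw₁ _ (inv_mem hkz)]
        _ = τ * (k⁻¹ * k⁻¹ * (τ * w₁)) := by group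
        _ = τ * ((τ * w₁) * k) := by rw [e3, hcommz _ hτw₁ _ hkz]
        _ = τ * (τ * w₀) := by rw [hk, mul_inv_cancel_left]
        _ = w₀ := e0
    have hy : k * x ∉ H := fun h => hxH ((mul_mem_cancel_left (hle k hkz)).1 h)
    have hyw₀ : k * x * w₀ * (k * x)⁻¹ = w₀ := by
      calc k * x * w₀ * (k * x)⁻¹ = k * (x * w₀ * x⁻¹) * k⁻¹ := by group
        _ = w₀ := hkw
    refine false_of_inverts_of_notMem hD hg hτ hinv hH hy fun w hw hw' => ?_
    by_cases hwz : w ∈ Subgroup.zpowers g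
    · rw [hB _ hy w hwz hw']; simp
    · have hτw := ((hH w).1 hw).resolve_left hwz
      -- Two involutions of $H$ differ by a rotation. As $kx$ fixes $w_0$, it keeps this rotation
      -- inside $H$, so the rotation is trivial and $w = w_0$.
      have hz : w₀⁻¹ * w ∈ Subgroup.zpowers g := by
        have : w₀⁻¹ * w = (τ * w₀)⁻¹ * (τ * w) := by group
        rw [this]
        exact mul_mem (inv_mem hτw₀) hτw
      have h1 := hB _ hy _ hz (by
        have : k * x * (w₀⁻¹ * w) * (k * x)⁻¹ =
            (k * x * w₀ * (k * x)⁻¹)⁻¹ * (k * x * w * (k * x)⁻¹) := by group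
        rw [this, hyw₀]
        exact mul_mem (inv_mem hw₀) hw')
      rw [inv_mul_eq_one] at h1
      rw [← h1, hyw₀]
  · push Not at hcase
    refine false_of_inverts_of_notMem hD hg hτ hinv hH hxH fun w hw hw' => ?_
    by_cases hwz : w ∈ Subgroup.zpowers g
    · rw [hB _ hxH w hwz hw']; simp
    · exact absurd hw' (hcase w hw hwz)

end OrderThree

/-! ### Excluding self-normalizing subgroups of order three -/

section Alternating

variable {G : Type*} [Group G]

/-- The sequence `g² g⁻² t³` is an atom whenever `t` is an involution such that the product of its
three conjugates under the element `g` of order three is trivial. -/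
theorem isProductOneAtom_of_orbit_product {g t : G} (hg : orderOf g = 3) (ht : t * t = 1)
    (htg : t ∉ Subgroup.zpowers g) (h : t * (g * t * g⁻¹) * (g ^ 2 * t * (g ^ 2)⁻¹) = 1) :
    IsProductOneAtom (Multiset.replicate 3 t +
      (Multiset.replicate 2 g + Multiset.replicate 2 g⁻¹)) := by
  classical
  have ht1 : t ≠ 1 := fun h1 => htg (h1 ▸ one_mem _)
  set W : Multiset G := Multiset.replicate 2 g + Multiset.replicate 2 g⁻¹ with hW
  have hWz : ∀ w ∈ W, w ∈ Subgroup.zpowers g := by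
    intro w hw
    rcases Multiset.mem_add.1 hw with hw | hw
    · rw [Multiset.eq_of_mem_replicate hw]; exact Subgroup.mem_zpowers g
    · rw [Multiset.eq_of_mem_replicate hw]; exact inv_mem (Subgroup.mem_zpowers g)
  have htW : t ∉ W := fun h => htg (hWz t h)
  have aux : ∀ U₁ U₂ : Multiset G, IsProductOne U₁ → IsProductOne U₂ →
      Multiset.replicate 3 t + W = U₁ + U₂ → U₂.count t = 0 → U₂ = 0 := by
    intro U₁ U₂ h₁ h₂ hs hc
    obtain ⟨A, hA, B, hB, hAB⟩ := Multiset.exists_add_of_le_add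
      (show U₂ ≤ Multiset.replicate 3 t + W by rw [hs]; exact Multiset.le_add_left _ _)
    obtain ⟨n, -, rfl⟩ := Multiset.le_replicate_iff_eq hA
    have hn : n = 0 := by
      rw [hAB, Multiset.count_add, Multiset.count_replicate_self] at hc
      omega
    subst hn
    rw [Multiset.replicate_zero, zero_add] at hAB
    subst hAB
    obtain ⟨C, hC, D, hD, rfl⟩ := Multiset.exists_add_of_le_add hB
    obtain ⟨a, ha, rfl⟩ := Multiset.le_replicate_iff_eq hC
    obtain ⟨b, hb, rfl⟩ := Multiset.le_replicate_iff_eq hD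
    -- The product $g^{a-b}$ is trivial only if three divides $a - b$, while $a, b \le 2$.
    have hab : a = b := by
      obtain ⟨l, hl, hp⟩ := h₂
      have hprod : ∀ l : List G, (∀ x ∈ l, x = g ∨ x = g⁻¹) →
          ∃ p q : ℕ, (l : Multiset G) = Multiset.replicate p g + Multiset.replicate q g⁻¹ ∧
            l.prod = g ^ ((p : ℤ) - q) := by
        intro l
        induction l with
        | nil => exact fun _ => ⟨0, 0, by simp, by simp⟩
        | cons x l ih =>
          intro hx
          obtain ⟨p, q, h1, h2⟩ := ih fun y hy => hx y (List.mem_cons_of_mem _ hy)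
          rcases hx x List.mem_cons_self with rfl | rfl
          · refine ⟨p + 1, q, ?_, ?_⟩
            · rw [← Multiset.cons_coe, h1, Multiset.replicate_succ, Multiset.cons_add]
            · rw [List.prod_cons, h2, ← zpow_one_add]
              congr 1; push_cast; ring
          · refine ⟨p, q + 1, ?_, ?_⟩
            · rw [← Multiset.cons_coe, h1, Multiset.replicate_succ, Multiset.add_cons]
            · rw [List.prod_cons, h2, ← zpow_neg_one, ← zpow_add]
              congr 1; push_cast; ring
      obtain ⟨p, q, h1, h2⟩ := hprod l (by
        intro x hx
        have : x ∈ Multiset.replicate a g + Multiset.replicate b g⁻¹ := by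
          rw [← hl]; simpa using hx
        rcases Multiset.mem_add.1 this with h | h
        · exact Or.inl (Multiset.eq_of_mem_replicate h)
        · exact Or.inr (Multiset.eq_of_mem_replicate h))
      have hne : g⁻¹ ≠ g := by
        intro he
        have h1 : g ^ 2 = 1 := by rw [pow_two]; nth_rw 1 [← he]; simp
        have := Nat.le_of_dvd (by norm_num) (orderOf_dvd_of_pow_eq_one h1)
        omega
      rw [hl] at h1
      have e1 := congrArg (Multiset.count g) h1
      have e2 := congrArg (Multiset.count g⁻¹) h1
      simp only [Multiset.count_add, Multiset.count_replicate, hne, hne.symm, if_true, if_false,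
        add_zero, zero_add] at e1 e2
      rw [hp] at h2
      have := orderOf_dvd_iff_zpow_eq_one.2 h2.symm
      rw [hg] at this
      omega
    subst hab
    have ha3 : a = 0 ∨ a = 1 ∨ a = 2 := by omega
    rcases ha3 with rfl | rfl | rfl
    · simp
    · exfalso
      have hU : U₁ = g ::ₘ g⁻¹ ::ₘ Multiset.replicate 3 t := by
        have e : U₁ + (Multiset.replicate 1 g + Multiset.replicate 1 g⁻¹) =
            (g ::ₘ g⁻¹ ::ₘ Multiset.replicate 3 t) +
              (Multiset.replicate 1 g + Multiset.replicate 1 g⁻¹) := by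
          rw [← hs, hW]
          simp only [Multiset.replicate_succ, Multiset.replicate_zero, ← Multiset.singleton_add]
          abel
        exact add_right_cancel e
      rw [hU] at h₁
      obtain ⟨l₁, l₂, hl, hp⟩ := isProductOne_pair_cons h₁
      rw [← Multiset.coe_replicate, Multiset.coe_eq_coe, List.perm_replicate] at hl
      obtain ⟨hlen, e₁, e₂⟩ := List.append_eq_replicate_iff.1 hl
      rw [e₁, e₂, List.prod_replicate, List.prod_replicate] at hp
      have ht3 : t ^ 3 = t := by rw [pow_succ, pow_two, ht, one_mul]
      -- In $g t^i g^{-1} t^j = 1$ with $i + j = 3$ one exponent is even, which forces $t = 1$.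
      have h0 : l₁.length = 0 ∧ l₂.length = 3 ∨ l₁.length = 1 ∧ l₂.length = 2 ∨
          l₁.length = 2 ∧ l₂.length = 1 ∨ l₁.length = 3 ∧ l₂.length = 0 := by omega
      rcases h0 with ⟨e, e'⟩ | ⟨e, e'⟩ | ⟨e, e'⟩ | ⟨e, e'⟩ <;> rw [e, e'] at hp <;>
        simp [pow_two, ht, ht3, ht1] at hp
    · exfalso
      have hU : U₁ = Multiset.replicate 3 t := add_right_cancel hs.symm
      rw [hU, isProductOne_replicate, pow_succ, pow_two, ht, one_mul] at h₁
      exact ht1 h₁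
  -- As $t \notin \langle g \rangle$, no part contains $t$ exactly once, so all three copies lie in
  -- the same part.
  have aux1 : ∀ U₁ U₂ : Multiset G, IsProductOne U₂ →
      Multiset.replicate 3 t + W = U₁ + U₂ → U₂.count t ≠ 1 := by
    intro U₁ U₂ h₂ hs hc
    obtain ⟨V, rfl⟩ := Multiset.exists_cons_of_mem
      (Multiset.count_pos.1 (show 0 < U₂.count t by omega))
    refine not_isProductOne_cons (K := Subgroup.zpowers g) ?_ htg h₂
    intro v hv
    have hm : v ∈ Multiset.replicate 3 t + W := by rw [hs]; simp [hv]
    rcases Multiset.mem_add.1 hm with hm | hm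
    · rw [Multiset.eq_of_mem_replicate hm] at hv
      rw [Multiset.count_cons_self] at hc
      have := Multiset.count_pos.2 hv
      omega
    · exact hWz v hm
  refine ⟨?_, by simp [Multiset.replicate_succ], fun U₁ U₂ h₁ h₂ hs => ?_⟩
  · refine ⟨[t, g, t, g, t, g⁻¹, g⁻¹], ?_, ?_⟩
    · simp only [hW, Multiset.replicate_succ, Multiset.replicate_zero, ← Multiset.singleton_add,
        ← Multiset.cons_coe, Multiset.coe_nil]
      abel
    · rw [← h]
      simp [pow_two, mul_assoc]
  · have hcount := congrArg (Multiset.count t) hs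
    have hcW := Multiset.count_eq_zero.2 htW
    clear_value W
    rw [Multiset.count_add, Multiset.count_add, Multiset.count_replicate_self, hcW] at hcount
    have n1 := aux1 U₁ U₂ h₂ hs
    have n2 := aux1 U₂ U₁ h₁ (by rw [hs, add_comm])
    have : U₂.count t = 0 ∨ U₁.count t = 0 := by omega
    rcases this with h0 | h0
    · exact Or.inr (aux U₁ U₂ h₁ h₂ hs h0)
    · exact Or.inl (aux U₂ U₁ h₂ h₁ (by rw [hs, add_comm]) h0)

/-- Otherwise $\langle g \rangle$ has a normal complement $K$ on which $g$ acts without non-trivial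
fixed points. Then $K$ is a 2-group of order at most eight and congruent to one modulo three; the
case $|K| = 4$ yields a seven-term atom. -/
theorem exists_conj_mem_zpowers [Finite G] (hD : AtomCardLE G 6) (hcard : 6 ≤ Nat.card G)
    (hord : ∀ x : G, 0 < orderOf x ∧ orderOf x ≤ 4) (h9 : ¬ 9 ∣ Nat.card G) {g : G}
    (hg : orderOf g = 3) :
    ∃ x : G, x * g * x⁻¹ ∈ Subgroup.zpowers g ∧ x ∉ Subgroup.zpowers g := by
  by_contra hc
  push Not at hc
  have h3 : Fact (Nat.Prime 3) := ⟨Nat.prime_three⟩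
  have h2 : Fact (Nat.Prime 2) := ⟨Nat.prime_two⟩
  obtain ⟨K, hK, hKc⟩ := exists_normal_complement hg h9 hc
  have hnofix : ∀ k ∈ K, g * k * g⁻¹ = k → k = 1 := by
    intro k hk hfix
    have hk3 := pow_three_eq_one_of_commute hord hg (mul_inv_eq_iff_eq_mul.1 hfix).symm
    have hdvd : orderOf k ∣ Nat.card K := Subgroup.orderOf_dvd_natCard K hk
    rcases (Nat.dvd_prime Nat.prime_three).1 (orderOf_dvd_of_pow_eq_one hk3) with h | h
    · exact orderOf_eq_one_iff.1 h
    · exfalso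
      apply h9
      rw [hKc]
      rw [h] at hdvd
      exact Nat.mul_dvd_mul hdvd (dvd_refl 3)
  -- Conjugation by $g$ is a permutation of $K$ with cube one and the identity as its only fixed
  -- point.
  have hmod : Nat.card K ≡ 1 [MOD 3] := by
    classical
    have := Fintype.ofFinite K
    let f : Function.End K := fun k => MulAut.conjNormal g k
    have hfv : ∀ k : K, ((f k : K) : G) = g * k * g⁻¹ := fun k => MulAut.conjNormal_apply g k
    have hg3 : g ^ 3 = 1 := by rw [← hg]; exact pow_orderOf_eq_one g
    have hf3 : f ^ 3 ^ 1 = 1 := by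
      refine funext fun k => Subtype.ext ?_
      have : (((f ^ 3) k : K) : G) = g ^ 3 * k * (g ^ 3)⁻¹ := by
        change ((f (f (f k)) : K) : G) = _
        rw [hfv, hfv, hfv]
        simp [pow_succ, mul_assoc]
      rw [pow_one, this, hg3, one_mul, inv_one, mul_one]
      rfl
    have h1 := Equiv.Perm.card_fixedPoints_modEq (p := 3) (n := 1) hf3
    have hfp : Fintype.card (Function.fixedPoints f) = 1 := by
      rw [Fintype.card_eq_one_iff]
      refine ⟨⟨1, ?_⟩, ?_⟩
      · apply Subtype.ext
        rw [hfv]; simp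
      · rintro ⟨k, hk⟩
        apply Subtype.ext
        apply Subtype.ext
        exact hnofix k k.2 ((hfv k).symm.trans (congrArg Subtype.val hk))
    rw [hfp, ← Nat.card_eq_fintype_card] at h1
    exact h1
  obtain ⟨n, hn⟩ : ∃ n, Nat.card K = 2 ^ n := by
    refine ⟨_, Nat.eq_prime_pow_of_unique_prime_dvd Nat.card_pos.ne' ?_⟩
    intro p hp hpd
    have : Fact p.Prime := ⟨hp⟩
    obtain ⟨t, ht⟩ := exists_prime_orderOf_dvd_card' (G := K) p hpd
    have h4 := (hord (t : G)).2
    rw [Subgroup.orderOf_coe, ht] at h4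
    have : p ≠ 3 := by
      rintro rfl
      exact h9 (hKc ▸ Nat.mul_dvd_mul hpd (dvd_refl 3))
    have : p ≠ 4 := by rintro rfl; revert hp; norm_num
    have := hp.two_le
    omega
  have hn3 : n ≤ 3 := by
    obtain ⟨K', T, hK'c, hT, hfree, hTc⟩ := isProductOneFree_zero.exists_of_card_eq_pow (p := 2)
      (K := (⊥ : Subgroup G)) (a := 0) (by simp) (by simp) n (by
        rw [zero_add, ← hn]; exact Subgroup.card_subgroup_dvd_card K)
    -- The chain was built inside $G$. Its members satisfy $x^4 = 1$ and $x^3 \in K$, hence $x \in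
    -- K$.
    have hK'K : K' ≤ K := by
      intro x hx
      have hx4 : orderOf x ∣ 4 := by
        have hdv : orderOf x ∣ 2 ^ (0 + n) := hK'c ▸ Subgroup.orderOf_dvd_natCard K' hx
        obtain ⟨i, -, hio⟩ := (Nat.dvd_prime_pow Nat.prime_two).1 hdv
        have : i ≤ 2 := by
          by_contra hlt
          have h8 : 2 ^ 3 ≤ 2 ^ i := Nat.pow_le_pow_right (by norm_num) (by omega)
          have := (hord x).2
          omega
        rw [hio]
        exact pow_dvd_pow 2 this
      have hidx : K.index = 3 := by
        have h := K.card_mul_index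
        rw [hKc] at h
        exact Nat.eq_of_mul_eq_mul_left Nat.card_pos h
      have h1 := K.pow_index_mem x
      rw [hidx] at h1
      have : x = x ^ 4 * (x ^ 3)⁻¹ := by group
      rw [this, orderOf_dvd_iff_pow_eq_one.1 hx4, one_mul]
      exact inv_mem h1
    have hgK : g ∉ K := by
      intro h
      have : orderOf g ∣ Nat.card K := Subgroup.orderOf_dvd_natCard K h
      rw [hg, hn] at this
      have := (Nat.prime_dvd_prime_iff_eq Nat.prime_three Nat.prime_two).1
        (Nat.prime_three.dvd_of_dvd_pow this)
      omega
    have hghg : ∀ h ∈ K, g * h * g ∉ K := by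
      intro h hh hm
      have e : g * h * g = (g * h * g⁻¹) * (g * g) := by group
      rw [e, mul_mem_cancel_left (hK.conj_mem h hh g)] at hm
      apply hgK
      have hg3 : g ^ 3 = 1 := by rw [← hg]; exact pow_orderOf_eq_one g
      have : g = (g * g) * (g * g) := by
        calc g = g ^ 3 * g := by rw [hg3, one_mul]
          _ = _ := by simp only [pow_succ, pow_zero, one_mul, mul_assoc]
      rw [this]
      exact mul_mem hm hm
    -- Appending $g, g$ to the $n$ free terms gives an atom with $n + 3$ terms, so $n \le 3$.
    have := (hfree.cons_cons (K := K) (fun t ht => hK'K (hT t ht)) hgK hgK hghg).card_add_one_le hD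
    rw [Multiset.card_cons, Multiset.card_cons, hTc] at this
    simp at this
    omega
  have hn' : n = 0 ∨ n = 1 ∨ n = 2 ∨ n = 3 := by omega
  rw [hn] at hmod hKc
  rcases hn' with rfl | rfl | rfl | rfl
  · omega
  · revert hmod; decide
  · obtain ⟨t, ht⟩ := exists_prime_orderOf_dvd_card' (G := K) 2 (by rw [hn]; norm_num)
    have hcomm : ∀ a ∈ K, ∀ b ∈ K, a * b = b * a := by
      intro a ha b hb
      have := (IsPGroup.isMulCommutative_of_card_eq_prime_sq hn).is_comm.comm ⟨a, ha⟩ ⟨b, hb⟩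
      exact congrArg Subtype.val this
    have htt : (t : G) * t = 1 := by
      have := pow_orderOf_eq_one t
      rw [ht, pow_two] at this
      exact congrArg Subtype.val this
    have htg : (t : G) ∉ Subgroup.zpowers g := by
      intro h
      have := Subgroup.orderOf_dvd_natCard _ h
      rw [Nat.card_zpowers, hg, Subgroup.orderOf_coe, ht] at this
      omega
    have m1 := hK.conj_mem t t.2 g
    have m2 := hK.conj_mem t t.2 (g ^ 2)
    -- Conjugation by $g$ permutes the three conjugates of $t$ cyclically, so their product in the
    -- abelian group $K$ is fixed, hence trivial.
    have hprod := hnofix _ (mul_mem (mul_mem t.2 m1) m2) (by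
      have hg3 : g ^ 3 = 1 := by rw [← hg]; exact pow_orderOf_eq_one g
      calc g * (t * (g * t * g⁻¹) * (g ^ 2 * t * (g ^ 2)⁻¹)) * g⁻¹
          = (g * t * g⁻¹) * (g ^ 2 * t * (g ^ 2)⁻¹) * (g ^ 3 * t * (g ^ 3)⁻¹) := by group
        _ = ((g * t * g⁻¹) * (g ^ 2 * t * (g ^ 2)⁻¹)) * t := by rw [hg3]; simp
        _ = t * ((g * t * g⁻¹) * (g ^ 2 * t * (g ^ 2)⁻¹)) := hcomm _ (mul_mem m1 m2) _ t.2
        _ = _ := by group)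
    have := hD _ (isProductOneAtom_of_orbit_product hg htt htg hprod)
    simp at this
  · revert hmod; decide

/-- A group with an element of order three but none of order six, all of whose atoms have at most
six terms, one of them exactly six, is generated by an element of order three and an involution
inverting it. -/
theorem exists_inverted_generator [Finite G] (hD : AtomCardLE G 6)
    (h6 : ∃ U : Multiset G, IsProductOneAtom U ∧ U.card = 6)
    (hord : ∀ x : G, 0 < orderOf x ∧ orderOf x ≤ 4) {g : G} (hg : orderOf g = 3) :
    ∃ τ : G, τ * τ = 1 ∧ τ * g * τ⁻¹ = g⁻¹ ∧
      ∀ x, x ∈ Subgroup.zpowers g ∨ τ * x ∈ Subgroup.zpowers g := by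
  have hcard : 6 ≤ Nat.card G := by
    obtain ⟨U, hU, hc⟩ := h6
    exact hc ▸ hU.card_le_natCard
  have h9 := not_nine_dvd_card hD h6 hord
  obtain ⟨τ, hτ, hτg⟩ := exists_conj_mem_zpowers hD hcard hord h9 hg
  obtain ⟨h1, h2⟩ := exists_involution_inverting hord h9 hg hτ hτg
  exact ⟨τ, h1, h2, mem_zpowers_or_of_inverts hD hord h9 hg h1 h2⟩

end Alternating

/-! ### Seven-term atoms from a central commutator -/

section ClassTwo

variable {G : Type*} [Group G]

theorem isProductOne_pair_cons_of_central {x y : G} {T : Multiset G}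
    (hT : ∀ t ∈ T, ∀ g, t * g = g * t) (h : IsProductOne (x ::ₘ y ::ₘ T)) :
    ∃ l : List G, (l : Multiset G) = T ∧ x * y * l.prod = 1 := by
  obtain ⟨l₁, l₂, hl, hp⟩ := isProductOne_pair_cons h
  refine ⟨l₁ ++ l₂, hl, ?_⟩
  have hc : l₁.prod ∈ Subgroup.center G := by
    refine list_prod_mem fun t ht => Subgroup.mem_center_iff.2 fun g => (hT t ?_ g).symm
    rw [← hl]
    simp [ht]
  rw [← hp, List.prod_append, mul_assoc x l₁.prod y, ← Subgroup.mem_center_iff.1 hc y]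
  simp only [mul_assoc]

/-- Sub-sequences of `c i⁴` with product one. -/
theorem eq_of_isProductOne_of_le_cons_replicate {i c : G} {T : Multiset G}
    (hi : ∀ k, 0 < k → k < 4 → i ^ k ≠ 1) (hc : ∀ k ≤ 4, c * i ^ k ≠ 1)
    (hT : IsProductOne T) (hle : T ≤ c ::ₘ Multiset.replicate 4 i) :
    T = 0 ∨ T = Multiset.replicate 4 i := by
  rcases Multiset.le_cons_cases hle with h | ⟨T', rfl, h⟩
  · obtain ⟨k, hk, rfl⟩ := Multiset.le_replicate_iff_eq h
    rw [isProductOne_replicate] at hT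
    have : k = 0 ∨ k = 4 := by
      by_contra hne
      exact hi k (by omega) (by omega) hT
    rcases this with rfl | rfl <;> simp
  · obtain ⟨k, hk, rfl⟩ := Multiset.le_replicate_iff_eq h
    obtain ⟨l, hl, hp⟩ := isProductOne_cons_iff.1 hT
    have hl' : l = List.replicate k i := by
      rw [← Multiset.coe_replicate, Multiset.coe_eq_coe, List.perm_replicate] at hl
      exact hl
    rw [hl', List.prod_replicate] at hp
    exact absurd hp (hc k hk)

theorem mul_ne_one_of_not_commute {i y w : G} (hiy : i * y ≠ y * i) (hw : ∀ g, w * g = g * w) :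
    w * i ≠ 1 := by
  intro h
  apply hiy
  apply mul_left_cancel (a := w)
  rw [← mul_assoc, h, ← mul_assoc, hw y, mul_assoc, h, one_mul, mul_one]

/-- The terms other than $i$ multiply to $z$, and moving one $i$ past $y$ contributes a second
factor $z$ that cancels it. Only $i^4$ could be split off, and the remaining terms then multiply to
$z \ne 1$ in every order. -/
theorem isProductOneAtom_of_sq_eq_commutator {i y z c : G} (hz : ∀ g, z * g = g * z)
    (hc : ∀ g, c * g = g * c) (hiy : i * y = z * (y * i)) (hi : i * i = z) (hz2 : z * z = 1)
    (hz1 : z ≠ 1) (hc1 : c ≠ 1) (hcz : c ≠ z) :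
    IsProductOneAtom (y ::ₘ (c⁻¹ * y⁻¹ * z) ::ₘ c ::ₘ Multiset.replicate 4 i) := by
  have hiy' : i * y ≠ y * i := by
    intro h
    rw [h] at hiy
    exact hz1 (right_eq_mul.1 hiy)
  have hi2 : i ^ 2 = z := by rw [pow_two, hi]
  have hi4 : i ^ 4 = 1 := by rw [show 4 = 2 * 2 from rfl, pow_mul, hi2, pow_two, hz2]
  have hi3 : i ^ 3 = z * i := by rw [pow_succ, hi2]
  have hw : y * (c⁻¹ * y⁻¹ * z) * c = z := by
    rw [mul_assoc, ← hc]
    simp only [← mul_assoc, mul_inv_cancel_right]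
    simp
  refine isProductOneAtom_cons_cons (K := Subgroup.centralizer {i}) ?_ ?_ ?_ ?_
  · intro t ht
    rw [Subgroup.mem_centralizer_singleton_iff]
    rcases Multiset.mem_cons.1 ht with rfl | ht
    · exact hc i
    · rw [Multiset.eq_of_mem_replicate ht]
  · rw [Subgroup.mem_centralizer_singleton_iff]
    exact fun h => hiy' h.symm
  · refine ⟨[i, y, i, c⁻¹ * y⁻¹ * z, c, i, i], ?_, ?_⟩
    · simp only [Multiset.replicate_succ, Multiset.replicate_zero, ← Multiset.singleton_add,
        ← Multiset.cons_coe, Multiset.coe_nil]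
      abel
    · calc [i, y, i, c⁻¹ * y⁻¹ * z, c, i, i].prod
          = (i * y) * i * (c⁻¹ * y⁻¹ * z) * c * (i * i) := by simp [mul_assoc]
        _ = z * (y * (i * i) * (c⁻¹ * y⁻¹ * z) * c) * (i * i) := by rw [hiy]; simp only [mul_assoc]
        _ = z * (z * (y * (c⁻¹ * y⁻¹ * z) * c)) * z := by rw [hi, ← hz y]; simp only [mul_assoc]
        _ = 1 := by rw [hw, hz2, mul_one, hz2]
  · intro T₁ T₂ hT h₁ h₂
    have hpow : ∀ k, 0 < k → k < 4 → i ^ k ≠ 1 := by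
      intro k h0 h4 hk
      have : k = 1 ∨ k = 2 ∨ k = 3 := by omega
      rcases this with rfl | rfl | rfl
      · rw [pow_one] at hk
        simp [hk] at hiy'
      · exact hz1 (hi2 ▸ hk)
      · exact mul_ne_one_of_not_commute hiy' hz (hi3 ▸ hk)
    have hmul : ∀ k ≤ 4, c * i ^ k ≠ 1 := by
      intro k h4 hk
      have : k = 0 ∨ k = 1 ∨ k = 2 ∨ k = 3 ∨ k = 4 := by omega
      rcases this with rfl | rfl | rfl | rfl | rfl
      · exact hc1 (by simpa using hk)
      · exact mul_ne_one_of_not_commute hiy' hc (by simpa using hk)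
      · rw [hi2] at hk
        exact hcz (mul_right_cancel (hk.trans hz2.symm))
      · rw [hi3, ← mul_assoc] at hk
        refine mul_ne_one_of_not_commute hiy' (fun g => ?_) hk
        rw [mul_assoc, hz, ← mul_assoc, hc, mul_assoc]
      · exact hc1 (by simpa [hi4] using hk)
    rcases eq_of_isProductOne_of_le_cons_replicate hpow hmul h₂
      (hT ▸ Multiset.le_add_left _ _) with h | h
    · exact h
    · exfalso
      rw [h, ← Multiset.singleton_add] at hT
      rw [← add_right_cancel hT] at h₁
      obtain ⟨l, hl, hp⟩ := isProductOne_pair_cons_of_central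
        (by simpa using hc) h₁
      rw [Multiset.coe_eq_singleton] at hl
      rw [hl, List.prod_singleton, hw] at hp
      exact hz1 hp

/-- Moving one $t$ past $u$ produces a commutator that cancels the term $z$. Splitting off $t^4$
would leave $u, u, z$ with product $z \ne 1$. -/
theorem isProductOneAtom_of_involution {t u z : G} (hz : ∀ g, z * g = g * z)
    (htu : t * u = z * (u * t)) (hu : u * u = 1) (ht : ∀ g, t ^ 2 * g = g * t ^ 2)
    (ht4 : t ^ 4 = 1) (ht1 : t ^ 2 ≠ 1)
    (htz : t ^ 2 ≠ z) (hz2 : z * z = 1) (hz1 : z ≠ 1) :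
    IsProductOneAtom (u ::ₘ u ::ₘ z ::ₘ Multiset.replicate 4 t) := by
  have htu' : t * u ≠ u * t := by
    intro h
    rw [h] at htu
    exact hz1 (right_eq_mul.1 htu)
  have ht3 : t ^ 3 = t ^ 2 * t := pow_succ _ _
  refine isProductOneAtom_cons_cons (K := Subgroup.centralizer {t}) ?_ ?_ ?_ ?_
  · intro w hw
    rw [Subgroup.mem_centralizer_singleton_iff]
    rcases Multiset.mem_cons.1 hw with rfl | hw
    · exact hz t
    · rw [Multiset.eq_of_mem_replicate hw]
  · rw [Subgroup.mem_centralizer_singleton_iff]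
    exact fun h => htu' h.symm
  · refine ⟨[z, u, t, u, t, t, t], ?_, ?_⟩
    · simp only [Multiset.replicate_succ, Multiset.replicate_zero, ← Multiset.singleton_add,
        ← Multiset.cons_coe, Multiset.coe_nil]
      abel
    · calc [z, u, t, u, t, t, t].prod = z * u * (t * u) * t ^ 3 := by simp [pow_succ, mul_assoc]
        _ = z * (u * z) * (u * t) * t ^ 3 := by rw [htu]; simp only [mul_assoc]
        _ = (z * z) * (u * u) * t ^ 4 := by
          rw [← hz u, show t ^ 4 = t * t ^ 3 from pow_succ' t 3]; simp only [mul_assoc]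
        _ = 1 := by rw [hz2, hu, ht4, mul_one, mul_one]
  · intro T₁ T₂ hT h₁ h₂
    have hpow : ∀ k, 0 < k → k < 4 → t ^ k ≠ 1 := by
      intro k h0 h4 hk
      have : k = 1 ∨ k = 2 ∨ k = 3 := by omega
      rcases this with rfl | rfl | rfl
      · rw [pow_one] at hk
        simp [hk] at htu'
      · exact ht1 hk
      · exact mul_ne_one_of_not_commute htu' ht (ht3 ▸ hk)
    have hmul : ∀ k ≤ 4, z * t ^ k ≠ 1 := by
      intro k h4 hk
      have : k = 0 ∨ k = 1 ∨ k = 2 ∨ k = 3 ∨ k = 4 := by omega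
      rcases this with rfl | rfl | rfl | rfl | rfl
      · exact hz1 (by simpa using hk)
      · exact mul_ne_one_of_not_commute htu' hz (by simpa using hk)
      · exact htz (mul_left_cancel (hk.trans hz2.symm))
      · rw [ht3, ← mul_assoc] at hk
        refine mul_ne_one_of_not_commute htu' (fun g => ?_) hk
        rw [mul_assoc, ht, ← mul_assoc, hz, mul_assoc]
      · exact hz1 (by simpa [ht4] using hk)
    rcases eq_of_isProductOne_of_le_cons_replicate hpow hmul h₂
      (hT ▸ Multiset.le_add_left _ _) with h | h
    · exact h
    · exfalso
      rw [h, ← Multiset.singleton_add] at hT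
      rw [← add_right_cancel hT] at h₁
      obtain ⟨l, hl, hp⟩ := isProductOne_pair_cons_of_central (by simpa using hz) h₁
      rw [Multiset.coe_eq_singleton] at hl
      rw [hl, List.prod_singleton, hu, one_mul] at hp
      exact hz1 hp

end ClassTwo

/-! ### Non-abelian groups of order sixteen -/

section TwoGroup

variable {G : Type*} [Group G]

/-- The quotient by the centre has order at most three and is cyclic, so the group is abelian. -/
theorem mul_comm_of_card_lt_four_mul_card_center [Finite G]
    (h : Nat.card G < 4 * Nat.card (Subgroup.center G)) (a b : G) : a * b = b * a := by
  have hidx : (Subgroup.center G).index < 4 := by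
    have h1 := (Subgroup.center G).card_mul_index
    rw [← h1, mul_comm 4] at h
    exact Nat.lt_of_mul_lt_mul_left h
  have h0 : (Subgroup.center G).index ≠ 0 := Subgroup.index_ne_zero_of_finite
  have hc : Nat.card (G ⧸ Subgroup.center G) = (Subgroup.center G).index := rfl
  have hcyc : IsCyclic (G ⧸ Subgroup.center G) := by
    have h2 : Fact (Nat.Prime 2) := ⟨Nat.prime_two⟩
    have h3 : Fact (Nat.Prime 3) := ⟨Nat.prime_three⟩
    have : (Subgroup.center G).index = 1 ∨ (Subgroup.center G).index = 2 ∨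
      (Subgroup.center G).index = 3 := by omega
    rcases this with h | h | h
    · have := Nat.card_eq_one_iff_unique.1 (hc.trans h)
      have := this.1
      infer_instance
    · exact isCyclic_of_prime_card (hc.trans h)
    · exact isCyclic_of_prime_card (hc.trans h)
  exact ((QuotientGroup.mk' (Subgroup.center G)).isMulCommutative_of_isCyclic_of_ker_le_center
    (by simp)).is_comm.comm a b

/-- The quotient by the centre has order four and is not cyclic, so it is a Klein four-group. -/
theorem sq_and_commutator_mem_center [Finite G] (h : Nat.card G = 4 * Nat.card (Subgroup.center G))
    (hnc : ¬ ∀ a b : G, a * b = b * a) (x y : G) :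
    x ^ 2 ∈ Subgroup.center G ∧ x * y * x⁻¹ * y⁻¹ ∈ Subgroup.center G := by
  have hc : Nat.card (G ⧸ Subgroup.center G) = 4 := by
    have h1 := (Subgroup.center G).card_mul_index
    rw [h, mul_comm] at h1
    exact Nat.eq_of_mul_eq_mul_right Nat.card_pos h1
  have hsq : ∀ q : G ⧸ Subgroup.center G, q ^ 2 = 1 := by
    intro q
    by_contra hq
    have hd := hc ▸ orderOf_dvd_natCard q
    have h4 : orderOf q = 4 := by
      obtain ⟨k, hk, hk'⟩ := (Nat.dvd_prime_pow Nat.prime_two (i := orderOf q) (m := 2)).1 hd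
      have : k = 2 := by
        by_contra hk2
        exact hq (orderOf_dvd_iff_pow_eq_one.1
          (hk' ▸ (pow_dvd_pow 2 (show k ≤ 1 by omega) : 2 ^ k ∣ 2 ^ 1)))
      rw [hk', this]; rfl
    have := isCyclic_of_orderOf_eq_card q (h4.trans hc.symm)
    exact hnc ((QuotientGroup.mk'
      (Subgroup.center G)).isMulCommutative_of_isCyclic_of_ker_le_center (by simp)).is_comm.comm
  have hm : ∀ u : G, u ∈ Subgroup.center G ↔ (u : G ⧸ Subgroup.center G) = 1 :=
    fun u => (QuotientGroup.eq_one_iff u).symm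
  refine ⟨(hm _).2 (by rw [QuotientGroup.mk_pow, hsq]), (hm _).2 ?_⟩
  have hcomm : ∀ p q : G ⧸ Subgroup.center G, p * q = q * p := by
    intro p q
    have h1 := hsq (p * q)
    have hp : p * p = 1 := by rw [← pow_two, hsq]
    have hq : q * q = 1 := by rw [← pow_two, hsq]
    calc p * q = p * q * ((p * q) ^ 2)⁻¹ := by rw [h1]; simp
      _ = q⁻¹ * p⁻¹ := by group
      _ = q * p := by rw [inv_eq_of_mul_eq_one_left hp, inv_eq_of_mul_eq_one_left hq]
  rw [QuotientGroup.mk_mul, QuotientGroup.mk_mul, QuotientGroup.mk_mul, hcomm (x : G ⧸ _) y,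
    QuotientGroup.mk_inv, QuotientGroup.mk_inv]
  simp

/-- A group of order sixteen and exponent at most four has no centre of order two. -/
theorem card_center_ne_two [Finite G] (hc : Nat.card G = 16) (h4 : ∀ x : G, x ^ 4 = 1) :
    Nat.card (Subgroup.center G) ≠ 2 := by
  intro hZ
  have h2 : Fact (Nat.Prime 2) := ⟨Nat.prime_two⟩
  have hq : Nat.card (G ⧸ Subgroup.center G) = 2 ^ 3 := by
    have h1 := (Subgroup.center G).card_mul_index
    rw [hc, hZ] at h1
    change 2 * Nat.card (G ⧸ Subgroup.center G) = 16 at h1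
    omega
  have : Nontrivial (G ⧸ Subgroup.center G) := by
    rw [← Finite.one_lt_card_iff_nontrivial, hq]; norm_num
  have := (IsPGroup.of_card hq).center_nontrivial
  -- Choose $a$ in the second centre but not in the centre, so that all commutators with $a$ are
  -- central.
  obtain ⟨q, hq1⟩ := exists_ne (1 : Subgroup.center (G ⧸ Subgroup.center G))
  obtain ⟨q, hqc⟩ := q
  obtain ⟨a, rfl⟩ := QuotientGroup.mk_surjective q
  have haZ : a ∉ Subgroup.center G := fun h => hq1 (Subtype.ext ((QuotientGroup.eq_one_iff a).2 h))
  have hcom : ∀ x : G, x * a * x⁻¹ * a⁻¹ ∈ Subgroup.center G := by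
    intro x
    rw [← QuotientGroup.eq_one_iff]
    have := Subgroup.mem_center_iff.1 hqc x
    simp only [QuotientGroup.mk_mul, QuotientGroup.mk_inv]
    rw [this]; simp
  set H := Subgroup.centralizer ({a} : Set G) with hH
  have hmH : ∀ x, x ∈ H ↔ x * a = a * x := fun x => Subgroup.mem_centralizer_singleton_iff
  -- the centralizer of `a` has index two
  let f : G →* Subgroup.center G :=
    { toFun := fun x => ⟨x * a * x⁻¹ * a⁻¹, hcom x⟩
      map_one' := Subtype.ext (by simp)
      map_mul' := fun x y => Subtype.ext (by
        have h1 := Subgroup.mem_center_iff.1 (hcom y) x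
        change x * y * a * (x * y)⁻¹ * a⁻¹ = x * a * x⁻¹ * a⁻¹ * (y * a * y⁻¹ * a⁻¹)
        calc x * y * a * (x * y)⁻¹ * a⁻¹
            = x * (y * a * y⁻¹ * a⁻¹) * (a * x⁻¹ * a⁻¹) := by group
          _ = (y * a * y⁻¹ * a⁻¹) * (x * a * x⁻¹ * a⁻¹) := by rw [h1]; group
          _ = _ := (Subgroup.mem_center_iff.1 (hcom y) _).symm) }
  have hker : f.ker = H := by
    ext x
    rw [MonoidHom.mem_ker, hmH, Subtype.ext_iff]
    change x * a * x⁻¹ * a⁻¹ = 1 ↔ _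
    rw [mul_inv_eq_one, mul_inv_eq_iff_eq_mul]
  have hHne : H ≠ ⊤ := by
    intro h
    apply haZ
    rw [Subgroup.mem_center_iff]
    intro x
    have : x ∈ H := h ▸ Subgroup.mem_top x
    exact (hmH x).1 this
  have hHcard : Nat.card H = 8 := by
    have h1 : H.index = Nat.card f.range := by rw [← hker, Subgroup.index_ker]
    have h2 := Subgroup.card_subgroup_dvd_card f.range
    rw [← h1, hZ] at h2
    have h3 : H.index ≠ 1 := fun h => hHne (Subgroup.index_eq_one.1 h)
    have h4 := (Nat.dvd_prime Nat.prime_two).1 h2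
    have h5 : H.index = 2 := by tauto
    have h6 := H.card_mul_index
    rw [h5, hc] at h6
    omega
  have hHn : H.Normal := hker ▸ f.normal_ker
  have hHcomm : ∀ p ∈ H, ∀ q ∈ H, p * q = q * p := by
    intro p hp q hq
    refine congrArg Subtype.val
      (mul_comm_of_card_lt_four_mul_card_center (G := H) ?_ ⟨p, hp⟩ ⟨q, hq⟩)
    have hle : Subgroup.center G ≤ H := by
      intro x hx
      rw [hmH]
      exact (Subgroup.mem_center_iff.1 hx a).symm
    -- The centre of $H$ contains $a$ as well, so it has at least three elements; since $|H| = 8$,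
    -- this makes $H$ abelian.
    have hd : (Subgroup.center G) < (Subgroup.center H).map H.subtype := by
      refine lt_of_le_of_ne (fun x hx => ⟨⟨x, hle hx⟩, ?_, rfl⟩) ?_
      · exact Subgroup.mem_center_iff.2 fun g => Subtype.ext (Subgroup.mem_center_iff.1 hx g)
      · intro he
        apply haZ
        rw [he]
        refine ⟨⟨a, (hmH a).2 rfl⟩, ?_, rfl⟩
        exact Subgroup.mem_center_iff.2 fun g => Subtype.ext ((hmH g).1 g.2)
    have hlt : Nat.card (Subgroup.center G) < Nat.card (Subgroup.center H) := by
      rw [← Subgroup.card_map_of_injective H.subtype_injective]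
      exact Set.Finite.card_lt_card (Set.toFinite _) hd
    rw [hHcard]
    omega
  obtain ⟨x, hx⟩ : ∃ x, x ∉ H := by
    by_contra h
    push Not at h
    exact hHne ((Subgroup.eq_top_iff' H).2 h)
  have hx2 : x * x ∈ H := by
    have : H.index = 2 := by
      have h6 := H.card_mul_index
      rw [hHcard, hc] at h6; omega
    exact Subgroup.mul_self_mem_of_index_two this x
  -- $G$ is generated by the abelian subgroup $H$ of index two and $x$.
  have hcen : ∀ h ∈ H, x * h * x⁻¹ = h → h ∈ Subgroup.center G := by
    intro h hh hfix
    rw [Subgroup.mem_center_iff]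
    intro u
    have hxh : x * h = h * x := mul_inv_eq_iff_eq_mul.1 hfix
    by_cases hu : u ∈ H
    · exact hHcomm u hu h hh
    · have hi : H.index = 2 := by
        have h6 := H.card_mul_index
        rw [hHcard, hc] at h6; omega
      have h1 : x⁻¹ * u ∈ H := by
        rw [Subgroup.mul_mem_iff_of_index_two hi, inv_mem_iff]
        exact iff_of_false hx hu
      have h2 := hHcomm _ h1 h hh
      calc u * h = x * (x⁻¹ * u * h) := by group
        _ = x * h * (x⁻¹ * u) := by rw [h2, mul_assoc]
        _ = h * u := by rw [hxh]; group
  have hconj : ∀ h ∈ H, x * h * x⁻¹ ∈ H := fun h hh => hHn.conj_mem h hh x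
  have hnorm : ∀ h ∈ H, h * (x * h * x⁻¹) ∈ Subgroup.center G := by
    intro h hh
    apply hcen _ (mul_mem hh (hconj h hh))
    calc x * (h * (x * h * x⁻¹)) * x⁻¹ = (x * h * x⁻¹) * (x * x * h * (x * x)⁻¹) := by group
      _ = (x * h * x⁻¹) * h := by rw [hHcomm _ hx2 h hh]; group
      _ = _ := hHcomm _ (hconj h hh) h hh
  have hz2 : ∀ w ∈ Subgroup.center G, w * w = 1 := by
    intro w hw
    have := pow_card_eq_one' (G := Subgroup.center G) (x := ⟨w, hw⟩)
    rw [hZ, pow_two] at this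
    exact congrArg Subtype.val this
  have hsq : ∀ h ∈ H, h * h ∈ Subgroup.center G := by
    intro h hh
    apply hcen _ (mul_mem hh hh)
    have h1 := hz2 _ (hnorm h hh)
    have h2 := hHcomm h hh _ (hconj h hh)
    -- This is the square of the norm $h \cdot xhx^{-1}$, which is central and so has square one.
    -- Comparison with $h^4 = 1$ shows that $x$ fixes $h^2$.
    have h3 : h * h * (x * (h * h) * x⁻¹) = 1 := by
      rw [← h1]
      calc h * h * (x * (h * h) * x⁻¹) = h * (h * (x * h * x⁻¹)) * (x * h * x⁻¹) := by group
        _ = h * (x * h * x⁻¹ * h) * (x * h * x⁻¹) := by rw [← h2]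
        _ = _ := by simp only [mul_assoc]
    have h5 : h * h * (h * h) = 1 := by rw [← h4 h]; simp [pow_succ, mul_assoc]
    exact mul_left_cancel (h3.trans h5.symm)
  -- Kernel and image of $h \mapsto xhx^{-1}h^{-1}$ both lie in the centre: the image because each
  -- value is a norm times the inverse of a square. Hence $|H| \le 4$, a contradiction.
  let ψ : H →* G :=
    { toFun := fun h => x * h * x⁻¹ * (h : G)⁻¹
      map_one' := by simp
      map_mul' := fun p q => by
        have h1 := hHcomm _ (mul_mem (hconj q q.2) (inv_mem q.2)) _ (inv_mem p.2)
        push_cast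
        calc x * (p * q) * x⁻¹ * (p * q : G)⁻¹
            = x * p * x⁻¹ * (x * q * x⁻¹ * (q : G)⁻¹ * (p : G)⁻¹) := by group
          _ = _ := by rw [h1]; simp only [mul_assoc] }
  have hψ : ∀ h : H, ψ h = x * h * x⁻¹ * (h : G)⁻¹ := fun _ => rfl
  have hk : Nat.card ψ.ker ≤ 2 := by
    rw [← hZ, ← Subgroup.card_map_of_injective H.subtype_injective]
    apply Subgroup.card_le_of_le
    rintro _ ⟨h, hh, rfl⟩
    have hh : ψ h = 1 := hh
    rw [hψ, mul_inv_eq_one] at hh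
    exact hcen h h.2 hh
  have hr : Nat.card ψ.range ≤ 2 := by
    rw [← hZ]
    apply Subgroup.card_le_of_le
    rintro _ ⟨h, rfl⟩
    have h1 := mul_mem (hnorm h h.2) (inv_mem (hsq h h.2))
    convert h1 using 1
    rw [hψ, hHcomm h h.2 _ (hconj h h.2)]
    group
  have h1 := ψ.ker.card_mul_index
  rw [Subgroup.index_ker, hHcard] at h1
  have := Nat.mul_le_mul hk hr
  omega

/-- The centre has order four, so squares and commutators are central. Let $z$ be the commutator of
two non-commuting elements. One seven-term atom shows that neither of them has square $z$. Some $u$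
of square one and some $t$ with $t^2 \notin \{1, z\}$ among $x, y, xy$ then yield the other
seven-term atom. -/
theorem false_of_card_eq_sixteen [Finite G] (hD : AtomCardLE G 6) (hcard : Nat.card G = 16)
    (h4 : ∀ x : G, x ^ 4 = 1) (hnc : ¬ ∀ a b : G, a * b = b * a) : False := by
  classical
  have h2 : Fact (Nat.Prime 2) := ⟨Nat.prime_two⟩
  have hZ : Nat.card (Subgroup.center G) = 4 := by
    have h1 : ¬ Nat.card G < 4 * Nat.card (Subgroup.center G) := fun h =>
      hnc (mul_comm_of_card_lt_four_mul_card_center h)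
    have h3 := Subgroup.card_subgroup_dvd_card (Subgroup.center G)
    rw [hcard] at h1 h3
    have h5 := card_center_ne_two hcard h4
    have : Nontrivial G := by rw [← Finite.one_lt_card_iff_nontrivial, hcard]; norm_num
    have h6 := (IsPGroup.of_card (p := 2) (n := 4) hcard).center_nontrivial
    rw [← Finite.one_lt_card_iff_nontrivial] at h6
    have h7 : Nat.card (Subgroup.center G) ≤ 4 := by omega
    interval_cases Nat.card (Subgroup.center G) <;> omega
  have hsc := sq_and_commutator_mem_center (by rw [hcard, hZ]) hnc
  have hcen : ∀ w ∈ Subgroup.center G, ∀ g, w * g = g * w :=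
    fun w hw g => (Subgroup.mem_center_iff.1 hw g).symm
  -- basic facts about the commutator `z` of two elements
  have hfacts : ∀ x y : G, x * y ≠ y * x → ∃ z ∈ Subgroup.center G, z ≠ 1 ∧ z * z = 1 ∧
      x * y = z * (y * x) ∧ y * x = z * (x * y) := by
    intro x y hxy
    have hz := (hsc x y).2
    have e : x * y = x * y * x⁻¹ * y⁻¹ * (y * x) := by group
    generalize x * y * x⁻¹ * y⁻¹ = z at hz e
    have hz1 : z ≠ 1 := by rintro rfl; rw [one_mul] at e; exact hxy e
    have hz2 : z * z = 1 := by
      have h1 := hcen _ (hsc x x).1 y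
      have h3 : x ^ 2 * y = z * z * (y * x ^ 2) := by
        calc x ^ 2 * y = x * (x * y) := by rw [pow_two, mul_assoc]
          _ = x * z * (y * x) := by rw [e, mul_assoc]
          _ = z * (x * y) * x := by rw [← hcen z hz x]; simp only [mul_assoc]
          _ = _ := by rw [e, pow_two]; simp only [mul_assoc]
      rw [h1] at h3
      exact right_eq_mul.1 h3
    refine ⟨z, hz, hz1, hz2, e, ?_⟩
    rw [e, ← mul_assoc, hz2, one_mul]
  -- squares of noncentral elements differ from commutators
  have hne : ∀ x y z : G, x * y ≠ y * x → x * y = z * (y * x) → x * x ≠ z := by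
    intro x y z hxy e hx
    obtain ⟨z', hz, hz1, hz2, e', -⟩ := hfacts x y hxy
    obtain rfl : z' = z := mul_right_cancel (e'.symm.trans e)
    -- The centre has four elements, so it contains one other than $1$ and $z'$.
    obtain ⟨c, hc, hc1, hcz⟩ : ∃ c ∈ Subgroup.center G, c ≠ 1 ∧ c ≠ z' := by
      by_contra h
      push Not at h
      have h1 : (Subgroup.center G : Set G) ⊆ ({1, z'} : Finset G) := by
        intro c hc
        by_cases hc1 : c = 1
        · simp [hc1]
        · simp [h c hc hc1]
      have h3 := Set.ncard_le_ncard h1 (Finset.finite_toSet _)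
      rw [Set.ncard_coe_finset] at h3
      have h5 : (Subgroup.center G : Set G).ncard = 4 := hZ
      have := Finset.card_le_two (a := (1 : G)) (b := z')
      omega
    have := hD _ (isProductOneAtom_of_sq_eq_commutator (hcen _ hz) (hcen _ hc) e hx hz2 hz1 hc1 hcz)
    simp at this
  push Not at hnc
  obtain ⟨x, y, hxy⟩ := hnc
  obtain ⟨z, hz, hz1, hz2, exy, eyx⟩ := hfacts x y hxy
  have hx := hne x y z hxy exy
  have hy := hne y x z hxy.symm eyx
  have exyy : x * y * y = z * (y * (x * y)) := by
    nth_rw 1 [exy]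
    simp only [mul_assoc]
  have eyxx : x * (x * y) = z * (x * y * x) := by
    conv_lhs => rw [exy]
    rw [← mul_assoc, ← hcen z hz x]; simp only [mul_assoc]
  have hxyy : x * y * y ≠ y * (x * y) := by
    intro h; rw [exyy] at h; exact hz1 (mul_eq_right.1 h)
  have hxyz := hne (x * y) y z hxyy exyy
  have hprod : x * y * (x * y) = x * x * (y * y) * z := by
    calc x * y * (x * y) = x * (y * x) * y := by simp only [mul_assoc]
      _ = z * (x * (x * y)) * y := by
        rw [eyx, ← mul_assoc, ← hcen z hz x]; simp only [mul_assoc]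
      _ = _ := by rw [hcen z hz, mul_assoc, hcen z hz]; simp only [← mul_assoc]
  have h4' : ∀ w : G, w * w * (w * w) = 1 := fun w => by
    rw [← h4 w]; simp [pow_succ, mul_assoc]
  have hsq : ∀ w : G, w * w ∈ Subgroup.center G := fun w => by
    rw [← pow_two]; exact (hsc w w).1
  have hZsub : ∀ s : Finset G, (∀ c ∈ s, c ∈ Subgroup.center G) → s.card ≤ 4 := by
    intro s hs
    have h3 := Set.ncard_le_ncard (show (s : Set G) ⊆ Subgroup.center G from hs)
    rw [Set.ncard_coe_finset] at h3
    exact h3.trans hZ.le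
  have final : ∀ t u : G, t * u = z * (u * t) → u * u = 1 → t * t ≠ 1 → t * t ≠ z → False := by
    intro t u e hu ht htz
    rw [← pow_two] at ht htz
    have := hD _ (isProductOneAtom_of_involution (hcen z hz) e hu (hcen _ (hsc t t).1) (h4 t)
      ht htz hz2 hz1)
    simp at this
  -- Since $(xy)^2 = x^2 y^2 z \ne z$, the squares of $x$ and $y$ are not both trivial; if exactly
  -- one is, the pair itself serves as $t, u$.
  by_cases hx1 : x * x = 1
  · refine final y x eyx hx1 (fun hy1 => hxyz ?_) hy
    rw [hprod, hx1, hy1, one_mul, one_mul]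
  by_cases hy1 : y * y = 1
  · exact final x y exy hy1 hx1 hx
  refine final x (x * y) eyxx ?_ hx1 hx
  have hab : x * x * (y * y) ≠ 1 := by
    intro h
    rw [h, one_mul] at hprod
    exact hxyz hprod
  have heq : x * x ≠ y * y := by
    intro h
    rw [h, h4'] at hab
    exact hab rfl
  -- The elements $1, z, x^2, y^2$ already exhaust the centre, and $x^2 y^2$ can only be $z$. Then
  -- $(xy)^2 = z^2 = 1$.
  have hxyz' : x * x * (y * y) = z := by
    by_contra hcon
    have h := hZsub {x * x * (y * y), 1, z, x * x, y * y} (by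
      simp only [Finset.mem_insert, Finset.mem_singleton]
      rintro v (rfl | rfl | rfl | rfl | rfl)
      exacts [mul_mem (hsq x) (hsq y), one_mem _, hz, hsq x, hsq y])
    rw [Finset.card_insert_of_notMem, Finset.card_insert_of_notMem,
      Finset.card_insert_of_notMem, Finset.card_insert_of_notMem] at h
    · simp at h
    · simp [heq]
    · simp [hx.symm, hy.symm]
    · simp [hz1.symm, Ne.symm hx1, Ne.symm hy1]
    · simp [hab, hcon, hx1, hy1]
  rw [hprod, hxyz', hz2]

end TwoGroup

/-! ### A decision procedure for atoms -/

section Decision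

theorem List.all_range_succ_iff {p : ℕ → Bool} {n : ℕ} :
    (List.range (n + 1)).all p = true ↔ ∀ j ≤ n, p j = true := by
  simp [List.all_eq_true]

/-- Whether `p` holds for (a list representing) each sequence `T + acc` with `T` of length `n`
over the given list of elements. -/
def allSequences {α : Type*} (p : List α → Bool) : List α → ℕ → List α → Bool
  | [], n, acc => n != 0 || p acc
  | x :: xs, n, acc =>
    (List.range (n + 1)).all fun j => allSequences p xs (n - j) (List.replicate j x ++ acc)

theorem exists_of_allSequences {α : Type*} [DecidableEq α] {p : List α → Bool} {xs : List α}
    {n : ℕ} {acc : List α} (h : allSequences p xs n acc = true) {T : Multiset α}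
    (hT : ∀ t ∈ T, t ∈ xs) (hn : T.card = n) :
    ∃ l : List α, (l : Multiset α) = T + acc ∧ p l = true := by
  induction xs generalizing n acc T with
  | nil =>
    have : T = 0 := Multiset.eq_zero_of_forall_notMem fun t ht => by simpa using hT t ht
    subst this
    subst hn
    exact ⟨acc, by simp, by simpa [allSequences] using h⟩
  | cons x xs ih =>
    rw [allSequences, List.all_range_succ_iff] at h
    have hc : T.count x ≤ n := hn ▸ T.count_le_card x
    obtain ⟨l, hl, hp⟩ := ih (h _ hc) (T := T.filter fun t => t ≠ x) (by
      intro t ht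
      rw [Multiset.mem_filter] at ht
      exact (List.mem_cons.1 (hT t ht.1)).resolve_left ht.2) (by
      have := congrArg Multiset.card (Multiset.filter_add_not (fun t => t = x) T)
      rw [Multiset.card_add, Multiset.filter_eq', Multiset.card_replicate, hn] at this
      change _ = n - T.count x
      have e : (T.filter fun t => t ≠ x).card = (T.filter fun t => ¬ t = x).card := rfl
      omega)
    refine ⟨l, ?_, hp⟩
    rw [hl, ← Multiset.coe_add, Multiset.coe_replicate, ← add_assoc, ← Multiset.filter_eq' T x]
    congr 1
    rw [add_comm]
    exact Multiset.filter_add_not (fun t => t = x) T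

/-- The ways to distribute the terms of a list over two lists. -/
def bipartitions {α : Type*} : List α → List (List α × List α)
  | [] => [([], [])]
  | x :: l => (bipartitions l).flatMap fun p => [(p.1, x :: p.2), (x :: p.1, p.2)]

theorem add_eq_of_mem_bipartitions {α : Type*} {l : List α} {p : List α × List α}
    (h : p ∈ bipartitions l) : (p.1 : Multiset α) + p.2 = l := by
  induction l generalizing p with
  | nil => simp only [bipartitions, List.mem_singleton] at h; subst h; rfl
  | cons x l ih =>
    simp only [bipartitions, List.mem_flatMap, List.mem_cons, List.not_mem_nil, or_false] at h
    obtain ⟨q, hq, rfl | rfl⟩ := h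
    · simp only [← Multiset.cons_coe, Multiset.add_cons, ih hq]
    · simp only [← Multiset.cons_coe, Multiset.cons_add, ih hq]

theorem exists_mem_bipartitions {α : Type*} {l : List α} {T₁ T₂ : Multiset α}
    (h : (l : Multiset α) = T₁ + T₂) :
    ∃ p ∈ bipartitions l, (p.1 : Multiset α) = T₁ ∧ (p.2 : Multiset α) = T₂ := by
  induction l generalizing T₁ T₂ with
  | nil =>
    obtain ⟨h1, h2⟩ := add_eq_zero.1 h.symm
    exact ⟨([], []), by simp [bipartitions], h1.symm, h2.symm⟩
  | cons x l ih =>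
    have hx : x ∈ T₁ + T₂ := by rw [← h]; simp
    rw [← Multiset.cons_coe] at h
    rcases Multiset.mem_add.1 hx with hx | hx
    · obtain ⟨T, rfl⟩ := Multiset.exists_cons_of_mem hx
      rw [Multiset.cons_add, Multiset.cons_inj_right] at h
      obtain ⟨q, hq, h1, h2⟩ := ih h
      exact ⟨(x :: q.1, q.2), List.mem_flatMap.2 ⟨q, hq, by simp⟩,
        by rw [← h1]; rfl, h2⟩
    · obtain ⟨T, rfl⟩ := Multiset.exists_cons_of_mem hx
      rw [Multiset.add_cons, Multiset.cons_inj_right] at h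
      obtain ⟨q, hq, h1, h2⟩ := ih h
      exact ⟨(q.1, x :: q.2), List.mem_flatMap.2 ⟨q, hq, by simp⟩, h1,
        by rw [← h2]; rfl⟩

variable {G : Type*} [Group G]

/-- A test `χ` for elements of `G` that does not distinguish products of the same elements in
different orders and accepts the identity. -/
structure IsOrderBlind (χ : G → Bool) : Prop where
  one : χ 1 = true
  mul_comm : ∀ a b, χ (a * b) = χ (b * a)
  mul_mul_comm : ∀ a b c, χ (a * (b * c)) = χ (a * (c * b))

/-- An adjacent pair inside a product is rotated to the end, swapped there and rotated back. -/
theorem IsOrderBlind.perm {χ : G → Bool} (hχ : IsOrderBlind χ) {l l' : List G} (h : l.Perm l') :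
    χ l.prod = χ l'.prod := by
  suffices ∀ a, χ (a * l.prod) = χ (a * l'.prod) by simpa using this 1
  induction h with
  | nil => exact fun _ => rfl
  | cons x _ ih => intro a; rw [List.prod_cons, List.prod_cons, ← mul_assoc, ih, mul_assoc]
  | swap x y l =>
    intro a
    simp only [List.prod_cons]
    rw [show a * (y * (x * l.prod)) = a * (y * x) * l.prod by simp only [mul_assoc],
      show a * (x * (y * l.prod)) = a * (x * y) * l.prod by simp only [mul_assoc],
      hχ.mul_comm, ← mul_assoc, hχ.mul_mul_comm, mul_assoc, hχ.mul_comm]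
  | trans _ _ ih₁ ih₂ => exact fun a => (ih₁ a).trans (ih₂ a)

variable [DecidableEq G]

/-- Decides whether a sequence has product one. -/
def productOneTest (χ : G → Bool) (l : List G) : Bool :=
  -- If all terms commute, the given order already decides. Permutations are searched only when two
  -- terms fail to commute.
  χ l.prod && (l.prod == 1 || (l.any fun a => l.any fun b => a * b != b * a) &&
    l.permutations'.any fun m => m.prod == 1)

theorem productOneTest_iff {χ : G → Bool} (hχ : IsOrderBlind χ) {l : List G} :
    productOneTest χ l = true ↔ IsProductOne (l : Multiset G) := by
  simp only [productOneTest, Bool.and_eq_true, Bool.or_eq_true, beq_iff_eq, List.any_eq_true,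
    bne_iff_ne, ne_eq, List.mem_permutations']
  constructor
  · rintro ⟨-, h | ⟨-, m, hm, h⟩⟩
    · exact ⟨l, rfl, h⟩
    · exact ⟨m, Multiset.coe_eq_coe.2 hm, h⟩
  · rintro ⟨m, hm, h⟩
    have hm := Multiset.coe_eq_coe.1 hm
    refine ⟨by rw [← hχ.perm hm, h, hχ.one], ?_⟩
    by_cases hc : ∀ a ∈ l, ∀ b ∈ l, a * b = b * a
    · left
      rw [← h]
      refine (hm.symm.prod_eq' ?_)
      exact List.pairwise_of_forall_mem_list hc
    · right
      push Not at hc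
      obtain ⟨a, ha, b, hb, hab⟩ := hc
      exact ⟨⟨a, ha, b, hb, hab⟩, m, hm, h⟩

/-- Decides whether a sequence is the concatenation of two non-empty product-one sequences. -/
def splitTest (χ : G → Bool) (l : List G) : Bool :=
  (bipartitions l).any fun p =>
    !p.1.isEmpty && !p.2.isEmpty && productOneTest χ p.1 && productOneTest χ p.2

theorem splitTest_iff {χ : G → Bool} (hχ : IsOrderBlind χ) {l : List G} :
    splitTest χ l = true ↔ ∃ T₁ T₂ : Multiset G, IsProductOne T₁ ∧ IsProductOne T₂ ∧
      (l : Multiset G) = T₁ + T₂ ∧ T₁ ≠ 0 ∧ T₂ ≠ 0 := by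
  simp only [splitTest, List.any_eq_true, Bool.and_eq_true, Bool.not_eq_true', productOneTest_iff hχ]
  constructor
  · rintro ⟨p, hp, ⟨⟨h1, h2⟩, h3⟩, h4⟩
    refine ⟨p.1, p.2, h3, h4, (add_eq_of_mem_bipartitions hp).symm, ?_, ?_⟩
    · simpa using h1
    · simpa using h2
  · rintro ⟨T₁, T₂, h1, h2, h, h3, h4⟩
    obtain ⟨p, hp, rfl, rfl⟩ := exists_mem_bipartitions h
    exact ⟨p, hp, ⟨⟨by simpa using h3, by simpa using h4⟩, h1⟩, h2⟩

theorem isProductOneAtom_iff_test {χ : G → Bool} (hχ : IsOrderBlind χ) {l : List G} :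
    IsProductOneAtom (l : Multiset G) ↔
      l ≠ [] ∧ splitTest χ l = false ∧ productOneTest χ l = true := by
  rw [← Bool.not_eq_true, splitTest_iff hχ, productOneTest_iff hχ]
  constructor
  · rintro ⟨h1, h2, h3⟩
    refine ⟨by simpa using h2, ?_, h1⟩
    rintro ⟨T₁, T₂, h4, h5, h, h6, h7⟩
    rcases h3 T₁ T₂ h4 h5 h with h | h
    exacts [h6 h, h7 h]
  · rintro ⟨h2, h3, h1⟩
    refine ⟨h1, by simpa using h2, fun T₁ T₂ h4 h5 h => ?_⟩
    by_contra hc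
    rw [not_or] at hc
    exact h3 ⟨T₁, T₂, h4, h5, h, hc.1, hc.2⟩

/-- To see that all atoms of length `n` have property `P` it is enough to test all sequences. -/
theorem exists_list_of_isProductOneAtom {χ : G → Bool} (hχ : IsOrderBlind χ) {P : List G → Bool}
    {xs : List G} {n : ℕ} (hxs : ∀ g : G, g ≠ 1 → g ∈ xs) (hn : 2 ≤ n)
    (h : allSequences (fun l => !χ l.prod || splitTest χ l || P l || !productOneTest χ l) xs n [] =
      true)
    {U : Multiset G} (hU : IsProductOneAtom U) (hc : U.card = n) :
    ∃ l : List G, (l : Multiset G) = U ∧ P l = true := by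
  have h1 := hU.one_notMem (hc ▸ hn)
  obtain ⟨l, hl, hp⟩ := exists_of_allSequences h
    (fun t ht => hxs t fun h => h1 (h ▸ ht)) hc
  rw [Multiset.coe_nil, add_zero] at hl
  subst hl
  obtain ⟨-, h2, h3⟩ := (isProductOneAtom_iff_test hχ).1 hU
  refine ⟨l, rfl, ?_⟩
  have h4 : χ l.prod = true := by
    rw [productOneTest, Bool.and_eq_true] at h3
    exact h3.1
  simpa [h2, h3, h4] using hp

end Decision

/-! ### The long atoms over $D_3$, $D_4$ and $Q_8$ -/

section Enumeration

open DihedralGroup QuaternionGroup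

/-- The test for being a rotation. -/
def dihedralThreeTest : DihedralGroup 3 → Bool
  | r _ => true
  | sr _ => false

/-- Membership in the commutator subgroup, which depends only on the product in the abelianization.
-/
def dihedralFourTest (x : DihedralGroup 4) : Bool := x == 1 || x == r 2

/-- Again membership in the commutator subgroup, here $\{\pm 1\}$. -/
def quaternionTest (x : QuaternionGroup 2) : Bool := x == 1 || x == a 2

theorem isOrderBlind_dihedralThreeTest : IsOrderBlind dihedralThreeTest :=
  ⟨by decide +kernel, by decide +kernel, by decide +kernel⟩

theorem isOrderBlind_dihedralFourTest : IsOrderBlind dihedralFourTest :=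
  ⟨by decide +kernel, by decide +kernel, by decide +kernel⟩

theorem isOrderBlind_quaternionTest : IsOrderBlind quaternionTest :=
  ⟨by decide +kernel, by decide +kernel, by decide +kernel⟩

theorem eq_of_atom_card_eq_six_dihedralThree {U : Multiset (DihedralGroup 3)}
    (hU : IsProductOneAtom U) (hc : U.card = 6) :
    (∃ g t, U = {g, g, g, g, t, t} ∧ g * g * g = 1 ∧ g ≠ 1 ∧ t * t = 1 ∧ t ≠ 1) ∨
      ∃ x y, U = {x, x, x, y, y, y} ∧ x * x = 1 ∧ y * y = 1 ∧ x ≠ y ∧ x ≠ 1 ∧ y ≠ 1 := by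
  obtain ⟨l, rfl, h⟩ := exists_list_of_isProductOneAtom isOrderBlind_dihedralThreeTest
    (P := fun l => l.any fun x => l.any fun y =>
      (x * x * x == 1 && y * y == 1 && x != 1 && y != 1 && l.isPerm [x, x, x, x, y, y]) ||
      (x * x == 1 && y * y == 1 && x != y && x != 1 && y != 1 && l.isPerm [x, x, x, y, y, y]))
    (xs := [r 1, r 2, sr 0, sr 1, sr 2]) (by decide) (by norm_num) (by decide +kernel) hU hc
  simp only [List.any_eq_true, Bool.or_eq_true, Bool.and_eq_true, beq_iff_eq, bne_iff_ne,
    List.isPerm_iff] at h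
  obtain ⟨x, -, y, -, ⟨⟨⟨⟨h1, h2⟩, h3⟩, h4⟩, h5⟩ | ⟨⟨⟨⟨⟨h1, h2⟩, h3⟩, h4⟩, h5⟩, h6⟩⟩ := h
  · exact Or.inl ⟨x, y, Multiset.coe_eq_coe.2 h5, h1, h3, h2, h4⟩
  · exact Or.inr ⟨x, y, Multiset.coe_eq_coe.2 h6, h1, h2, h3, h4, h5⟩

theorem eq_of_atom_card_eq_six_dihedralFour {U : Multiset (DihedralGroup 4)}
    (hU : IsProductOneAtom U) (hc : U.card = 6) :
    ∃ x y y', U = {x, x, x, x, y, y'} ∧ x * x = y * y' ∧ x * x ≠ 1 ∧ x * y ≠ y * x := by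
  obtain ⟨l, rfl, h⟩ := exists_list_of_isProductOneAtom isOrderBlind_dihedralFourTest
    (P := fun l => l.any fun x => l.any fun y => l.any fun y' =>
      (x * x == y * y' && x * x != 1 && x * y != y * x && l.isPerm [x, x, x, x, y, y']))
    (xs := [r 1, r 2, r 3, sr 0, sr 1, sr 2, sr 3]) (by decide) (by norm_num)
    (by decide +kernel) hU hc
  simp only [List.any_eq_true, Bool.and_eq_true, beq_iff_eq, bne_iff_ne, List.isPerm_iff] at h
  obtain ⟨x, -, y, -, y', -, ⟨⟨h1, h2⟩, h3⟩, h4⟩ := h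
  exact ⟨x, y, y', Multiset.coe_eq_coe.2 h4, h1, h2, h3⟩

theorem eq_of_atom_card_eq_six_quaternion {U : Multiset (QuaternionGroup 2)}
    (hU : IsProductOneAtom U) (hc : U.card = 6) :
    ∃ x y y', U = {x, x, x, x, y, y'} ∧ x * x = y * y' ∧ x * x ≠ 1 ∧ x * y ≠ y * x := by
  obtain ⟨l, rfl, h⟩ := exists_list_of_isProductOneAtom isOrderBlind_quaternionTest
    (P := fun l => l.any fun x => l.any fun y => l.any fun y' =>
      (x * x == y * y' && x * x != 1 && x * y != y * x && l.isPerm [x, x, x, x, y, y']))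
    (xs := [a 1, a 2, a 3, xa 0, xa 1, xa 2, xa 3]) (by decide) (by norm_num)
    (by decide +kernel) hU hc
  simp only [List.any_eq_true, Bool.and_eq_true, beq_iff_eq, bne_iff_ne, List.isPerm_iff] at h
  obtain ⟨x, -, y, -, y', -, ⟨⟨h1, h2⟩, h3⟩, h4⟩ := h
  exact ⟨x, y, y', Multiset.coe_eq_coe.2 h4, h1, h2, h3⟩

/-- Needed for sequences with lengths $2$ and $5$, where atoms with five terms may occur. -/
theorem eq_of_atom_card_eq_five_quaternion {U : Multiset (QuaternionGroup 2)}
    (hU : IsProductOneAtom U) (hc : U.card = 5) :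
    (∃ u v, U = {a 2, u, u, v, v} ∧ u * v ≠ v * u) ∨
    (∃ u v, U = {a 2, u, u⁻¹, v, v⁻¹} ∧ u * v ≠ v * u) ∨
    ∃ u b c, U = {u, u, u, b, c} ∧ u * b ≠ b * u ∧ u * c ≠ c * u ∧ b * c ≠ c * b := by
  obtain ⟨l, rfl, h⟩ := exists_list_of_isProductOneAtom isOrderBlind_quaternionTest
    (P := fun l => l.any fun x => l.any fun y => (x * y != y * x) &&
      (l.isPerm [a 2, x, x, y, y] || (l.isPerm [a 2, x, x⁻¹, y, y⁻¹] ||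
        l.any fun c => (x * c != c * x && y * c != c * y && l.isPerm [x, x, x, y, c]))))
    (xs := [a 1, a 2, a 3, xa 0, xa 1, xa 2, xa 3]) (by decide) (by norm_num)
    (by decide +kernel) hU hc
  simp only [List.any_eq_true, Bool.and_eq_true, Bool.or_eq_true, bne_iff_ne,
    List.isPerm_iff] at h
  obtain ⟨x, -, y, -, h1, h | h | ⟨c, -, ⟨h2, h3⟩, h4⟩⟩ := h
  · exact Or.inl ⟨x, y, Multiset.coe_eq_coe.2 h, h1⟩
  · exact Or.inr (Or.inl ⟨x, y, Multiset.coe_eq_coe.2 h, h1⟩)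
  · exact Or.inr (Or.inr ⟨x, y, c, Multiset.coe_eq_coe.2 h4, h1, h2, h3⟩)

end Enumeration

/-! ### Short atoms and sequences with lengths two and six -/

section Factorizations

variable {G : Type*} [Group G]

theorem exists_hasFactorizationLength_iff (P : Set ℕ → Prop) :
    (∃ S : Multiset G, IsProductOne S ∧ P {k | HasFactorizationLength S k}) ↔
      ∃ L ∈ groupSystemOfSetsOfLengths G, P L := by
  simp only [mem_groupSystemOfSetsOfLengths_iff]
  constructor
  · rintro ⟨S, hS, h⟩; exact ⟨_, ⟨S, hS, rfl⟩, h⟩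
  · rintro ⟨_, ⟨S, hS, rfl⟩, h⟩; exact ⟨S, hS, h⟩

/-- Two atoms without the identity would already need four terms. -/
theorem IsProductOne.isProductOneAtom_of_card_le_three {S : Multiset G} (hS : IsProductOne S)
    (h0 : S ≠ 0) (h1 : 1 ∉ S) (hc : S.card ≤ 3) : IsProductOneAtom S := by
  obtain ⟨k, hk, hk2, hF⟩ := hS.exists_hasFactorizationLength h0 h1
  obtain rfl : k = 1 := by omega
  exact hasFactorizationLength_one.1 hF

theorem hasFactorizationLength_three_or_four {A B C : Multiset G} (hA : IsProductOneAtom A)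
    (hB : IsProductOneAtom B) (hC : IsProductOne C) (h0 : C ≠ 0) (h1 : 1 ∉ C) (hc : C.card ≤ 5) :
    HasFactorizationLength (A + (B + C)) 3 ∨ HasFactorizationLength (A + (B + C)) 4 := by
  obtain ⟨k, hk, hk2, hF⟩ := hC.exists_hasFactorizationLength h0 h1
  have h := hA.hasFactorizationLength.add (hB.hasFactorizationLength.add hF)
  have : k = 1 ∨ k = 2 := by omega
  rcases this with rfl | rfl
  exacts [Or.inl h, Or.inr h]

/-- A proper splitting consists of two pairs with product one, and $p$ would belong to one of them.
-/
theorem isProductOneAtom_of_four {p q r s : G} (h : IsProductOne {p, q, r, s})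
    (h1 : 1 ∉ ({p, q, r, s} : Multiset G)) (hq : p * q ≠ 1) (hr : p * r ≠ 1) (hs : p * s ≠ 1) :
    IsProductOneAtom {p, q, r, s} := by
  have key : ∀ T₁ T₂ : Multiset G, IsProductOne T₁ → IsProductOne T₂ →
      ({p, q, r, s} : Multiset G) = T₁ + T₂ → p ∈ T₁ → T₂ = 0 := by
    intro T₁ T₂ h₁ h₂ hT hp
    by_contra h0
    obtain ⟨T, rfl⟩ := Multiset.exists_cons_of_mem hp
    rw [hT, Multiset.mem_add, not_or] at h1
    obtain ⟨k, hk, hk2, -⟩ := h₂.exists_hasFactorizationLength h0 h1.2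
    obtain ⟨k', hk', hk2', -⟩ := h₁.exists_hasFactorizationLength (by simp) h1.1
    have hc := congrArg Multiset.card hT
    rw [Multiset.card_add] at hc
    simp only [Multiset.insert_eq_cons, Multiset.card_cons, Multiset.card_singleton] at hc hk2'
    obtain ⟨w, rfl⟩ := Multiset.card_eq_one.1 (show T.card = 1 by omega)
    have hw : w ∈ ({q, r, s} : Multiset G) := by
      have : ({q, r, s} : Multiset G) = {w} + T₂ := by
        rw [Multiset.cons_add] at hT
        exact (Multiset.cons_inj_right p).1 hT
      rw [this]; simp
    have hpw : p * w = 1 := isProductOne_pair.1 h₁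
    simp only [Multiset.insert_eq_cons, Multiset.mem_cons, Multiset.mem_singleton] at hw
    rcases hw with rfl | rfl | rfl
    exacts [hq hpw, hr hpw, hs hpw]
  refine ⟨h, by simp, fun T₁ T₂ h₁ h₂ hT => ?_⟩
  have : p ∈ T₁ + T₂ := by rw [← hT]; simp
  rcases Multiset.mem_add.1 this with hp | hp
  · exact Or.inr (key T₁ T₂ h₁ h₂ hT hp)
  · exact Or.inl (key T₂ T₁ h₂ h₁ (by rw [hT, add_comm]) hp)

theorem isProductOneAtom_four_of_order_four {x : G} (h4 : x ^ 4 = 1) (h2 : x * x ≠ 1) :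
    IsProductOneAtom {x, x, x, x} := by
  have hx : x ≠ 1 := by rintro rfl; simp at h2
  refine isProductOneAtom_of_four ⟨[x, x, x, x], rfl, ?_⟩ (by simpa using hx.symm) h2 h2 h2
  rw [← h4]; simp [pow_succ, mul_assoc]

/-- The data of a sequence with factorization lengths two and six. -/
theorem exists_atoms_of_two_of_six (hD : AtomCardLE G 6) {S : Multiset G}
    (h2 : HasFactorizationLength S 2) (h6 : HasFactorizationLength S 6) :
    1 ∉ S ∧ (∃ U V, IsProductOneAtom U ∧ IsProductOneAtom V ∧ S = U + V ∧
      U.card = 6 ∧ V.card = 6) ∧ ∃ T : Multiset G, T.card = 6 ∧ S = T + T.map fun x => x⁻¹ := by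
  have h1 := HasFactorizationLength.one_notMem (by norm_num) h2 h6
  have hle := h6.two_mul_le h1
  obtain ⟨U, V, hU, hV, rfl⟩ := hasFactorizationLength_two.1 h2
  have hU' := hD U hU
  have hV' := hD V hV
  rw [Multiset.card_add] at hle
  refine ⟨h1, ⟨U, V, hU, hV, rfl, by omega, by omega⟩, ?_⟩
  exact h6.exists_pairs h1 (by rw [Multiset.card_add]; omega)

theorem exists_two_of_six (h6 : ∃ U : Multiset G, IsProductOneAtom U ∧ U.card = 6) :
    ∃ S : Multiset G, HasFactorizationLength S 2 ∧ HasFactorizationLength S 6 := by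
  obtain ⟨U, hU, hc⟩ := h6
  refine ⟨U + U.map fun x => x⁻¹, hasFactorizationLength_two.2 ⟨U, _, hU, hU.inv, rfl⟩, ?_⟩
  rw [← hc]
  exact hasFactorizationLength_pairs U (hU.one_notMem (by omega))

/-- Applies to $D_4$ and $Q_8$. By the symmetry under inversion the second atom contains $x^{-1}$
four times, so the sequence is $x^4 y y' \cdot x^{-4} v v'$. It regroups as $x^4$, $x^{-2} y y'$ and
$x^{-2} v v'$. -/
theorem hasFactorizationLength_three_of_two_of_six (hD : AtomCardLE G 6) (h4 : ∀ x : G, x ^ 4 = 1)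
    (hform : ∀ U : Multiset G, IsProductOneAtom U → U.card = 6 → ∃ x y y',
      U = {x, x, x, x, y, y'} ∧ x * x = y * y' ∧ x * x ≠ 1 ∧ x * y ≠ y * x)
    {S : Multiset G} (h2 : HasFactorizationLength S 2) (h6 : HasFactorizationLength S 6) :
    HasFactorizationLength S 3 := by
  classical
  obtain ⟨h1, ⟨U, V, hU, hV, rfl, hUc, hVc⟩, T, -, hT⟩ := exists_atoms_of_two_of_six hD h2 h6
  obtain ⟨x, y, y', rfl, hxy, hx1, hc⟩ := hform U hU hUc
  obtain ⟨u, v, v', rfl, huv, hu1, hc'⟩ := hform V hV hVc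
  have hx4 : x * x * (x * x) = 1 := by rw [← h4 x]; simp [pow_succ, mul_assoc]
  have hxx : x⁻¹ ≠ x := fun h => hx1 (by nth_rw 1 [← h]; simp)
  have hy : x⁻¹ ≠ y := by rintro rfl; simp at hc
  have hy' : x⁻¹ ≠ y' := by
    rintro rfl
    have e : y = x * x * x := mul_inv_eq_iff_eq_mul.1 hxy.symm
    rw [e] at hc
    simp [mul_assoc] at hc
  have hcount := count_inv_eq_of_pairs hT x
  have hu : u = x⁻¹ := by
    by_contra hne
    simp only [Multiset.insert_eq_cons, Multiset.count_add, Multiset.count_cons,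
      Multiset.count_singleton, Ne.symm hne, hxx, hy, hy', if_false, if_true] at hcount
    split_ifs at hcount <;> omega
  subst hu
  have hxi : x⁻¹ * x⁻¹ = x * x := by
    rw [← mul_inv_rev, inv_eq_of_mul_eq_one_left hx4]
  have hx0 : x ≠ 1 := by rintro rfl; simp at hx1
  have hquad : ∀ p q : G, x * x = p * q → x * p ≠ p * x → p ≠ 1 → q ≠ 1 →
      IsProductOneAtom {x⁻¹, x⁻¹, p, q} := by
    intro p q hpq hxp hp hq
    refine isProductOneAtom_of_four ⟨[x⁻¹, x⁻¹, p, q], rfl, ?_⟩ ?_ (hxi ▸ hx1) ?_ ?_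
    · rw [← hx4]
      nth_rw 2 [hpq]
      rw [← hxi]
      simp [mul_assoc]
    · simp [hp.symm, hq.symm, hx0]
    · intro h
      rw [inv_mul_eq_one] at h
      exact hxp (by rw [h])
    · intro h
      rw [inv_mul_eq_one] at h
      rw [← h, mul_left_inj] at hpq
      exact hxp (by rw [hpq])
  have m : ∀ w ∈ ({x, x, x, x, y, y'} : Multiset G) + {x⁻¹, x⁻¹, x⁻¹, x⁻¹, v, v'}, w ≠ 1 :=
    fun w hw h => h1 (h ▸ hw)
  rw [hasFactorizationLength_three]
  refine ⟨{x, x, x, x}, {x⁻¹, x⁻¹, y, y'}, {x⁻¹, x⁻¹, v, v'},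
    isProductOneAtom_four_of_order_four (h4 x) hx1,
    hquad y y' hxy hc (m _ (by simp)) (m _ (by simp)),
    hquad v v' (hxi ▸ huv) ?_ (m _ (by simp)) (m _ (by simp)), ?_⟩
  · intro h
    apply hc'
    rw [inv_mul_eq_iff_eq_mul, ← mul_assoc, eq_mul_inv_iff_mul_eq, h]
  · simp only [Multiset.insert_eq_cons, ← Multiset.singleton_add]
    abel

end Factorizations

/-! ### Atoms over two involutions and their commutator -/

section TwoAndThreeElements

variable {G : Type*} [Group G]

theorem Multiset.exists_eq_replicate_add_replicate {α : Type*} {x y : α} {W : Multiset α}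
    (h : ∀ w ∈ W, w = x ∨ w = y) :
    ∃ a b, W = Multiset.replicate a x + Multiset.replicate b y := by
  induction W using Multiset.induction_on with
  | empty => exact ⟨0, 0, by simp⟩
  | cons w W ih =>
    obtain ⟨a, b, rfl⟩ := ih fun v hv => h v (Multiset.mem_cons_of_mem hv)
    rcases h w (Multiset.mem_cons_self _ _) with rfl | rfl
    · exact ⟨a + 1, b, by rw [Multiset.replicate_succ, Multiset.cons_add]⟩
    · exact ⟨a, b + 1, by rw [Multiset.replicate_succ, Multiset.add_cons]⟩

theorem Multiset.exists_eq_replicate_add_replicate_add_replicate {α : Type*} {x y z : α}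
    {W : Multiset α} (h : ∀ w ∈ W, w = x ∨ w = y ∨ w = z) :
    ∃ a b c, W = Multiset.replicate a x + Multiset.replicate b y + Multiset.replicate c z := by
  induction W using Multiset.induction_on with
  | empty => exact ⟨0, 0, 0, by simp⟩
  | cons w W ih =>
    obtain ⟨a, b, c, rfl⟩ := ih fun v hv => h v (Multiset.mem_cons_of_mem hv)
    rcases h w (Multiset.mem_cons_self _ _) with rfl | rfl | rfl
    · exact ⟨a + 1, b, c, by rw [Multiset.replicate_succ, Multiset.cons_add, Multiset.cons_add]⟩
    · exact ⟨a, b + 1, c, by rw [Multiset.replicate_succ, Multiset.add_cons, Multiset.cons_add]⟩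
    · exact ⟨a, b, c + 1, by rw [Multiset.replicate_succ, Multiset.add_cons]⟩

theorem IsOrderBlind.eq_true {χ : G → Bool} (hχ : IsOrderBlind χ) {l : List G}
    (h : IsProductOne (l : Multiset G)) : χ l.prod = true := by
  obtain ⟨m, hm, h⟩ := h
  rw [← hχ.perm (Multiset.coe_eq_coe.1 hm), h, hχ.one]

theorem IsOrderBlind.pow_mul_pow_mul_pow {χ : G → Bool} (hχ : IsOrderBlind χ) {x y z : G}
    {a b c : ℕ} (h : IsProductOne
      (Multiset.replicate a x + Multiset.replicate b y + Multiset.replicate c z)) :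
    χ (x ^ a * y ^ b * z ^ c) = true := by
  have := hχ.eq_true (l := List.replicate a x ++ List.replicate b y ++ List.replicate c z)
    (by simpa only [← Multiset.coe_add, Multiset.coe_replicate] using h)
  simpa [mul_assoc] using this

theorem isProductOne_of_pow_mul_pow_mul_pow {x y z : G} {a b c : ℕ}
    (h : x ^ a * y ^ b * z ^ c = 1) : IsProductOne
      (Multiset.replicate a x + Multiset.replicate b y + Multiset.replicate c z) := by
  refine ⟨List.replicate a x ++ List.replicate b y ++ List.replicate c z, ?_, by simpa [mul_assoc] using h⟩
  simp only [← Multiset.coe_add, Multiset.coe_replicate]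

theorem pow_eq_one_of_even {x : G} (hx : x * x = 1) {a : ℕ} (ha : Even a) : x ^ a = 1 := by
  obtain ⟨k, rfl⟩ := ha
  rw [← two_mul, pow_mul, pow_two, hx, one_pow]

theorem pow_eq_self_of_odd {x : G} (hx : x * x = 1) {a : ℕ} (ha : Odd a) : x ^ a = x := by
  obtain ⟨k, rfl⟩ := ha
  rw [pow_succ, pow_eq_one_of_even hx (even_two_mul k), one_mul]

/-- Atoms over two non-commuting involutions and their commutator in a group of class two. -/
theorem card_eq_of_atom_of_involutions {x y z : G} (hx : x * x = 1) (hy : y * y = 1)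
    (hz : z * z = 1) (hz1 : z ≠ 1) (hxz : x * z = z * x) (hyz : y * z = z * y)
    (hxy : x * y * x * y = z) {χ : G → Bool} (hχ : IsOrderBlind χ)
    (hχx : ∀ w, w = 1 ∨ w = z → χ (x * w) = false ∧ χ (y * w) = false ∧ χ (x * y * w) = false)
    {W : Multiset G} (hW : IsProductOneAtom W) (h : ∀ w ∈ W, w = x ∨ w = y ∨ w = z) :
    W.card = 2 ∨ W.card = 5 := by
  obtain ⟨a, b, c, rfl⟩ := Multiset.exists_eq_replicate_add_replicate_add_replicate h
  -- The test `χ` sees the product in a fixed order and rejects odd exponents of $x$ or $y$.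
  have hev : Even a ∧ Even b := by
    have h1 := hχ.pow_mul_pow_mul_pow hW.1
    have hw : z ^ c = 1 ∨ z ^ c = z := by
      rcases Nat.even_or_odd c with hc | hc
      · exact Or.inl (pow_eq_one_of_even hz hc)
      · exact Or.inr (pow_eq_self_of_odd hz hc)
    have h2 := hχx _ hw
    rcases Nat.even_or_odd a with ha | ha <;> rcases Nat.even_or_odd b with hb | hb
    · exact ⟨ha, hb⟩
    · rw [pow_eq_one_of_even hx ha, pow_eq_self_of_odd hy hb, one_mul, h2.2.1] at h1
      simp at h1
    · rw [pow_eq_self_of_odd hx ha, pow_eq_one_of_even hy hb, mul_one, h2.1] at h1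
      simp at h1
    · rw [pow_eq_self_of_odd hx ha, pow_eq_self_of_odd hy hb, h2.2.2] at h1
      simp at h1
  obtain ⟨ha, hb⟩ := hev
  have hone : ∀ a' b' c', Even a' → Even b' → Even c' → IsProductOne
      (Multiset.replicate a' x + Multiset.replicate b' y + Multiset.replicate c' z) :=
    fun a' b' c' ha hb hc => isProductOne_of_pow_mul_pow_mul_pow (by
      rw [pow_eq_one_of_even hx ha, pow_eq_one_of_even hy hb, pow_eq_one_of_even hz hc]; simp)
  -- A remainder with even exponents has product one, so any non-empty product-one part leaving such
  -- a remainder is the whole atom.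
  have split : ∀ p q r, p ≤ a → q ≤ b → r ≤ c → Even (a - p) → Even (b - q) → Even (c - r) →
      0 < p + q + r → IsProductOne
        (Multiset.replicate p x + Multiset.replicate q y + Multiset.replicate r z) →
      (Multiset.replicate a x + Multiset.replicate b y + Multiset.replicate c z).card
        = p + q + r := by
    intro p q r hp hq hr ea eb ec h0 h1
    rcases hW.2.2 _ _ h1 (hone _ _ _ ea eb ec) (by
      obtain ⟨a', rfl⟩ := Nat.exists_eq_add_of_le hp
      obtain ⟨b', rfl⟩ := Nat.exists_eq_add_of_le hq
      obtain ⟨c', rfl⟩ := Nat.exists_eq_add_of_le hr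
      simp only [Nat.add_sub_cancel_left, Multiset.replicate_add]
      abel) with h | h
    · have := congrArg Multiset.card h
      simp only [Multiset.card_add, Multiset.card_replicate, Multiset.card_zero] at this
      omega
    · have := congrArg Multiset.card h
      simp only [Multiset.card_add, Multiset.card_replicate, Multiset.card_zero] at this ⊢
      omega
  have h0 : 0 < a + b + c := by
    have := Multiset.card_pos.2 hW.2.1
    simpa using this
  rcases Nat.even_or_odd c with hc | hc
  · left
    rcases Nat.eq_zero_or_pos a with h1 | h1
    · rcases Nat.eq_zero_or_pos b with h2 | h2
      · exact split 0 0 2 (by omega) (by omega) (by obtain ⟨k, rfl⟩ := hc; omega) (by simpa)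
          (by simpa) (hc.tsub even_two) (by omega) (hone _ _ _ (by simp) (by simp) (by simp))
      · exact split 0 2 0 (by omega) (by obtain ⟨k, rfl⟩ := hb; omega) (by omega) (by simpa)
          (hb.tsub even_two) (by simpa) (by omega) (hone _ _ _ (by simp) (by simp) (by simp))
    · exact split 2 0 0 (by obtain ⟨k, rfl⟩ := ha; omega) (by omega) (by omega)
        (ha.tsub even_two) (by simpa) (by simpa) (by omega)
        (hone _ _ _ (by simp) (by simp) (by simp))
  · right
    -- Without $x$ or without $y$ all terms commute, and the product would be $z$. With both
    -- present, $xyxyz = 1$ can be split off.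
    have hcomm : (a = 0 ∨ b = 0) → False := by
      intro h0
      obtain ⟨l, hl, hp⟩ := hW.1
      have hpow : (List.replicate a x ++ List.replicate b y ++ List.replicate c z).prod = l.prod := by
        refine List.Perm.prod_eq' (Multiset.coe_eq_coe.1 ?_) ?_
        · rw [hl]; simp only [← Multiset.coe_add, Multiset.coe_replicate]
        · refine List.pairwise_of_forall_mem_list fun p hp q hq => ?_
          have hxyc : ∀ r, r ∈ List.replicate a x ++ List.replicate b y ++ List.replicate c z →
              (r = x ∧ a ≠ 0) ∨ (r = y ∧ b ≠ 0) ∨ r = z := by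
            intro r hr
            simp only [List.mem_append, List.mem_replicate] at hr
            tauto
          rcases hxyc p hp with ⟨rfl, h1⟩ | ⟨rfl, h1⟩ | rfl <;>
            rcases hxyc q hq with ⟨rfl, h2⟩ | ⟨rfl, h2⟩ | rfl <;>
            first
            | rfl
            | (exfalso; tauto)
            | exact hxz
            | exact hyz
            | exact hxz.symm
            | exact hyz.symm
      rw [hp] at hpow
      simp only [List.prod_append, List.prod_replicate, pow_eq_one_of_even hx ha,
        pow_eq_one_of_even hy hb, pow_eq_self_of_odd hz hc, one_mul] at hpow
      exact hz1 hpow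
    have ha0 : a ≠ 0 := fun h => hcomm (Or.inl h)
    have hb0 : b ≠ 0 := fun h => hcomm (Or.inr h)
    refine split 2 2 1 (by obtain ⟨k, rfl⟩ := ha; omega) (by obtain ⟨k, rfl⟩ := hb; omega)
      hc.pos (ha.tsub even_two) (hb.tsub even_two) (hc.tsub_odd odd_one) (by omega)
      ⟨[x, y, x, y, z], ?_, ?_⟩
    · simp only [Multiset.replicate_succ, Multiset.replicate_zero, ← Multiset.singleton_add,
        ← Multiset.cons_coe, Multiset.coe_nil]
      abel
    · rw [← hz]
      nth_rw 2 [← hxy]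
      simp [mul_assoc]

theorem HasFactorizationLength.exists_of_card_eq {S : Multiset G} {k m n : ℕ}
    (h : HasFactorizationLength S k)
    (hS : ∀ U ≤ S, IsProductOneAtom U → U.card = m ∨ U.card = n) :
    ∃ i j, k = i + j ∧ S.card = i * m + j * n := by
  induction k generalizing S with
  | zero => exact ⟨0, 0, rfl, by
      obtain ⟨s, -, rfl, hs⟩ := h
      simp [Multiset.card_eq_zero.1 hs]⟩
  | succ k ih =>
    obtain ⟨U, T, hU, hT, rfl⟩ := hasFactorizationLength_succ.1 h
    obtain ⟨i, j, rfl, hc⟩ := ih hT fun V hV => hS V (hV.trans (Multiset.le_add_left _ _))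
    rcases hS U (Multiset.le_add_right _ _) hU with h1 | h1
    · exact ⟨i + 1, j, by omega, by rw [Multiset.card_add, hc, h1]; ring⟩
    · exact ⟨i, j + 1, by omega, by rw [Multiset.card_add, hc, h1]; ring⟩

end TwoAndThreeElements

/-! ### Sets of lengths over $D_4$ and $Q_8$ -/

section OrderEight

open DihedralGroup QuaternionGroup

theorem dihedralFour_three_of_two_of_six (hD : AtomCardLE (DihedralGroup 4) 6)
    {S : Multiset (DihedralGroup 4)} (h2 : HasFactorizationLength S 2)
    (h6 : HasFactorizationLength S 6) : HasFactorizationLength S 3 :=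
  hasFactorizationLength_three_of_two_of_six hD (by decide +kernel)
    (fun _ => eq_of_atom_card_eq_six_dihedralFour) h2 h6

theorem quaternion_three_of_two_of_six (hD : AtomCardLE (QuaternionGroup 2) 6)
    {S : Multiset (QuaternionGroup 2)} (h2 : HasFactorizationLength S 2)
    (h6 : HasFactorizationLength S 6) : HasFactorizationLength S 3 :=
  hasFactorizationLength_three_of_two_of_six hD (by decide +kernel)
    (fun _ => eq_of_atom_card_eq_six_quaternion) h2 h6

/-- The sequence `x⁴ y⁴ z²`, for non-commuting involutions `x` and `y` with commutator `z`, has set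
of lengths `{2, 5}`. -/
theorem dihedralFour_exists_two_five : ∃ S : Multiset (DihedralGroup 4),
    HasFactorizationLength S 2 ∧ HasFactorizationLength S 5 ∧
      ¬ HasFactorizationLength S 3 ∧ ¬ HasFactorizationLength S 4 := by
  have hU : IsProductOneAtom
      (([sr 0, sr 0, sr 1, sr 1, r 2] : List (DihedralGroup 4)) : Multiset (DihedralGroup 4)) := by
    rw [isProductOneAtom_iff_test isOrderBlind_dihedralFourTest]
    decide +kernel
  set U : Multiset (DihedralGroup 4) :=
    (([sr 0, sr 0, sr 1, sr 1, r 2] : List (DihedralGroup 4)) : Multiset (DihedralGroup 4))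
  have hmem : ∀ w ∈ U + U.map (fun x => x⁻¹), w = sr 0 ∨ w = sr 1 ∨ w = r 2 := by decide
  have key : ∀ k, HasFactorizationLength (U + U.map fun x => x⁻¹) k → k = 2 ∨ k = 5 := by
    intro k hk
    obtain ⟨i, j, rfl, hc⟩ := hk.exists_of_card_eq (m := 2) (n := 5) (by
      intro W hW hA
      refine card_eq_of_atom_of_involutions (x := sr 0) (y := sr 1) (z := r 2) (by decide)
        (by decide) (by decide) (by decide) (by decide) (by decide) (by decide)
        isOrderBlind_dihedralFourTest (by decide) hA ?_
      exact fun w hw => hmem w (Multiset.mem_of_le hW hw))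
    -- Ten terms in atoms of two or five terms make five atoms or two.
    have : Multiset.card (U + U.map fun x => x⁻¹) = 10 := by decide
    omega
  refine ⟨U + U.map fun x => x⁻¹, hasFactorizationLength_two.2 ⟨U, _, hU, hU.inv, rfl⟩,
    hasFactorizationLength_pairs U (by decide), fun h => ?_, fun h => ?_⟩
  · have := key 3 h; omega
  · have := key 4 h; omega

/-- Such a sequence has at least ten terms, so both atoms are among the enumerated ones or one has
only four terms. Every consistent case regroups into two atoms and a product-one sequence of four
terms, which contributes one or two further atoms. -/
theorem quaternion_not_two_five (hD : AtomCardLE (QuaternionGroup 2) 6)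
    {S : Multiset (QuaternionGroup 2)} (h2 : HasFactorizationLength S 2)
    (h5 : HasFactorizationLength S 5) :
    HasFactorizationLength S 3 ∨ HasFactorizationLength S 4 := by
  have h1 := HasFactorizationLength.one_notMem (by norm_num) h2 h5
  have hle := h5.two_mul_le h1
  obtain ⟨U, V, hU, hV, rfl⟩ := hasFactorizationLength_two.1 h2
  wlog hUV : V.card ≤ U.card generalizing U V with H
  · rw [add_comm U V] at h1 h2 h5 hle ⊢
    exact H V U hV hU h2 h5 h1 hle (by omega)
  have hz : (a 2 : QuaternionGroup 2) * a 2 = 1 := by decide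
  have hsq : ∀ u : QuaternionGroup 2, u * u ≠ 1 → u * u = a 2 := by decide +kernel
  have hnc : ∀ u v : QuaternionGroup 2, u * v ≠ v * u → u * u = a 2 ∧ v * v = a 2 ∧ u ≠ a 2 ∧
      v ≠ a 2 ∧ u * u ≠ 1 ∧ v * v ≠ 1 := by decide +kernel
  have h4 : ∀ u : QuaternionGroup 2, u ^ 4 = 1 := by decide +kernel
  -- Pairwise non-commuting elements represent the three classes $\{\pm i\}, \{\pm j\}, \{\pm k\}$.
  -- Their product is $\pm 1$, and exchanging two factors changes the sign.
  have habc : ∀ u v w : QuaternionGroup 2, u * v ≠ v * u → u * w ≠ w * u → v * w ≠ w * v →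
      u * v * w = 1 ∨ u * w * v = 1 := by decide +kernel
  -- Each non-commuting pair meets two of the three classes, so two pairs share a class.
  have hshare : ∀ u v w x : QuaternionGroup 2, u * v ≠ v * u → w * x ≠ x * w →
      (w = u ∨ w = u⁻¹) ∨ (w = v ∨ w = v⁻¹) ∨ (x = u ∨ x = u⁻¹) ∨ (x = v ∨ x = v⁻¹) := by
    decide +kernel
  -- splittings into two atoms and a short product-one sequence
  have split : ∀ A : Multiset (QuaternionGroup 2), ∀ B C : List (QuaternionGroup 2),
      U + V = A + (B + C) → IsProductOneAtom A → B.prod = 1 → C.prod = 1 → B.length = 3 →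
      C.length = 4 → HasFactorizationLength (U + V) 3 ∨ HasFactorizationLength (U + V) 4 := by
    intro A B C h hA hB hC hBc hCc
    rw [h, Multiset.mem_add, Multiset.mem_add, not_or, not_or] at h1
    rw [h]
    refine hasFactorizationLength_three_or_four hA ?_ (IsProductOne.of_list hC) ?_ h1.2.2 ?_
    · refine (IsProductOne.of_list hB).isProductOneAtom_of_card_le_three ?_ h1.2.1 ?_
      · rintro h; rw [Multiset.coe_eq_zero] at h; simp [h] at hBc
      · rw [Multiset.coe_card, hBc]
    · rintro h; rw [Multiset.coe_eq_zero] at h; simp [h] at hCc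
    · rw [Multiset.coe_card, hCc]; norm_num
  have split33 : ∀ A B C : List (QuaternionGroup 2),
      U + V = (A : Multiset (QuaternionGroup 2)) + ((B : Multiset (QuaternionGroup 2)) + C) →
      A.prod = 1 → B.prod = 1 → C.prod = 1 → A.length = 3 → B.length = 3 → C.length = 4 →
      HasFactorizationLength (U + V) 3 ∨ HasFactorizationLength (U + V) 4 := by
    intro A B C h hA hB hC hAc hBc hCc
    refine split A B C h ?_ hB hC hBc hCc
    rw [h, Multiset.mem_add, not_or] at h1
    refine (IsProductOne.of_list hA).isProductOneAtom_of_card_le_three ?_ h1.1 ?_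
    · rintro h; rw [Multiset.coe_eq_zero] at h; simp [h] at hAc
    · rw [Multiset.coe_card, hAc]
  have hU6 := hD U hU
  have hV6 := hD V hV
  rw [Multiset.card_add] at hle
  have hcases : U.card = 6 ∧ V.card = 6 ∨ U.card = 6 ∧ V.card = 5 ∨ U.card = 6 ∧ V.card = 4 ∨
      U.card = 5 ∧ V.card = 5 := by omega
  have hprod3 : ∀ u b c : QuaternionGroup 2, u * b ≠ b * u → u * c ≠ c * u → b * c ≠ c * b →
      ∃ B : List (QuaternionGroup 2), (B : Multiset (QuaternionGroup 2)) = {u, b, c} ∧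
        B.prod = 1 ∧ B.length = 3 := by
    intro u b c h1 h2 h3
    rcases habc u b c h1 h2 h3 with h | h
    · exact ⟨[u, b, c], rfl, by simpa [mul_assoc] using h, rfl⟩
    · refine ⟨[u, c, b], ?_, by simpa [mul_assoc] using h, rfl⟩
      exact Multiset.coe_eq_coe.2 (List.Perm.cons _ (List.Perm.swap _ _ _))
  rcases hcases with ⟨hc, hc'⟩ | ⟨hc, hc'⟩ | ⟨hc, hc'⟩ | ⟨hc, hc'⟩
  · obtain ⟨x, y, y', rfl, hxy, hx1, -⟩ := eq_of_atom_card_eq_six_quaternion hU hc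
    obtain ⟨u, v, v', rfl, huv, hu1, -⟩ := eq_of_atom_card_eq_six_quaternion hV hc'
    rw [hsq x hx1] at hxy
    rw [hsq u hu1] at huv
    have h1' : (1 : QuaternionGroup 2) ∉ ({y, y', v, v'} : Multiset (QuaternionGroup 2)) := by
      intro h
      apply h1
      simp only [Multiset.insert_eq_cons, Multiset.mem_cons, Multiset.mem_singleton] at h
      simp only [Multiset.insert_eq_cons, Multiset.mem_add, Multiset.mem_cons,
        Multiset.mem_singleton]
      tauto
    have := hasFactorizationLength_three_or_four
      (isProductOneAtom_four_of_order_four (h4 x) hx1)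
      (isProductOneAtom_four_of_order_four (h4 u) hu1) (C := {y, y', v, v'})
      ⟨[y, y', v, v'], rfl, by
        calc [y, y', v, v'].prod = (y * y') * (v * v') := by simp [mul_assoc]
          _ = 1 := by rw [← hxy, ← huv, hz]⟩ (by simp) h1' (by simp)
    convert this using 2 <;>
    · simp only [Multiset.insert_eq_cons, ← Multiset.singleton_add]
      abel
  · obtain ⟨x, y, y', rfl, hxy, hx1, -⟩ := eq_of_atom_card_eq_six_quaternion hU hc
    rw [hsq x hx1] at hxy
    have hx := isProductOneAtom_four_of_order_four (h4 x) hx1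
    rcases eq_of_atom_card_eq_five_quaternion hV hc' with ⟨u, v, rfl, huv⟩ | ⟨u, v, rfl, huv⟩ |
      ⟨u, b, c, rfl, hub, huc, hbc⟩
    · refine split {x, x, x, x} [y, y', a 2] [u, u, v, v] ?_ hx ?_ ?_ rfl rfl
      · simp only [Multiset.insert_eq_cons, ← Multiset.singleton_add, ← Multiset.cons_coe,
          Multiset.coe_nil]
        abel
      · calc [y, y', a 2].prod = (y * y') * a 2 := by simp [mul_assoc]
          _ = 1 := by rw [← hxy, hz]
      · calc [u, u, v, v].prod = (u * u) * (v * v) := by simp [mul_assoc]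
          _ = 1 := by rw [(hnc u v huv).1, (hnc u v huv).2.1, hz]
    · refine split {x, x, x, x} [y, y', a 2] [u, u⁻¹, v, v⁻¹] ?_ hx ?_ (by simp) rfl rfl
      · simp only [Multiset.insert_eq_cons, ← Multiset.singleton_add, ← Multiset.cons_coe,
          Multiset.coe_nil]
        abel
      · calc [y, y', a 2].prod = (y * y') * a 2 := by simp [mul_assoc]
          _ = 1 := by rw [← hxy, hz]
    · obtain ⟨B, hB, hB1, hB3⟩ := hprod3 u b c hub huc hbc
      refine split {x, x, x, x} B [y, y', u, u] ?_ hx hB1 ?_ hB3 rfl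
      · rw [hB]
        simp only [Multiset.insert_eq_cons, ← Multiset.singleton_add, ← Multiset.cons_coe,
          Multiset.coe_nil]
        abel
      · calc [y, y', u, u].prod = (y * y') * (u * u) := by simp [mul_assoc]
          _ = 1 := by rw [← hxy, (hnc u b hub).1, hz]
  -- With ten terms and length five the sequence is symmetric under inversion. This forces the
  -- second atom to be $x^{-4}$, and then $y^{-1}$ does not occur.
  · exfalso
    obtain ⟨T, -, hT⟩ := h5.exists_pairs h1 (by rw [Multiset.card_add]; omega)
    obtain ⟨x, y, y', rfl, hxy, hx1, hxyc⟩ := eq_of_atom_card_eq_six_quaternion hU hc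
    rw [hsq x hx1] at hxy
    have hcx := count_inv_eq_of_pairs hT x
    have hcy := count_inv_eq_of_pairs hT y
    have n1 : x⁻¹ ≠ x := fun h => hx1 (by nth_rw 1 [← h]; simp)
    have n2 : x⁻¹ ≠ y := by rintro rfl; simp at hxyc
    have n3 : x⁻¹ ≠ y' := by
      rintro rfl
      rw [eq_mul_inv_iff_mul_eq] at hxy
      apply hxyc
      rw [← hxy, ← hsq x hx1]
      simp only [mul_assoc]
    have hV4 : V = Multiset.replicate 4 x⁻¹ := by
      rw [Multiset.eq_replicate]
      refine ⟨hc', fun b hb => ?_⟩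
      have : V.count x⁻¹ = V.card := by
        refine le_antisymm (Multiset.count_le_card _ _) ?_
        simp only [Multiset.insert_eq_cons, Multiset.count_add, Multiset.count_cons,
          Multiset.count_singleton, n1, n2, n3, if_false, if_true] at hcx
        omega
      exact (Multiset.count_eq_card.1 this b hb).symm
    subst hV4
    have m1 : y⁻¹ ≠ x := fun h => n2 (by rw [← h, inv_inv])
    have m2 : y⁻¹ ≠ y := fun h => (hnc x y hxyc).2.2.2.2.2 (by nth_rw 1 [← h]; simp)
    have m3 : y⁻¹ ≠ y' := by
      intro h
      rw [← h, mul_inv_cancel] at hxy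
      revert hxy; decide
    have m4 : y⁻¹ ≠ x⁻¹ := by
      intro h
      rw [inv_inj.1 h] at hxyc
      exact hxyc rfl
    simp only [Multiset.insert_eq_cons, Multiset.count_add, Multiset.count_cons,
      Multiset.count_singleton, Multiset.count_replicate, m1, m2, m3, m4.symm, if_false,
      if_true] at hcy
    omega
  · obtain ⟨T, -, hT⟩ := h5.exists_pairs h1 (by rw [Multiset.card_add]; omega)
    -- The central involution is its own inverse and occurs an even number of times. This rules out
    -- one atom containing it once and the other not at all.
    have hev := even_count_of_pairs hT (x := a 2) (by decide)
    have hodd1 : ∀ u v : QuaternionGroup 2, u * v ≠ v * u →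
        Multiset.count (a 2) {a 2, u, u, v, v} = 1 := by decide +kernel
    have hodd2 : ∀ u v : QuaternionGroup 2, u * v ≠ v * u →
        Multiset.count (a 2) {a 2, u, u⁻¹, v, v⁻¹} = 1 := by decide +kernel
    have heven : ∀ u b c : QuaternionGroup 2, u * b ≠ b * u → u * c ≠ c * u →
        Multiset.count (a 2) {u, u, u, b, c} = 0 := by decide +kernel
    -- the mixed case of the first two types
    have mixed : ∀ u v w x : QuaternionGroup 2, u * v ≠ v * u → U + V =
        {a 2, u, u, v, v} + {a 2, w, w⁻¹, x, x⁻¹} →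
        HasFactorizationLength (U + V) 3 ∨ HasFactorizationLength (U + V) 4 := by
      intro u v w x huv h
      refine split33 [a 2, u, u] [a 2, v, v] [w, w⁻¹, x, x⁻¹] ?_ ?_ ?_ (by simp) rfl rfl rfl
      · rw [h]
        simp only [Multiset.insert_eq_cons, ← Multiset.singleton_add, ← Multiset.cons_coe,
          Multiset.coe_nil]
        abel
      · simp [(hnc u v huv).1, hz]
      · simp [(hnc u v huv).2.1, hz]
    rcases eq_of_atom_card_eq_five_quaternion hU hc with ⟨u, v, rfl, huv⟩ | ⟨u, v, rfl, huv⟩ |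
        ⟨u, b, c, rfl, hub, huc, hbc⟩ <;>
      rcases eq_of_atom_card_eq_five_quaternion hV hc' with ⟨w, x, rfl, hwx⟩ | ⟨w, x, rfl, hwx⟩ |
        ⟨w, d, e, rfl, hwd, hwe, hde⟩
    · refine split33 [a 2, u, u] [a 2, w, w] [v, v, x, x] ?_ ?_ ?_ ?_ rfl rfl rfl
      · simp only [Multiset.insert_eq_cons, ← Multiset.singleton_add, ← Multiset.cons_coe,
          Multiset.coe_nil]
        abel
      · simp [(hnc u v huv).1, hz]
      · simp [(hnc w x hwx).1, hz]
      · calc [v, v, x, x].prod = (v * v) * (x * x) := by simp [mul_assoc]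
          _ = 1 := by rw [(hnc u v huv).2.1, (hnc w x hwx).2.1, hz]
    · exact mixed u v w x huv rfl
    · rw [Multiset.count_add, hodd1 u v huv, heven w d e hwd hwe] at hev
      exact absurd hev (by decide)
    · exact mixed w x u v hwx (add_comm _ _)
    · -- both atoms contain a pair of the same class
      have key : ∀ p q r : QuaternionGroup 2, p * p = a 2 →
          ({a 2, u, u⁻¹, v, v⁻¹} : Multiset (QuaternionGroup 2)) + {a 2, w, w⁻¹, x, x⁻¹} =
            {a 2, p, p⁻¹, q, q⁻¹} + {a 2, p, p⁻¹, r, r⁻¹} →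
          HasFactorizationLength
              (({a 2, u, u⁻¹, v, v⁻¹} : Multiset (QuaternionGroup 2)) + {a 2, w, w⁻¹, x, x⁻¹}) 3 ∨
            HasFactorizationLength
              (({a 2, u, u⁻¹, v, v⁻¹} : Multiset (QuaternionGroup 2)) + {a 2, w, w⁻¹, x, x⁻¹}) 4 := by
        intro p q r hp h
        refine split33 [a 2, p, p] [p⁻¹, p⁻¹, a 2] [q, q⁻¹, r, r⁻¹] ?_ ?_ ?_ (by simp) rfl rfl rfl
        · rw [h]
          simp only [Multiset.insert_eq_cons, ← Multiset.singleton_add, ← Multiset.cons_coe,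
            Multiset.coe_nil]
          abel
        · simp [hp, hz]
        · simp [← hp]
      have hu := (hnc u v huv).1
      have hv := (hnc u v huv).2.1
      rcases hshare u v w x huv hwx with (rfl | rfl) | (rfl | rfl) | (rfl | rfl) | (rfl | rfl)
      · exact key w v x hu rfl
      · refine key u v x hu ?_
        simp only [Multiset.insert_eq_cons, ← Multiset.singleton_add, inv_inv]; abel
      · refine key w u x hv ?_
        simp only [Multiset.insert_eq_cons, ← Multiset.singleton_add]; abel
      · refine key v u x hv ?_
        simp only [Multiset.insert_eq_cons, ← Multiset.singleton_add, inv_inv]; abel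
      · refine key x v w hu ?_
        simp only [Multiset.insert_eq_cons, ← Multiset.singleton_add]; abel
      · refine key u v w hu ?_
        simp only [Multiset.insert_eq_cons, ← Multiset.singleton_add, inv_inv]; abel
      · refine key x u w hv ?_
        simp only [Multiset.insert_eq_cons, ← Multiset.singleton_add]; abel
      · refine key v u w hv ?_
        simp only [Multiset.insert_eq_cons, ← Multiset.singleton_add, inv_inv]; abel
    · rw [Multiset.count_add, hodd2 u v huv, heven w d e hwd hwe] at hev
      exact absurd hev (by decide)
    · rw [Multiset.count_add, heven u b c hub huc, hodd1 w x hwx] at hev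
      exact absurd hev (by decide)
    · rw [Multiset.count_add, heven u b c hub huc, hodd2 w x hwx] at hev
      exact absurd hev (by decide)
    · obtain ⟨A, hA, hA1, hA3⟩ := hprod3 u b c hub huc hbc
      obtain ⟨B, hB, hB1, hB3⟩ := hprod3 w d e hwd hwe hde
      refine split33 A B [u, u, w, w] ?_ hA1 hB1 ?_ hA3 hB3 rfl
      · rw [hA, hB]
        simp only [Multiset.insert_eq_cons, ← Multiset.singleton_add, ← Multiset.cons_coe,
          Multiset.coe_nil]
        abel
      · calc [u, u, w, w].prod = (u * u) * (w * w) := by simp [mul_assoc]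
          _ = 1 := by rw [(hnc u b hub).1, (hnc w d hwd).1, hz]

end OrderEight

/-! ### Sets of lengths over $D_3$ -/

section OrderSix

open DihedralGroup

/-- The test forces equal parities of the two multiplicities. If both are even, a pair of equal
terms splits off. If both are odd, neither is one, because $xy \ne 1$, so both are at least three.
-/
theorem card_of_atom_of_two_involutions {G : Type*} [Group G] [DecidableEq G] {x y : G}
    (hx : x * x = 1) (hy : y * y = 1) (hxy : x ≠ y) {χ : G → Bool} (hχ : IsOrderBlind χ)
    (hχx : χ x = false) (hχy : χ y = false) {W : Multiset G} (hW : IsProductOneAtom W)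
    (h : ∀ w ∈ W, w = x ∨ w = y) :
    (W.card = 2 ∧ Even (W.count x)) ∨ (6 ≤ W.card ∧ Odd (W.count x)) := by
  obtain ⟨a, b, rfl⟩ := Multiset.exists_eq_replicate_add_replicate h
  have hcount : (Multiset.replicate a x + Multiset.replicate b y).count x = a := by
    rw [Multiset.count_add, Multiset.count_replicate_self, Multiset.count_replicate,
      if_neg hxy.symm, add_zero]
  have hcard : (Multiset.replicate a x + Multiset.replicate b y).card = a + b := by simp
  rw [hcount, hcard]
  have h1 := hχ.pow_mul_pow_mul_pow (x := x) (y := y) (z := 1) (a := a) (b := b) (c := 0)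
    (by simpa using hW.1)
  rw [pow_zero, mul_one] at h1
  have hone : ∀ a' b', Even a' → Even b' → IsProductOne
      (Multiset.replicate a' x + Multiset.replicate b' y) := fun a' b' ha hb => by
    have := isProductOne_of_pow_mul_pow_mul_pow (x := x) (y := y) (z := 1) (a := a') (b := b')
      (c := 0) (by rw [pow_eq_one_of_even hx ha, pow_eq_one_of_even hy hb]; simp)
    simpa using this
  have split : ∀ p q, p ≤ a → q ≤ b → Even (a - p) → Even (b - q) → 0 < p + q →
      IsProductOne (Multiset.replicate p x + Multiset.replicate q y) → a + b = p + q := by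
    intro p q hp hq ea eb h0 h1
    rcases hW.2.2 _ _ h1 (hone _ _ ea eb) (by
      obtain ⟨a', rfl⟩ := Nat.exists_eq_add_of_le hp
      obtain ⟨b', rfl⟩ := Nat.exists_eq_add_of_le hq
      simp only [Nat.add_sub_cancel_left, Multiset.replicate_add]
      abel) with h | h
    · have := congrArg Multiset.card h
      simp only [Multiset.card_add, Multiset.card_replicate, Multiset.card_zero] at this
      omega
    · have := congrArg Multiset.card h
      simp only [Multiset.card_add, Multiset.card_replicate, Multiset.card_zero] at this
      omega
  have h0 : 0 < a + b := by
    rw [← hcard]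
    exact Multiset.card_pos.2 hW.2.1
  rcases Nat.even_or_odd a with ha | ha <;> rcases Nat.even_or_odd b with hb | hb
  · refine Or.inl ⟨?_, ha⟩
    rcases Nat.eq_zero_or_pos a with h2 | h2
    · exact split 0 2 (by omega) (by obtain ⟨k, rfl⟩ := hb; omega) (by simpa)
        (hb.tsub even_two) (by omega) (hone _ _ (by simp) (by simp))
    · exact split 2 0 (by obtain ⟨k, rfl⟩ := ha; omega) (by omega) (ha.tsub even_two)
        (by simpa) (by omega) (hone _ _ (by simp) (by simp))
  · rw [pow_eq_one_of_even hx ha, pow_eq_self_of_odd hy hb, one_mul, hχy] at h1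
    simp at h1
  · rw [pow_eq_self_of_odd hx ha, pow_eq_one_of_even hy hb, mul_one, hχx] at h1
    simp at h1
  · refine Or.inr ⟨?_, ha⟩
    have aux : ∀ (u v : G) (n : ℕ), u ≠ v → v * v = 1 → Odd n →
        ¬ IsProductOne (Multiset.replicate 1 u + Multiset.replicate n v) := by
      intro u v n huv hv hn hp
      rw [Multiset.replicate_one, Multiset.singleton_add] at hp
      obtain ⟨l, hl, hp⟩ := isProductOne_cons_iff.1 hp
      rw [← Multiset.coe_replicate, Multiset.coe_eq_coe, List.perm_replicate] at hl
      rw [hl, List.prod_replicate, pow_eq_self_of_odd hv hn] at hp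
      exact huv (mul_right_cancel (hp.trans hv.symm))
    have ha1 : a ≠ 1 := by
      rintro rfl
      exact aux x y b hxy hy hb hW.1
    have hb1 : b ≠ 1 := by
      rintro rfl
      exact aux y x a hxy.symm hx ha (by rw [add_comm]; exact hW.1)
    obtain ⟨k, rfl⟩ := ha
    obtain ⟨m, rfl⟩ := hb
    omega

/-- Here $i$ counts the pairs and $j$ the long atoms; the parity of $j$ is visible in the
multiplicity of $x$. -/
theorem HasFactorizationLength.exists_of_two_involutions {G : Type*} [Group G] [DecidableEq G]
    {x y : G} (hx : x * x = 1) (hy : y * y = 1) (hxy : x ≠ y) {χ : G → Bool} (hχ : IsOrderBlind χ)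
    (hχx : χ x = false) (hχy : χ y = false) {S : Multiset G} (h : ∀ w ∈ S, w = x ∨ w = y) {k : ℕ}
    (hF : HasFactorizationLength S k) : ∃ i j, k = i + j ∧ 2 * i + 6 * j ≤ S.card ∧
      (j = 0 → S.card = 2 * i) ∧ (S.count x + j) % 2 = 0 := by
  induction k generalizing S with
  | zero =>
    obtain ⟨s, -, rfl, hs⟩ := hF
    exact ⟨0, 0, by simp [Multiset.card_eq_zero.1 hs]⟩
  | succ k ih =>
    obtain ⟨U, T, hU, hT, rfl⟩ := hasFactorizationLength_succ.1 hF
    obtain ⟨i, j, rfl, h1, h2, h3⟩ := ih (fun w hw => h w (Multiset.mem_add.2 (Or.inr hw))) hT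
    rw [Multiset.card_add, Multiset.count_add]
    rcases card_of_atom_of_two_involutions hx hy hxy hχ hχx hχy hU
      (fun w hw => h w (Multiset.mem_add.2 (Or.inl hw))) with ⟨h4, m, h5⟩ | ⟨h4, m, h5⟩
    · exact ⟨i + 1, j, by omega, by omega, by omega, by omega⟩
    · exact ⟨i, j + 1, by omega, by omega, by omega, by omega⟩

/-- Among the twelve terms six equal $x$, so the number $j$ of long atoms is even. Either $j = 0$
and there are six pairs, or $j = 2$ and there are no pairs. -/
theorem dihedralThree_lengths {x y : DihedralGroup 3} (hx : x * x = 1) (hy : y * y = 1)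
    (hxy : x ≠ y) (hx1 : x ≠ 1) (hy1 : y ≠ 1) {k : ℕ}
    (hF : HasFactorizationLength ({x, x, x, y, y, y} + {x, x, x, y, y, y}) k) :
    k = 2 ∨ k = 6 := by
  have hχ : ∀ w : DihedralGroup 3, w * w = 1 → w ≠ 1 → dihedralThreeTest w = false := by
    decide +kernel
  obtain ⟨i, j, rfl, h1, h2, h3⟩ := hF.exists_of_two_involutions hx hy hxy
    isOrderBlind_dihedralThreeTest (hχ x hx hx1) (hχ y hy hy1) (by
      intro w hw
      simp only [Multiset.insert_eq_cons, Multiset.mem_add, Multiset.mem_cons,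
        Multiset.mem_singleton] at hw
      tauto)
  simp only [Multiset.insert_eq_cons, Multiset.card_add, Multiset.card_cons,
    Multiset.card_singleton, Multiset.count_add, Multiset.count_cons, Multiset.count_singleton,
    hxy, if_true, if_false] at h1 h2 h3
  omega

/-- The sequence `x⁶ y⁶`, for distinct involutions `x` and `y`, has set of lengths `{2, 6}`. -/
theorem dihedralThree_exists_two_six : ∃ S : Multiset (DihedralGroup 3),
    HasFactorizationLength S 2 ∧ HasFactorizationLength S 6 ∧ ¬ HasFactorizationLength S 3 := by
  have hU : IsProductOneAtom ({sr 0, sr 0, sr 0, sr 1, sr 1, sr 1} : Multiset (DihedralGroup 3)) := by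
    refine (isProductOneAtom_iff_test isOrderBlind_dihedralThreeTest
      (l := [sr 0, sr 0, sr 0, sr 1, sr 1, sr 1])).2 ?_
    decide +kernel
  refine ⟨{sr 0, sr 0, sr 0, sr 1, sr 1, sr 1} + {sr 0, sr 0, sr 0, sr 1, sr 1, sr 1},
    hasFactorizationLength_two.2 ⟨_, _, hU, hU, rfl⟩, ?_, fun h => ?_⟩
  · exact hasFactorizationLength_pairs {sr 0, sr 0, sr 0, sr 1, sr 1, sr 1} (by decide)
  · have := dihedralThree_lengths (by decide) (by decide) (by decide) (by decide) (by decide) h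
    omega

/-- The three atoms are $g^3$, $g\, g^{-2} t^2$ and $g^{-2} s^2$, with the second ordered as $g\,
t\, g^{-2}\, t$. -/
theorem dihedralThree_three {g t s : DihedralGroup 3} (hg : g * g * g = 1) (hg1 : g ≠ 1)
    (ht : t * t = 1) (ht1 : t ≠ 1) (hs : s * s = 1) (hs1 : s ≠ 1) :
    HasFactorizationLength
      ({g, g, g, g, t, t} + {g⁻¹, g⁻¹, g⁻¹, g⁻¹, s, s} : Multiset (DihedralGroup 3)) 3 := by
  have key : ∀ g t : DihedralGroup 3, g * g * g = 1 → g ≠ 1 → t * t = 1 → t ≠ 1 →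
      ([g, g, g] ≠ [] ∧ splitTest dihedralThreeTest [g, g, g] = false ∧
        productOneTest dihedralThreeTest [g, g, g] = true) ∧
      ([g, g⁻¹, g⁻¹, t, t] ≠ [] ∧ splitTest dihedralThreeTest [g, g⁻¹, g⁻¹, t, t] = false ∧
        productOneTest dihedralThreeTest [g, g⁻¹, g⁻¹, t, t] = true) ∧
      ([g⁻¹, g⁻¹, t, t] ≠ [] ∧ splitTest dihedralThreeTest [g⁻¹, g⁻¹, t, t] = false ∧
        productOneTest dihedralThreeTest [g⁻¹, g⁻¹, t, t] = true) := by decide +kernel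
  simp only [← isProductOneAtom_iff_test isOrderBlind_dihedralThreeTest] at key
  obtain ⟨h1, h2, -⟩ := key g t hg hg1 ht ht1
  obtain ⟨-, -, h3⟩ := key g s hg hg1 hs hs1
  rw [hasFactorizationLength_three]
  refine ⟨_, _, _, h1, h2, h3, ?_⟩
  simp only [Multiset.insert_eq_cons, ← Multiset.singleton_add, ← Multiset.cons_coe,
    Multiset.coe_nil]
  abel

theorem dihedralThree_exists_two_three_six : ∃ S : Multiset (DihedralGroup 3),
    HasFactorizationLength S 2 ∧ HasFactorizationLength S 3 ∧ HasFactorizationLength S 6 := by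
  have hU : IsProductOneAtom ({r 1, r 1, r 1, r 1, sr 0, sr 0} : Multiset (DihedralGroup 3)) := by
    refine (isProductOneAtom_iff_test isOrderBlind_dihedralThreeTest
      (l := [r 1, r 1, r 1, r 1, sr 0, sr 0])).2 ?_
    decide +kernel
  refine ⟨{r 1, r 1, r 1, r 1, sr 0, sr 0} + {(r 1)⁻¹, (r 1)⁻¹, (r 1)⁻¹, (r 1)⁻¹, sr 0, sr 0},
    hasFactorizationLength_two.2 ⟨_, _, hU, hU.inv, rfl⟩,
    dihedralThree_three (by decide) (by decide) (by decide) (by decide) (by decide) (by decide), ?_⟩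
  exact hasFactorizationLength_pairs {r 1, r 1, r 1, r 1, sr 0, sr 0} (by decide)

/-- Symmetry under inversion pairs the two types of six-term atoms only with themselves. Two atoms
with rotations use inverse rotations and refactor into three atoms. Two atoms $x^3y^3$ use the same
involutions, and then four is not a length. -/
theorem dihedralThree_three_of_two_four_six (hD : AtomCardLE (DihedralGroup 3) 6)
    {S : Multiset (DihedralGroup 3)} (h2 : HasFactorizationLength S 2)
    (h4 : HasFactorizationLength S 4) (h6 : HasFactorizationLength S 6) :
    HasFactorizationLength S 3 := by
  obtain ⟨-, ⟨U, V, hU, hV, rfl, hUc, hVc⟩, T, -, hT⟩ := exists_atoms_of_two_of_six hD h2 h6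
  have hinv : ∀ w : DihedralGroup 3, w * w = 1 → w⁻¹ = w := fun w h => inv_eq_of_mul_eq_one_left h
  have hne : ∀ g w : DihedralGroup 3, g * g * g = 1 → g ≠ 1 → w * w = 1 → w ≠ g⁻¹ := by
    decide +kernel
  have hne' : ∀ g : DihedralGroup 3, g * g * g = 1 → g ≠ 1 → g ≠ g⁻¹ := by decide +kernel
  have mixed : ∀ g t x y : DihedralGroup 3, g * g * g = 1 → g ≠ 1 → t * t = 1 → x * x = 1 →
      y * y = 1 → U + V = {g, g, g, g, t, t} + {x, x, x, y, y, y} → False := by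
    intro g t x y hg hg1 ht hx hy h
    have hc := count_inv_eq_of_pairs hT g
    rw [h] at hc
    simp only [Multiset.insert_eq_cons, Multiset.count_add, Multiset.count_cons,
      Multiset.count_singleton, (hne g t hg hg1 ht).symm, (hne g x hg hg1 hx).symm,
      (hne g y hg hg1 hy).symm, (hne' g hg hg1).symm, if_false, if_true] at hc
    omega
  rcases eq_of_atom_card_eq_six_dihedralThree hU hUc with ⟨g, t, rfl, hg, hg1, ht, ht1⟩ |
      ⟨x, y, rfl, hx, hy, hxy, hx1, hy1⟩ <;>
    rcases eq_of_atom_card_eq_six_dihedralThree hV hVc with ⟨h, s, rfl, hh, hh1, hs, hs1⟩ |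
      ⟨u, v, rfl, hu, hv, huv, hu1, hv1⟩
  · have hc := count_inv_eq_of_pairs hT g
    have : h = g⁻¹ := by
      by_contra hhg
      simp only [Multiset.insert_eq_cons, Multiset.count_add, Multiset.count_cons,
        Multiset.count_singleton, (hne g t hg hg1 ht).symm, (hne g s hg hg1 hs).symm,
        Ne.symm hhg, (hne' g hg hg1).symm, if_false, if_true] at hc
      omega
    subst this
    exact dihedralThree_three hg hg1 ht ht1 hs hs1
  · exact (mixed g t u v hg hg1 ht hu hv rfl).elim
  · exact (mixed h s x y hh hh1 hs hx hy (add_comm _ _)).elim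
  · exfalso
    have ex := even_count_of_pairs hT (hinv x hx)
    have ey := even_count_of_pairs hT (hinv y hy)
    have hS : ({u, u, u, v, v, v} : Multiset (DihedralGroup 3)) = {x, x, x, y, y, y} := by
      simp only [Multiset.insert_eq_cons, Multiset.count_add, Multiset.count_cons,
        Multiset.count_singleton, hxy, hxy.symm, if_false, if_true, Nat.even_iff] at ex ey
      by_cases h1 : x = u
      · subst h1
        by_cases h2 : y = v
        · rw [h2]
        · simp only [h2, hxy.symm, if_false] at ey
          omega
      · by_cases h2 : x = v
        · subst h2
          by_cases h3 : y = u
          · subst h3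
            simp only [Multiset.insert_eq_cons, ← Multiset.singleton_add]
            abel
          · simp only [h3, hxy.symm, if_false] at ey
            omega
        · simp only [h1, h2, if_false] at ex
          omega
    rw [hS] at h4
    have := dihedralThree_lengths hx hy hxy hx1 hy1 h4
    omega

end OrderSix

/-! ### Sets of lengths over the abelian groups -/

section Commutative

/-- An additive weight that is constant on the atoms dividing a sequence restricts the number of
atoms. -/
theorem HasFactorizationLength.map_eq_nsmul {G M : Type*} [Group G] [AddCommMonoid M]
    (f : Multiset G →+ M) {c : M} {S : Multiset G} {k : ℕ} (h : HasFactorizationLength S k)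
    (hS : ∀ U ≤ S, IsProductOneAtom U → f U = c) : f S = k • c := by
  induction k generalizing S with
  | zero =>
    obtain ⟨s, -, rfl, hs⟩ := h
    simp [Multiset.card_eq_zero.1 hs]
  | succ k ih =>
    obtain ⟨U, T, hU, hT, rfl⟩ := hasFactorizationLength_succ.1 h
    rw [map_add, hS U (Multiset.le_add_right _ _) hU,
      ih hT fun V hV => hS V (hV.trans (Multiset.le_add_left _ _)), succ_nsmul, add_comm]

/-- The weight may live in a cyclic group, where it adds a congruence to the count of terms. -/
theorem HasFactorizationLength.exists_of_two_types {G M : Type*} [Group G] [AddCommMonoid M]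
    (f : Multiset G →+ M) {p q : M} {m n : ℕ} {S : Multiset G} {k : ℕ}
    (h : HasFactorizationLength S k) (hS : ∀ U ≤ S, IsProductOneAtom U →
      (U.card = m ∧ f U = p) ∨ (U.card = n ∧ f U = q)) :
    ∃ i j, k = i + j ∧ S.card = i * m + j * n ∧ f S = i • p + j • q := by
  induction k generalizing S with
  | zero =>
    obtain ⟨s, -, rfl, hs⟩ := h
    exact ⟨0, 0, rfl, by simp [Multiset.card_eq_zero.1 hs], by simp [Multiset.card_eq_zero.1 hs]⟩
  | succ k ih =>
    obtain ⟨U, T, hU, hT, rfl⟩ := hasFactorizationLength_succ.1 h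
    obtain ⟨i, j, rfl, hc, hf⟩ := ih hT fun V hV => hS V (hV.trans (Multiset.le_add_left _ _))
    rcases hS U (Multiset.le_add_right _ _) hU with ⟨h1, h2⟩ | ⟨h1, h2⟩
    · refine ⟨i + 1, j, by omega, by rw [Multiset.card_add, hc, h1]; ring, ?_⟩
      rw [map_add, h2, hf, succ_nsmul, add_comm (i • p) p, add_assoc]
    · refine ⟨i, j + 1, by omega, by rw [Multiset.card_add, hc, h1]; ring, ?_⟩
      rw [map_add, h2, hf, succ_nsmul, add_comm q, add_assoc]

/-- In an abelian group the complement of a product-one subsequence again has product one. -/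
theorem IsProductOneAtom.eq_of_le {A : Type*} [CommGroup A] {U W : Multiset A}
    (hU : IsProductOneAtom U) (hW : IsProductOne W) (h0 : W ≠ 0) (hle : W ≤ U) : U = W := by
  obtain ⟨R, rfl⟩ := Multiset.le_iff_exists_add.1 hle
  have hR : IsProductOne R := by
    have h1 := hU.1
    rw [isProductOne_iff_prod_eq_one] at hW h1 ⊢
    rwa [Multiset.prod_add, hW, one_mul] at h1
  rcases hU.2.2 W R hW hR rfl with h | h
  · exact absurd h h0
  · rw [h, add_zero]

theorem IsProductOneAtom.eq_pair {A : Type*} [CommGroup A] [DecidableEq A] {U : Multiset A}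
    (hU : IsProductOneAtom U) {x : A} (hx : x ∈ U) (hx' : x⁻¹ ∈ U.erase x) : U = {x, x⁻¹} := by
  refine hU.eq_of_le (isProductOne_pair.2 (by simp)) (by simp) ?_
  obtain ⟨T, rfl⟩ := Multiset.exists_cons_of_mem hx
  rw [Multiset.erase_cons_head] at hx'
  exact Multiset.cons_le_cons _ (Multiset.singleton_le.2 hx')

/-- Atoms other than pairs $x, x$ are squarefree, and all multiplicities in the sequence are even,
so it is $V^2$. Its atoms are pairs and $V$. For a fixed $x \in V$, the multiplicity modulo two
shows that $V$ is used an even number of times. -/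
theorem lengths_of_two_of_six_of_exponent_two {A : Type*} [CommGroup A] (hA : ∀ x : A, x * x = 1)
    (hD : AtomCardLE A 6) {S : Multiset A} (h2 : HasFactorizationLength S 2)
    (h6 : HasFactorizationLength S 6) {k : ℕ} (hk : HasFactorizationLength S k) :
    k = 2 ∨ k = 6 := by
  classical
  obtain ⟨h1, ⟨U, V, hU, hV, rfl, hUc, hVc⟩, T, -, hT⟩ := exists_atoms_of_two_of_six hD h2 h6
  have hinv : ∀ x : A, x⁻¹ = x := fun x => inv_eq_of_mul_eq_one_left (hA x)
  have hnd : ∀ W : Multiset A, IsProductOneAtom W → W.card ≠ 2 → ∀ x, W.count x ≤ 1 := by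
    intro W hW hc x
    by_contra hlt
    push Not at hlt
    have := hW.eq_of_le (W := Multiset.replicate 2 x) (isProductOne_replicate.2 (by
      rw [pow_two, hA])) (by simp) (Multiset.le_count_iff_replicate_le.1 hlt)
    rw [this] at hc
    simp at hc
  have hUV : V = U := by
    ext x
    have h1 := hnd U hU (by omega) x
    have h2 := hnd V hV (by omega) x
    have h3 := even_count_of_pairs hT (hinv x)
    rw [Multiset.count_add, Nat.even_iff] at h3
    omega
  subst hUV
  obtain ⟨x, hx⟩ := Multiset.card_pos_iff_exists_mem.1 (show 0 < V.card by omega)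
  have hcx : V.count x = 1 := by
    have := hnd V hU (by omega) x
    have := Multiset.count_pos.2 hx
    omega
  let f : Multiset A →+ ZMod 2 := (Nat.castAddMonoidHom (ZMod 2)).comp (Multiset.countAddMonoidHom x)
  have hf : ∀ W, f W = (W.count x : ZMod 2) := fun _ => rfl
  obtain ⟨i, j, rfl, hc, hfS⟩ := hk.exists_of_two_types f (m := 2) (n := 6) (p := 0) (q := 1) (by
    intro W hW hWa
    by_cases hc : W.card = 2
    · refine Or.inl ⟨hc, ?_⟩
      obtain ⟨p, q, rfl⟩ := Multiset.card_eq_two.1 hc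
      have hpq := isProductOne_pair.1 hWa.1
      have : q = p := by rw [← inv_eq_of_mul_eq_one_right hpq, hinv]
      subst this
      rw [hf]
      by_cases hxp : x = q
      · simp [hxp]; decide
      · simp [hxp]
    · have hWV : W ≤ V := by
        rw [Multiset.le_iff_count]
        intro w
        have h1 := hnd W hWa hc w
        have h2 := Multiset.le_iff_count.1 hW w
        rw [Multiset.count_add] at h2
        omega
      have e := hU.eq_of_le hWa.1 hWa.2.1 hWV
      refine Or.inr ⟨by rw [← e, hUc], ?_⟩
      rw [hf, ← e, hcx, Nat.cast_one])
  rw [Multiset.card_add, hUc] at hc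
  rw [hf, Multiset.count_add, hcx] at hfS
  have hj : j ≠ 1 := by
    rintro rfl
    simp only [smul_zero, zero_add, one_smul] at hfS
    exact absurd hfS (by decide)
  omega

/-! ### The cyclic group of order six -/

section CyclicSix

/-- The standard generator of the cyclic group of order six. -/
abbrev genSix : Multiplicative (ZMod 6) := Multiplicative.ofAdd 1

theorem isOrderBlind_eq_one {A : Type*} [CommGroup A] [DecidableEq A] :
    IsOrderBlind fun x : A => x == 1 :=
  ⟨by simp, fun a b => by rw [mul_comm], fun a b c => by rw [mul_comm b]⟩

theorem eq_of_atom_card_eq_six_cyclic {U : Multiset (Multiplicative (ZMod 6))}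
    (hU : IsProductOneAtom U) (hc : U.card = 6) :
    U = Multiset.replicate 6 genSix ∨ U = Multiset.replicate 6 genSix⁻¹ := by
  obtain ⟨l, rfl, h⟩ := exists_list_of_isProductOneAtom (isOrderBlind_eq_one)
    (P := fun l => l.isPerm (List.replicate 6 genSix) || l.isPerm (List.replicate 6 genSix⁻¹))
    (xs := [genSix, genSix ^ 2, genSix ^ 3, genSix ^ 4, genSix ^ 5]) (by decide) (by norm_num)
    (by decide +kernel) hU hc
  simp only [Bool.or_eq_true, List.isPerm_iff] at h
  exact h.imp Multiset.coe_eq_coe.2 Multiset.coe_eq_coe.2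

/-- The sequence is $g^6 g^{-6}$, with atoms $g^6$, $g^{-6}$ and $g\,g^{-1}$. The multiplicity of
$g$ modulo six counts the pairs and excludes three pairs with a single long atom. -/
theorem cyclicSix_lengths_of_two_of_six (hD : AtomCardLE (Multiplicative (ZMod 6)) 6)
    {S : Multiset (Multiplicative (ZMod 6))} (h2 : HasFactorizationLength S 2)
    (h6 : HasFactorizationLength S 6) {k : ℕ} (hk : HasFactorizationLength S k) :
    k = 2 ∨ k = 6 := by
  obtain ⟨h1, ⟨U, V, hU, hV, rfl, hUc, hVc⟩, T, -, hT⟩ := exists_atoms_of_two_of_six hD h2 h6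
  have hg : genSix ≠ genSix⁻¹ := by decide
  have hcount := count_inv_eq_of_pairs hT genSix
  rw [Multiset.count_add, Multiset.count_add] at hcount
  have hS : U + V = Multiset.replicate 6 genSix + Multiset.replicate 6 genSix⁻¹ := by
    rcases eq_of_atom_card_eq_six_cyclic hU hUc with rfl | rfl <;>
      rcases eq_of_atom_card_eq_six_cyclic hV hVc with rfl | rfl
    · exact absurd hcount (by decide)
    · rfl
    · exact add_comm _ _
    · exact absurd hcount (by decide)
  rw [hS] at hk
  let f : Multiset (Multiplicative (ZMod 6)) →+ ZMod 6 :=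
    (Nat.castAddMonoidHom (ZMod 6)).comp (Multiset.countAddMonoidHom genSix)
  have hf : ∀ W, f W = (W.count genSix : ZMod 6) := fun _ => rfl
  have hpow : ∀ g : Multiplicative (ZMod 6), g = genSix ∨ g = genSix⁻¹ → ∀ n < 7, g ^ n = 1 →
      n = 0 ∨ n = 6 := by decide
  obtain ⟨i, j, rfl, hc, hfS⟩ := hk.exists_of_two_types f (m := 2) (n := 6) (p := 1) (q := 0) (by
    intro W hW hWa
    obtain ⟨W₁, hW₁, W₂, hW₂, rfl⟩ := Multiset.exists_add_of_le_add hW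
    obtain ⟨a, ha, rfl⟩ := Multiset.le_replicate_iff_eq hW₁
    obtain ⟨b, hb, rfl⟩ := Multiset.le_replicate_iff_eq hW₂
    have hone := hWa.2.1
    rcases Nat.eq_zero_or_pos a with rfl | ha0
    · rw [Multiset.replicate_zero, zero_add] at hWa hone ⊢
      have := hpow _ (Or.inr rfl) b (by omega) (isProductOne_replicate.1 hWa.1)
      rcases this with rfl | rfl
      · exact absurd rfl hone
      · exact Or.inr ⟨by simp, by decide⟩
    rcases Nat.eq_zero_or_pos b with rfl | hb0
    · rw [Multiset.replicate_zero, add_zero] at hWa hone ⊢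
      have := hpow _ (Or.inl rfl) a (by omega) (isProductOne_replicate.1 hWa.1)
      rcases this with rfl | rfl
      · exact absurd rfl hone
      · exact Or.inr ⟨by simp, by decide⟩
    · have := hWa.eq_of_le (W := {genSix, genSix⁻¹}) (isProductOne_pair.2 (by decide)) (by simp) (by
        have h1 : Multiset.replicate 1 genSix ≤ Multiset.replicate a genSix :=
          Multiset.replicate_le_replicate _ |>.2 ha0
        have h2 : Multiset.replicate 1 genSix⁻¹ ≤ Multiset.replicate b genSix⁻¹ :=
          Multiset.replicate_le_replicate _ |>.2 hb0
        exact add_le_add h1 h2)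
      rw [this]
      exact Or.inl ⟨rfl, by decide⟩)
  simp only [Multiset.card_add, Multiset.card_replicate] at hc
  have hj : j ≠ 1 := by
    rintro rfl
    obtain rfl : i = 3 := by omega
    exact absurd hfS (by decide)
  omega

/-- Nine atoms without the identity require eighteen terms, hence three atoms equal to $g^6$ or
$g^{-6}$. Three is odd, so the multiplicities of $g$ and $g^{-1}$ differ. A term equal to the
identity would leave lengths two and eight, which is too long. -/
theorem cyclicSix_not_three_nine (hD : AtomCardLE (Multiplicative (ZMod 6)) 6)
    {S : Multiset (Multiplicative (ZMod 6))} (h3 : HasFactorizationLength S 3) :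
    ¬ HasFactorizationLength S 9 := by
  intro h9
  have h1 : 1 ∉ S := by
    intro h1
    obtain ⟨T, rfl⟩ := Multiset.exists_cons_of_mem h1
    obtain ⟨l, hl, hT⟩ := h3.of_one_cons
    obtain rfl : l = 2 := by omega
    obtain ⟨m, hm, hT'⟩ := h9.of_one_cons
    obtain rfl : m = 8 := by omega
    have hT1 := HasFactorizationLength.one_notMem (by norm_num) hT hT'
    have := hT'.two_mul_le hT1
    have := hT.card_le hD
    omega
  have hle := h9.two_mul_le h1
  obtain ⟨U, V, W, hU, hV, hW, rfl⟩ := hasFactorizationLength_three.1 h3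
  have hU6 := hD U hU
  have hV6 := hD V hV
  have hW6 := hD W hW
  rw [Multiset.card_add, Multiset.card_add] at hle
  obtain ⟨T, -, hT⟩ := h9.exists_pairs h1 (by rw [Multiset.card_add, Multiset.card_add]; omega)
  have hcount := count_inv_eq_of_pairs hT genSix
  simp only [Multiset.count_add] at hcount
  rcases eq_of_atom_card_eq_six_cyclic hU (by omega) with rfl | rfl <;>
    rcases eq_of_atom_card_eq_six_cyclic hV (by omega) with rfl | rfl <;>
    rcases eq_of_atom_card_eq_six_cyclic hW (by omega) with rfl | rfl <;>
    exact absurd hcount (by decide)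

end CyclicSix

/-! ### The elementary abelian group of order 32 -/

section ElementaryAbelian

/-- An element of the elementary abelian group of order 32 given by its coordinates. -/
abbrev vec (x : Fin 5 → ZMod 2) : Multiplicative (Fin 5 → ZMod 2) := Multiplicative.ofAdd x

theorem elementary_exists_three_nine : ∃ S : Multiset (Multiplicative (Fin 5 → ZMod 2)),
    HasFactorizationLength S 3 ∧ HasFactorizationLength S 9 := by
  -- The three triples have the same sum, the last basis vector, so any two of them together have
  -- sum zero. Then $(ABC)^2$ is both $AB \cdot BC \cdot AC$ and nine pairs of equal terms.
  let A := [vec ![1, 0, 0, 0, 0], vec ![0, 1, 0, 0, 0], vec ![1, 1, 0, 0, 1]]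
  let B := [vec ![0, 0, 1, 0, 0], vec ![0, 0, 0, 1, 0], vec ![0, 0, 1, 1, 1]]
  let C := [vec ![1, 0, 1, 0, 0], vec ![0, 1, 0, 1, 0], vec ![1, 1, 1, 1, 1]]
  have h1 : IsProductOneAtom ((A ++ B : List _) : Multiset (Multiplicative (Fin 5 → ZMod 2))) := by
    rw [isProductOneAtom_iff_test isOrderBlind_eq_one]; decide +kernel
  have h2 : IsProductOneAtom ((B ++ C : List _) : Multiset (Multiplicative (Fin 5 → ZMod 2))) := by
    rw [isProductOneAtom_iff_test isOrderBlind_eq_one]; decide +kernel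
  have h3 : IsProductOneAtom ((A ++ C : List _) : Multiset (Multiplicative (Fin 5 → ZMod 2))) := by
    rw [isProductOneAtom_iff_test isOrderBlind_eq_one]; decide +kernel
  let T : Multiset (Multiplicative (Fin 5 → ZMod 2)) := ((A ++ B ++ C : List _) : Multiset _)
  have hinv : T.map (fun x => x⁻¹) = T := by
    refine (Multiset.map_congr rfl fun x _ => ?_).trans (Multiset.map_id T)
    revert x; decide +kernel
  have h9 := hasFactorizationLength_pairs T (by decide +kernel)
  refine ⟨_, hasFactorizationLength_three.2 ⟨_, _, _, h1, h2, h3, ?_⟩, h9⟩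
  rw [hinv]
  simp only [T, ← Multiset.coe_add]
  abel

end ElementaryAbelian

/-! ### The group $C_4 \times C_2^2$ -/

section CyclicFourTimesKlein

/-- An element of the direct product of a cyclic group of order four and a Klein four-group given
by its coordinates. -/
abbrev elt (x : ZMod 4) (y z : ZMod 2) : Multiplicative (ZMod 4 × ZMod 2 × ZMod 2) :=
  Multiplicative.ofAdd (x, y, z)

/-- Whether `p` holds for all sublists of a list, prepended in reverse order to `acc`. -/
def allSublists {α : Type*} (p : List α → Bool) : List α → List α → Bool
  | [], acc => p acc
  | x :: l, acc => allSublists p l acc && allSublists p l (x :: acc)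

theorem exists_of_allSublists {α : Type*} {p : List α → Bool} {l acc w : List α}
    (h : allSublists p l acc = true) (hw : w.Sublist l) :
    ∃ w' : List α, w'.Perm (w ++ acc) ∧ p w' = true := by
  induction hw generalizing acc with
  | slnil => exact ⟨acc, List.Perm.refl _, h⟩
  | cons x _ ih =>
    rw [allSublists, Bool.and_eq_true] at h
    exact ih h.1
  | cons_cons x _ ih =>
    rw [allSublists, Bool.and_eq_true] at h
    obtain ⟨w', h1, h2⟩ := ih h.2
    exact ⟨w', h1.trans List.perm_middle, h2⟩

/-- A weight taking the value four on all atoms dividing the sequence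
`g³ a b (abg) · g⁻³ a b (abg⁻¹)`. -/
def atomWeight (x : Multiplicative (ZMod 4 × ZMod 2 × ZMod 2)) : ZMod 8 :=
  if x = elt 1 0 0 then 1 else if x = elt 3 0 0 then 3 else if x = elt 1 1 1 then 5
    else if x = elt 3 1 1 then 7 else 2

/-- With $U = g^3 a\, b\, (abg)$ the sequence is $U U^{-1}$. Its total weight is zero modulo eight
and each atom has weight four, so the number of atoms is even. -/
theorem cyclicFour_exists_two_four_six :
    ∃ S : Multiset (Multiplicative (ZMod 4 × ZMod 2 × ZMod 2)), HasFactorizationLength S 2 ∧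
      HasFactorizationLength S 4 ∧ HasFactorizationLength S 6 ∧ ¬ HasFactorizationLength S 3 := by
  let g := elt 1 0 0
  let l := [g, g, g, elt 0 1 0, elt 0 0 1, elt 1 1 1]
  let l' := [elt 3 0 0, elt 3 0 0, elt 3 0 0, elt 0 1 0, elt 0 0 1, elt 3 1 1]
  have hl : IsProductOneAtom (l : Multiset (Multiplicative (ZMod 4 × ZMod 2 × ZMod 2))) := by
    rw [isProductOneAtom_iff_test isOrderBlind_eq_one]; decide +kernel
  have hl' : IsProductOneAtom (l' : Multiset (Multiplicative (ZMod 4 × ZMod 2 × ZMod 2))) := by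
    rw [isProductOneAtom_iff_test isOrderBlind_eq_one]; decide +kernel
  have hll' : (l : Multiset (Multiplicative (ZMod 4 × ZMod 2 × ZMod 2))).map (fun x => x⁻¹) = l' := by
    decide +kernel
  have h6 := hasFactorizationLength_pairs
    (l : Multiset (Multiplicative (ZMod 4 × ZMod 2 × ZMod 2))) (by decide +kernel)
  rw [hll'] at h6
  refine ⟨l + l', hasFactorizationLength_two.2 ⟨_, _, hl, hl', rfl⟩, ?_, h6, fun h3 => ?_⟩
  · have a1 : IsProductOneAtom (([elt 1 1 1, elt 0 1 0, elt 0 0 1, elt 3 0 0] : List _) :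
        Multiset (Multiplicative (ZMod 4 × ZMod 2 × ZMod 2))) := by
      rw [isProductOneAtom_iff_test isOrderBlind_eq_one]; decide +kernel
    have a2 : IsProductOneAtom (([elt 3 1 1, elt 0 1 0, elt 0 0 1, elt 1 0 0] : List _) :
        Multiset (Multiplicative (ZMod 4 × ZMod 2 × ZMod 2))) := by
      rw [isProductOneAtom_iff_test isOrderBlind_eq_one]; decide +kernel
    have a3 : IsProductOneAtom (([elt 1 0 0, elt 3 0 0] : List _) :
        Multiset (Multiplicative (ZMod 4 × ZMod 2 × ZMod 2))) := by
      rw [isProductOneAtom_iff_test isOrderBlind_eq_one]; decide +kernel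
    have h := (a1.hasFactorizationLength.add a2.hasFactorizationLength).add
      (a3.hasFactorizationLength.add a3.hasFactorizationLength)
    convert h using 1
    decide +kernel
  · let f : Multiset (Multiplicative (ZMod 4 × ZMod 2 × ZMod 2)) →+ ZMod 8 :=
      Multiset.sumAddMonoidHom.comp (Multiset.mapAddMonoidHom atomWeight)
    have hf : ∀ W, f W = (W.map atomWeight).sum := fun _ => rfl
    have hpair : ∀ x ∈ l ++ l', atomWeight x + atomWeight x⁻¹ = 4 := by decide +kernel
    -- An atom containing mutually inverse terms is just that pair, so the weight has to be checked
    -- only on sublists without such a pair. Erasing one copy first treats involutions correctly.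
    have hsub : allSublists (fun w => w.prod != 1 || w.isEmpty || (w.any fun x =>
        (w.erase x).contains x⁻¹) || (w.map atomWeight).sum == 4) (l ++ l') [] = true := by
      decide +kernel
    have key := h3.map_eq_nsmul f (c := 4) (by
      intro W hW hWa
      induction W using Quotient.inductionOn with
      | _ w =>
      obtain ⟨w'', hw'', hs⟩ := (Multiset.coe_le (l₁ := w) (l₂ := l ++ l')).1 hW
      obtain ⟨w', hw', hp⟩ := exists_of_allSublists hsub hs
      rw [List.append_nil] at hw'
      simp only [Bool.or_eq_true, bne_iff_ne, List.isEmpty_iff, List.any_eq_true,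
        List.contains_iff_mem, beq_iff_eq] at hp
      have e : (w' : Multiset (Multiplicative (ZMod 4 × ZMod 2 × ZMod 2))) = w :=
        Multiset.coe_eq_coe.2 (hw'.trans hw'')
      change f (Multiset.ofList w) = 4
      change IsProductOneAtom (Multiset.ofList w) at hWa
      rw [← e] at hWa ⊢
      have h1 := isProductOne_iff_prod_eq_one.1 hWa.1
      rcases hp with ((h | h) | ⟨x, hx, hx'⟩) | h
      · exact absurd (by simpa using h1) h
      · rw [h] at hWa; exact absurd rfl hWa.2.1
      · rw [hWa.eq_pair (x := x) (by simpa using hx) (by simpa using hx'), hf]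
        simpa using hpair x (hs.subset (hw'.subset hx))
      · rw [hf]; simpa using h)
    rw [hf] at key
    exact absurd key (by decide +kernel)

end CyclicFourTimesKlein

end Commutative

/-! ### Recognizing the groups from generators -/

section Isomorphisms

variable {G : Type*} [Group G]

theorem exists_zmod_hom {g : G} {n : ℕ} (hg : g ^ n = 1) :
    ∃ e : ZMod n → G, (∀ i j, e (i + j) = e i * e j) ∧ (∀ k : ℤ, e k = g ^ k) := by
  refine ⟨fun i => (ZMod.lift n ⟨(zmultiplesHom (Additive G)) (Additive.ofMul g), ?_⟩ i).toMul,
    fun i j => ?_, fun k => ?_⟩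
  · rw [zmultiplesHom_apply, natCast_zsmul, ← ofMul_pow, hg, ofMul_one]
  · beta_reduce; rw [map_add, toMul_add]
  · beta_reduce; rw [ZMod.lift_coe, zmultiplesHom_apply, ← ofMul_zpow, toMul_ofMul]

/-- The relations define a homomorphism from the dihedral group; it is onto by generation and
bijective by counting. -/
theorem nonempty_mulEquiv_dihedral [Finite G] {g τ : G} {n : ℕ} [NeZero n] (hg : g ^ n = 1)
    (hτ : τ * τ = 1) (hinv : τ * g * τ⁻¹ = g⁻¹)
    (h : ∀ x, x ∈ Subgroup.zpowers g ∨ τ * x ∈ Subgroup.zpowers g) (hcard : 2 * n ≤ Nat.card G) :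
    Nonempty (G ≃* DihedralGroup n) := by
  obtain ⟨e, hadd, hk⟩ := exists_zmod_hom hg
  have h0 : e 0 = 1 := by simpa using hk 0
  have hconj : ∀ i, e i * τ = τ * e (-i) := by
    intro i
    obtain ⟨k, rfl⟩ := ZMod.intCast_surjective i
    have h1 : τ * g ^ k * τ⁻¹ = (g ^ k)⁻¹ := by
      rw [← conj_zpow, hinv, inv_zpow]
    rw [hk, ← Int.cast_neg, hk, zpow_neg, ← h1]
    have : τ⁻¹ = τ := inv_eq_of_mul_eq_one_left hτ
    rw [this, ← mul_assoc, ← mul_assoc, hτ, one_mul]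
  let f : DihedralGroup n →* G :=
    { toFun := fun x => match x with
        | .r i => e i
        | .sr i => τ * e i
      map_one' := h0
      map_mul' := by
        rintro (i | i) (j | j)
        · exact hadd i j
        · change τ * e (j - i) = e i * (τ * e j)
          rw [← mul_assoc, hconj, mul_assoc, ← hadd]; congr 2; ring
        · change τ * e (i + j) = τ * e i * e j
          rw [hadd, mul_assoc]
        · change e (j - i) = τ * e i * (τ * e j)
          rw [mul_assoc τ, ← mul_assoc (e i), hconj, ← mul_assoc τ, ← mul_assoc τ, hτ, one_mul,
            ← hadd]
          congr 1; ring }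
  have hf : Function.Surjective f := by
    intro x
    rcases h x with ⟨k, hx⟩ | ⟨k, hx⟩
    · exact ⟨.r k, (hk k).trans hx⟩
    · refine ⟨.sr k, ?_⟩
      change τ * e k = x
      rw [hk]
      change g ^ k = τ * x at hx
      rw [hx, ← mul_assoc, hτ, one_mul]
  have hb : Function.Bijective f := hf.bijective_of_nat_card_le (by
    rw [DihedralGroup.nat_card]; exact hcard)
  exact ⟨(MulEquiv.ofBijective f hb).symm⟩

theorem nonempty_mulEquiv_quaternion [Finite G] {g τ : G} {n : ℕ} [NeZero n]
    (hg : g ^ (2 * n) = 1) (hτ : τ * τ = g ^ n) (hinv : τ * g * τ⁻¹ = g⁻¹)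
    (h : ∀ x, x ∈ Subgroup.zpowers g ∨ τ * x ∈ Subgroup.zpowers g) (hcard : 4 * n ≤ Nat.card G) :
    Nonempty (G ≃* QuaternionGroup n) := by
  obtain ⟨e, hadd, hk⟩ := exists_zmod_hom hg
  have h0 : e 0 = 1 := by simpa using hk 0
  have hn : e n = g ^ n := by simpa using hk n
  have hconj : ∀ i, e i * τ = τ * e (-i) := by
    intro i
    obtain ⟨k, rfl⟩ := ZMod.intCast_surjective i
    have h1 : τ * g ^ k * τ⁻¹ = (g ^ k)⁻¹ := by
      rw [← conj_zpow, hinv, inv_zpow]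
    rw [← Int.cast_neg, hk, hk, zpow_neg]
    have h2 := congrArg (fun w => w⁻¹) h1
    simp only [mul_inv_rev, inv_inv, ← mul_assoc] at h2
    exact eq_mul_inv_iff_mul_eq.1 h2.symm
  let f : QuaternionGroup n →* G :=
    { toFun := fun x => match x with
        | .a i => e i
        | .xa i => τ * e i
      map_one' := h0
      map_mul' := by
        rintro (i | i) (j | j)
        · exact hadd i j
        · change τ * e (j - i) = e i * (τ * e j)
          rw [← mul_assoc, hconj, mul_assoc, ← hadd]; congr 2; ring
        · change τ * e (i + j) = τ * e i * e j
          rw [hadd, mul_assoc]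
        · change e (n + j - i) = τ * e i * (τ * e j)
          rw [mul_assoc τ, ← mul_assoc (e i), hconj, ← mul_assoc τ, ← mul_assoc τ, hτ, ← hn,
            ← hadd, ← hadd]
          congr 1; ring }
  have hf : Function.Surjective f := by
    intro x
    rcases h x with ⟨k, hx⟩ | ⟨k, hx⟩
    · exact ⟨.a k, (hk k).trans hx⟩
    -- From $\tau x = g^k$ and $\tau^2 = g^n$ one gets $x = \tau g^{k-n}$.
    · refine ⟨.xa (k - n), ?_⟩
      change τ * e (k - n) = x
      change g ^ k = τ * x at hx
      apply mul_left_cancel (a := τ)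
      rw [← hx, ← mul_assoc, hτ, ← hn, ← hadd, add_sub_cancel, hk]
  have hb : Function.Bijective f := hf.bijective_of_nat_card_le (by
    rw [Nat.card_eq_fintype_card, QuaternionGroup.card]; exact hcard)
  exact ⟨(MulEquiv.ofBijective f hb).symm⟩

theorem nonempty_mulEquiv_of_exponent_two {A : Type*} [CommGroup A] {n : ℕ}
    (h2 : ∀ x : A, x * x = 1) (hcard : Nat.card A = 2 ^ n) :
    Nonempty (A ≃* Multiplicative (Fin n → ZMod 2)) := by
  have : Finite A := Nat.finite_of_card_ne_zero (by rw [hcard]; positivity)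
  let _ : Module (ZMod 2) (Additive A) := AddCommGroup.zmodModule (n := 2) fun x => by
    rw [two_nsmul]; exact congrArg Additive.ofMul (h2 x.toMul)
  have hfr : Module.finrank (ZMod 2) (Additive A) = n := by
    have h := Module.natCard_eq_pow_finrank (K := ZMod 2) (V := Additive A)
    rw [show Nat.card (Additive A) = Nat.card A from rfl, hcard, Nat.card_zmod] at h
    exact (Nat.pow_right_injective (le_refl 2) h).symm
  have e : Additive A ≃ₗ[ZMod 2] (Fin n → ZMod 2) :=
    LinearEquiv.ofFinrankEq _ _ (by rw [hfr]; simp)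
  exact ⟨AddEquiv.toMultiplicativeRight e.toAddEquiv⟩

/-- The generators are $g$, then $a$ of square one outside $\langle g \rangle$, then $b$ of square
one outside $\langle g, a \rangle$. -/
theorem nonempty_mulEquiv_four_two_two {A : Type*} [CommGroup A] (hcard : Nat.card A = 16) {g : A}
    (hg : g ^ 4 = 1) (hg2 : g ^ 2 ≠ 1) (hsq : ∀ x : A, x ^ 2 = 1 ∨ x ^ 2 = g ^ 2) :
    Nonempty (A ≃* Multiplicative (ZMod 4 × ZMod 2 × ZMod 2)) := by
  have hfin : Finite A := Nat.finite_of_card_ne_zero (by rw [hcard]; norm_num)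
  -- every proper subgroup containing `g` is avoided by some involution
  have key : ∀ K : Subgroup A, g ∈ K → Nat.card K < 16 → ∃ b, b ^ 2 = 1 ∧ b ∉ K := by
    intro K hgK hK
    obtain ⟨x, hx⟩ : ∃ x, x ∉ K := by
      by_contra h
      push Not at h
      rw [(Subgroup.eq_top_iff' K).2 h, Subgroup.card_top, hcard] at hK
      omega
    rcases hsq x with h | h
    · exact ⟨x, h, hx⟩
    -- If $x^2 = g^2$, then $(xg)^2 = g^4 = 1$.
    · refine ⟨x * g, ?_, fun h' => hx ((mul_mem_cancel_right hgK).1 h')⟩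
      rw [mul_pow, h, ← pow_add, hg]
  obtain ⟨e, hadd, hk⟩ := exists_zmod_hom hg
  have he : e 1 = g := by simpa using hk 1
  have e0 : e 0 = 1 := by simpa using hk 0
  let f₁ : Multiplicative (ZMod 4) →* A :=
    { toFun := fun i => e i.toAdd, map_one' := e0, map_mul' := fun i j => hadd _ _ }
  obtain ⟨a, ha, haK⟩ := key f₁.range ⟨Multiplicative.ofAdd 1, he⟩ (by
    have h1 := Nat.card_le_card_of_surjective f₁.rangeRestrict f₁.rangeRestrict_surjective
    have h2 : Nat.card (Multiplicative (ZMod 4)) = 4 := by simp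
    omega)
  obtain ⟨ea, hadda, hka⟩ := exists_zmod_hom ha
  have ea0 : ea 0 = 1 := by simpa using hka 0
  have ea1 : ea 1 = a := by simpa using hka 1
  let f₂ : Multiplicative (ZMod 4 × ZMod 2) →* A :=
    { toFun := fun i => e i.toAdd.1 * ea i.toAdd.2
      map_one' := by simp [e0, ea0]
      map_mul' := fun i j => by
        simp only [toAdd_mul, Prod.fst_add, Prod.snd_add, hadd, hadda]
        rw [mul_mul_mul_comm] }
  obtain ⟨b, hb, hbK⟩ := key f₂.range ⟨Multiplicative.ofAdd (1, 0), by
      change e 1 * ea 0 = g; rw [he, ea0, mul_one]⟩ (by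
    have h1 := Nat.card_le_card_of_surjective f₂.rangeRestrict f₂.rangeRestrict_surjective
    have h2 : Nat.card (Multiplicative (ZMod 4 × ZMod 2)) = 8 := by simp
    omega)
  obtain ⟨eb, haddb, hkb⟩ := exists_zmod_hom hb
  have eb0 : eb 0 = 1 := by simpa using hkb 0
  have eb1 : eb 1 = b := by simpa using hkb 1
  let f : Multiplicative (ZMod 4 × ZMod 2 × ZMod 2) →* A :=
    { toFun := fun i => e i.toAdd.1 * ea i.toAdd.2.1 * eb i.toAdd.2.2
      map_one' := by simp [e0, ea0, eb0]
      map_mul' := fun i j => by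
        simp only [toAdd_mul, Prod.fst_add, Prod.snd_add, hadd, hadda, haddb]
        rw [mul_mul_mul_comm (e _), mul_mul_mul_comm] }
  have hinj : Function.Injective f := by
    rw [injective_iff_map_eq_one]
    intro x hx
    obtain ⟨i, j, k⟩ := x
    have hx : e i * ea j * eb k = 1 := hx
    have hkk : k = 0 ∨ k = 1 := by clear * -; revert k; decide
    have hjj : j = 0 ∨ j = 1 := by clear * -; revert j; decide
    rcases hkk with rfl | rfl
    · rw [eb0, mul_one] at hx
      rcases hjj with rfl | rfl
      · rw [ea0, mul_one] at hx
        have hi : i = 0 ∨ i = 1 ∨ i = 2 ∨ i = 3 := by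
          clear * -; revert i; decide
        have h2 := hk 2
        have h3 := hk 3
        rcases hi with rfl | rfl | rfl | rfl
        · rfl
        · exfalso; apply hg2; rw [← he, hx, one_pow]
        · exfalso; apply hg2
          have : e 2 = g ^ 2 := by exact_mod_cast h2
          rw [← this, hx]
        · exfalso; apply hg2
          have : e 3 = g ^ 3 := by exact_mod_cast h3
          have h4 : g ^ 3 = 1 := this.symm.trans hx
          have h5 : g = 1 := by rw [← hg, pow_succ, h4, one_mul]
          rw [h5, one_pow]
      · exfalso
        apply haK
        refine ⟨Multiplicative.ofAdd (-i), ?_⟩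
        change e (-i) = a
        rw [ea1] at hx
        apply mul_left_cancel (a := e i)
        rw [hx, ← hadd, add_neg_cancel, e0]
    · exfalso
      apply hbK
      refine ⟨Multiplicative.ofAdd (-i, -j), ?_⟩
      change e (-i) * ea (-j) = b
      rw [eb1] at hx
      apply mul_left_cancel (a := e i * ea j)
      rw [hx, mul_mul_mul_comm, ← hadd, ← hadda, add_neg_cancel, add_neg_cancel, e0, ea0, one_mul]
  have hbij : Function.Bijective f := by
    refine hinj.bijective_of_nat_card_le ?_
    rw [hcard]; simp
  exact ⟨(MulEquiv.ofBijective f hbij).symm⟩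

end Isomorphisms

/-! ### The groups with large Davenport constant six -/

section Classification

/-- Free sequences over an elementary abelian 2-group are linearly independent: a new term lies
outside the subgroup of earlier subproducts and at least doubles it. -/
theorem IsProductOneFree.exists_subgroup_of_exponent_two {A : Type*} [CommGroup A] [Finite A]
    (h2 : ∀ x : A, x * x = 1) {T : Multiset A} (hT : IsProductOneFree T) :
    ∃ K : Subgroup A, 2 ^ T.card ≤ Nat.card K ∧ ∀ x ∈ K, ∃ T' ≤ T, x = T'.prod := by
  induction T using Multiset.induction_on with
  | empty => exact ⟨⊥, by simp, fun x hx => ⟨0, le_rfl, by simpa using hx⟩⟩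
  | cons t T ih =>
    obtain ⟨K, hK, hKT⟩ := ih fun U hU hp => hT U (hU.trans (Multiset.le_cons_self _ _)) hp
    have ht : t ∉ K := by
      intro ht
      obtain ⟨T', hT', e⟩ := hKT t ht
      have := hT (t ::ₘ T') (Multiset.cons_le_cons t hT') (by
        rw [isProductOne_iff_prod_eq_one, Multiset.prod_cons, ← e, h2])
      exact Multiset.cons_ne_zero this
    refine ⟨K ⊔ Subgroup.zpowers t, ?_, ?_⟩
    · obtain ⟨m, hm⟩ := Subgroup.card_dvd_of_le (le_sup_left : K ≤ K ⊔ Subgroup.zpowers t)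
      have hm1 : m ≠ 1 := by
        rintro rfl
        rw [mul_one] at hm
        have := Subgroup.eq_of_le_of_card_ge (le_sup_left : K ≤ K ⊔ Subgroup.zpowers t) hm.le
        apply ht
        rw [this]
        exact Subgroup.mem_sup_right (Subgroup.mem_zpowers t)
      have hm0 : m ≠ 0 := by
        rintro rfl
        exact Nat.card_pos.ne' (hm.trans (mul_zero _))
      rw [Multiset.card_cons, pow_succ, hm]
      exact Nat.mul_le_mul hK (by omega)
    · intro x hx
      obtain ⟨k, hk, y, ⟨n, rfl⟩, rfl⟩ := Subgroup.mem_sup.1 hx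
      obtain ⟨T', hT', rfl⟩ := hKT k hk
      rcases Int.even_or_odd' n with ⟨m, rfl | rfl⟩
      · refine ⟨T', hT'.trans (Multiset.le_cons_self _ _), ?_⟩
        simp only [zpow_mul, zpow_two, h2, one_zpow, mul_one]
      · refine ⟨t ::ₘ T', Multiset.cons_le_cons t hT', ?_⟩
        change T'.prod * t ^ (2 * m + 1) = _
        rw [zpow_add, zpow_mul, zpow_two, h2, one_zpow, one_mul, zpow_one, Multiset.prod_cons,
          mul_comm]

/-- A six-term atom contains five independent elements, while a basis of $k$ elements is free and
gives an atom with $k + 1$ terms. -/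
theorem card_eq_of_exponent_two {A : Type*} [CommGroup A] [Finite A] (h2 : ∀ x : A, x * x = 1)
    (hD : AtomCardLE A 6) (h6 : ∃ U : Multiset A, IsProductOneAtom U ∧ U.card = 6) {k : ℕ}
    (hk : Nat.card A = 2 ^ k) : Nat.card A = 2 ^ 5 := by
  have h2p : Fact (Nat.Prime 2) := ⟨Nat.prime_two⟩
  obtain ⟨U, hU, hc⟩ := h6
  obtain ⟨t, ht⟩ := Multiset.card_pos_iff_exists_mem.1 (show 0 < U.card by omega)
  obtain ⟨T, rfl⟩ := Multiset.exists_cons_of_mem ht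
  rw [Multiset.card_cons] at hc
  obtain ⟨K, hK, -⟩ := hU.isProductOneFree_of_cons.exists_subgroup_of_exponent_two h2
  have h1 : 2 ^ 5 ≤ 2 ^ k := by
    rw [← hk, show 5 = T.card by omega]
    exact hK.trans (Subgroup.card_le_card_group K)
  have h5 := (Nat.pow_le_pow_iff_right (by norm_num)).1 h1
  obtain ⟨K', T', -, -, hfree, hTc⟩ := isProductOneFree_zero.exists_of_card_eq_pow (p := 2)
    (K := (⊥ : Subgroup A)) (a := 0) (by simp) (by simp) k (by rw [zero_add, hk])
  have := hfree.card_add_one_le hD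
  rw [hTc, Multiset.card_zero] at this
  rw [hk, show k = 5 by omega]

variable {G : Type*} [Group G]

/-- Three copies of $g$ and $k - 2$ further terms along a chain of subgroups give an atom with $k +
2$ terms. -/
theorem card_eq_eight_or_sixteen [Finite G] (hD : AtomCardLE G 6) (h6 : 6 ≤ Nat.card G) {k : ℕ}
    (hk : Nat.card G = 2 ^ k) {g : G} (hg : orderOf g = 4) :
    Nat.card G = 8 ∨ Nat.card G = 16 := by
  have h2p : Fact (Nat.Prime 2) := ⟨Nat.prime_two⟩
  have hk3 : 3 ≤ k := by
    by_contra h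
    have : 2 ^ k ≤ 2 ^ 2 := Nat.pow_le_pow_right (by norm_num) (by omega)
    omega
  obtain ⟨K', T', -, -, hfree, hTc⟩ :=
    (isProductOneFree_replicate_of_lt_orderOf (g := g) (n := 3) (by omega)).exists_of_card_eq_pow
      (p := 2) (K := Subgroup.zpowers g) (a := 2) (fun t ht => by
        rw [Multiset.eq_of_mem_replicate ht]; exact Subgroup.mem_zpowers g)
      (by rw [Nat.card_zpowers, hg]; rfl) (k - 2) (by rw [hk]; exact pow_dvd_pow 2 (by omega))
  have := hfree.card_add_one_le hD
  rw [hTc, Multiset.card_replicate] at this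
  have : k = 3 ∨ k = 4 := by omega
  rcases this with rfl | rfl
  · exact Or.inl hk
  · exact Or.inr hk

/-- Otherwise $g$ and $h$ are independent of order four, and $g^3 h^3$ is a free sequence with six
terms. -/
theorem sq_eq_of_commute (hD : AtomCardLE G 6) {g h : G} (hcomm : g * h = h * g) (hg : g ^ 4 = 1)
    (hh : h ^ 4 = 1) (hg2 : g ^ 2 ≠ 1) : h ^ 2 = 1 ∨ h ^ 2 = g ^ 2 := by
  by_contra hcon
  push Not at hcon
  obtain ⟨n1, n2⟩ := hcon
  have c : Commute g h := hcomm
  have hne : ∀ i j : ℕ, g ^ i * h ^ j = 1 → i ≤ 3 → j ≤ 3 → i = 0 ∧ j = 0 := by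
    intro i j hij hi hj
    have hsq : g ^ (2 * i) * h ^ (2 * j) = 1 := by
      rw [mul_comm 2 i, mul_comm 2 j, pow_mul, pow_mul, ← (c.pow_pow i j).mul_pow, hij, one_pow]
    have hg6 : g ^ 6 = g ^ 2 := by rw [show 6 = 4 + 2 from rfl, pow_add, hg, one_mul]
    have hh6 : h ^ 6 = h ^ 2 := by rw [show 6 = 4 + 2 from rfl, pow_add, hh, one_mul]
    have hgg : g ^ 2 * g ^ 2 = 1 := by rw [← pow_add, hg]
    have e : h ^ 2 ≠ 1 ∧ g ^ 2 * h ^ 2 ≠ 1 := ⟨n1, fun h' => n2 (mul_left_cancel (h'.trans hgg.symm))⟩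
    have hj' : j = 0 ∨ j = 2 := by
      have : j = 0 ∨ j = 1 ∨ j = 2 ∨ j = 3 := by omega
      have : i = 0 ∨ i = 1 ∨ i = 2 ∨ i = 3 := by omega
      rcases ‹j = 0 ∨ _› with rfl | rfl | rfl | rfl <;>
        rcases ‹i = 0 ∨ _› with rfl | rfl | rfl | rfl <;>
        simp [hg, hg6, hh6, e.1, e.2] at hsq ⊢
    rcases hj' with rfl | rfl
    · rw [pow_zero, mul_one] at hij
      refine ⟨?_, rfl⟩
      have hg1 : g ≠ 1 := by rintro rfl; simp at hg2
      have : i = 0 ∨ i = 1 ∨ i = 2 ∨ i = 3 := by omega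
      rcases this with rfl | rfl | rfl | rfl
      · rfl
      · exact absurd (by simpa using hij) hg1
      · exact absurd hij hg2
      · rw [pow_succ, hij, one_mul] at hg
        exact absurd hg hg1
    · exfalso
      have : i = 0 ∨ i = 1 ∨ i = 2 ∨ i = 3 := by omega
      rcases this with rfl | rfl | rfl | rfl
      · simp [e.1] at hij
      · exact hg2 (by simpa [hh] using hsq)
      · exact e.2 hij
      · exact hg2 (by simpa [hh, hg6] using hsq)
  have hfree : IsProductOneFree (Multiset.replicate 3 g + Multiset.replicate 3 h) := by
    intro U hU hp
    obtain ⟨A, hA, B, hB, rfl⟩ := Multiset.exists_add_of_le_add hU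
    obtain ⟨i, hi, rfl⟩ := Multiset.le_replicate_iff_eq hA
    obtain ⟨j, hj, rfl⟩ := Multiset.le_replicate_iff_eq hB
    obtain ⟨l, hl, hl1⟩ := hp
    have : (List.replicate i g ++ List.replicate j h).prod = l.prod := by
      refine List.Perm.prod_eq' (Multiset.coe_eq_coe.1 ?_) ?_
      · rw [hl, ← Multiset.coe_add, Multiset.coe_replicate, Multiset.coe_replicate]
      · refine List.pairwise_of_forall_mem_list fun p hp q hq => ?_
        simp only [List.mem_append, List.mem_replicate] at hp hq
        rcases hp with ⟨-, rfl⟩ | ⟨-, rfl⟩ <;> rcases hq with ⟨-, rfl⟩ | ⟨-, rfl⟩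
        exacts [rfl, hcomm, hcomm.symm, rfl]
    rw [hl1, List.prod_append, List.prod_replicate, List.prod_replicate] at this
    obtain ⟨rfl, rfl⟩ := hne i j this hi hj
    simp
  have := hfree.card_add_one_le hD
  simp at this

/-- The groups occurring as groups with large Davenport constant six. -/
theorem classification [Finite G] (hD : AtomCardLE G 6)
    (h6 : ∃ U : Multiset G, IsProductOneAtom U ∧ U.card = 6) :
    Nonempty (G ≃* Multiplicative (ZMod 6)) ∨ Nonempty (G ≃* Multiplicative (Fin 5 → ZMod 2)) ∨
      Nonempty (G ≃* Multiplicative (ZMod 4 × ZMod 2 × ZMod 2)) ∨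
      Nonempty (G ≃* DihedralGroup 3) ∨ Nonempty (G ≃* DihedralGroup 4) ∨
      Nonempty (G ≃* QuaternionGroup 2) := by
  have hcard : 6 ≤ Nat.card G := by
    obtain ⟨U, hU, hc⟩ := h6
    exact hc ▸ hU.card_le_natCard
  by_cases h : ∃ g : G, orderOf g = 6
  · left
    obtain ⟨g, hg⟩ := h
    have htop := zpowers_eq_top_of_orderOf_eq_six hD hg
    have : IsCyclic G := ⟨g, fun x => (htop ▸ Subgroup.mem_top x : x ∈ Subgroup.zpowers g)⟩
    refine ⟨mulEquivOfCyclicCardEq ?_⟩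
    rw [← Subgroup.card_top (G := G), ← htop, Nat.card_zpowers, hg]
    simp
  push Not at h
  have hord : ∀ x : G, 0 < orderOf x ∧ orderOf x ≤ 4 := by
    intro x
    have h1 := orderOf_le_of_atom_card_le hD x
    have h2 := orderOf_ne_five hD hcard x
    have h3 := h x
    exact ⟨orderOf_pos x, by omega⟩
  by_cases h3 : ∃ g : G, orderOf g = 3
  · obtain ⟨g, hg⟩ := h3
    obtain ⟨τ, hτ, hinv, hgen⟩ := exists_inverted_generator hD h6 hord hg
    right; right; right; left
    exact nonempty_mulEquiv_dihedral (by rw [← hg]; exact pow_orderOf_eq_one g) hτ hinv hgen hcard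
  push Not at h3
  have hdvd : ∀ x : G, orderOf x = 1 ∨ orderOf x = 2 ∨ orderOf x = 4 := by
    intro x
    have := hord x
    have := h3 x
    omega
  have h4 : ∀ x : G, x ^ 4 = 1 := by
    intro x
    rw [← orderOf_dvd_iff_pow_eq_one]
    rcases hdvd x with h | h | h <;> rw [h] <;> decide
  obtain ⟨k, hk⟩ : ∃ k, Nat.card G = 2 ^ k := by
    refine ⟨_, Nat.eq_prime_pow_of_unique_prime_dvd Nat.card_pos.ne' ?_⟩
    intro p hp hpd
    have : Fact p.Prime := ⟨hp⟩
    obtain ⟨t, ht⟩ := exists_prime_orderOf_dvd_card' (G := G) p hpd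
    have := hp.two_le
    rcases hdvd t with h | h | h
    · omega
    · omega
    · rw [ht] at h
      rw [h] at hp
      exact absurd hp (by norm_num)
  by_cases hexp : ∀ x : G, x * x = 1
  · right; left
    let _ : CommGroup G := CommGroup.mk (fun a b => by
      have ha := inv_eq_of_mul_eq_one_left (hexp a)
      have hb := inv_eq_of_mul_eq_one_left (hexp b)
      have hab := inv_eq_of_mul_eq_one_left (hexp (a * b))
      rw [← hab, mul_inv_rev, ha, hb])
    exact nonempty_mulEquiv_of_exponent_two hexp (card_eq_of_exponent_two hexp hD h6 hk)
  push Not at hexp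
  obtain ⟨g, hg⟩ := hexp
  have hg2 : g ^ 2 ≠ 1 := by rwa [pow_two]
  have hg4 : orderOf g = 4 := by
    rcases hdvd g with h | h | h
    · exact absurd (by rw [orderOf_eq_one_iff.1 h, one_pow]) hg2
    · exact absurd (by rw [← h]; exact pow_orderOf_eq_one g) hg2
    · exact h
  rcases card_eq_eight_or_sixteen hD hcard hk hg4 with hc | hc
  · -- order eight
    have hidx : (Subgroup.zpowers g).index = 2 := by
      have h1 := (Subgroup.zpowers g).card_mul_index
      rw [Nat.card_zpowers, hg4, hc] at h1
      omega
    obtain ⟨b, hb⟩ : ∃ b, b ∉ Subgroup.zpowers g := by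
      by_contra hcon
      push Not at hcon
      rw [(Subgroup.eq_top_iff' _).2 hcon, Subgroup.index_top] at hidx
      omega
    have hgen : ∀ x, x ∈ Subgroup.zpowers g ∨ b * x ∈ Subgroup.zpowers g := by
      intro x
      rw [Subgroup.mul_mem_iff_of_index_two hidx]
      tauto
    have hz : ∀ x ∈ Subgroup.zpowers g, x = 1 ∨ x = g ∨ x = g ^ 2 ∨ x = g ^ 3 := by
      intro x hx
      classical
      obtain ⟨n, hn, rfl⟩ := Finset.mem_image.1 (mem_zpowers_iff_mem_range_orderOf.1 hx)
      rw [Finset.mem_range, hg4] at hn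
      have : n = 0 ∨ n = 1 ∨ n = 2 ∨ n = 3 := by omega
      rcases this with rfl | rfl | rfl | rfl <;> simp
    have hg6 : (g ^ 3) ^ 2 = g ^ 2 := by
      rw [← pow_mul, show 3 * 2 = 4 + 2 from rfl, pow_add, h4, one_mul]
    have hbb : b * b = 1 ∨ b * b = g ^ 2 := by
      have hb4 : (b * b) ^ 2 = 1 := by rw [← pow_two, ← pow_mul]; exact h4 b
      rcases hz _ (Subgroup.mul_self_mem_of_index_two hidx b) with h | h | h | h
      · exact Or.inl h
      · exact absurd (h ▸ hb4) hg2
      · exact Or.inr h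
      · rw [h, hg6] at hb4
        exact absurd hb4 hg2
    have hn := Subgroup.normal_of_index_eq_two hidx
    have hconj : b * g * b⁻¹ = g ∨ b * g * b⁻¹ = g⁻¹ := by
      have hsq : (b * g * b⁻¹) ^ 2 ≠ 1 := by
        rw [conj_pow]
        intro h
        apply hg2
        rwa [mul_inv_eq_one, mul_eq_left] at h
      rcases hz _ (hn.conj_mem g (Subgroup.mem_zpowers g) b) with h | h | h | h
      · rw [h, one_pow] at hsq; exact absurd rfl hsq
      · exact Or.inl h
      · rw [h, ← pow_mul] at hsq
        exact absurd (h4 g) hsq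
      · refine Or.inr (h.trans ?_)
        rw [eq_inv_iff_mul_eq_one, ← pow_succ]
        exact h4 g
    rcases hconj with hconj | hconj
    -- Here $G \cong C_4 \times C_2$: one of $b$ and $bg$ has square one and generates $G$ together
    -- with $g$. The group ring bound leaves at most five terms for an atom.
    · exfalso
      have hbg : b * g = g * b := mul_inv_eq_iff_eq_mul.1 hconj
      obtain ⟨c, hc1, hcg, hcgen⟩ : ∃ c : G, c ^ 2 = 1 ∧ c * g = g * c ∧
          ∀ x, x ∈ Subgroup.zpowers g ∨ x * c⁻¹ ∈ Subgroup.zpowers g := by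
        have aux : ∀ c, c ∉ Subgroup.zpowers g →
            ∀ x, x ∈ Subgroup.zpowers g ∨ x * c⁻¹ ∈ Subgroup.zpowers g := by
          intro c hc x
          rw [Subgroup.mul_mem_iff_of_index_two hidx, inv_mem_iff]
          tauto
        rcases hbb with h | h
        · exact ⟨b, by rw [pow_two, h], hbg, aux b hb⟩
        · refine ⟨b * g, ?_, by rw [hbg, mul_assoc, hbg], aux _ fun h' =>
            hb ((mul_mem_cancel_right (Subgroup.mem_zpowers g)).1 h')⟩
          have : Commute b g := hbg
          rw [this.mul_pow, pow_two b, h, ← pow_add]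
          exact h4 g
      have hform : ∀ x : G, ∃ i j : ℕ, x = g ^ i * c ^ j := by
        intro x
        rcases hcgen x with h | h
        · obtain ⟨i, hi⟩ := (isOfFinOrder_of_finite g).mem_powers_iff_mem_zpowers.2 h
          exact ⟨i, 0, by simpa using hi.symm⟩
        · obtain ⟨i, hi⟩ := (isOfFinOrder_of_finite g).mem_powers_iff_mem_zpowers.2 h
          exact ⟨i, 1, by rw [pow_one]; exact (eq_mul_of_mul_inv_eq hi.symm)⟩
      have hcomm : ∀ x y : G, x * y = y * x := by
        intro x y
        obtain ⟨i, j, rfl⟩ := hform x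
        obtain ⟨i', j', rfl⟩ := hform y
        have hcg : Commute c g := hcg
        have e : Commute (g ^ i * c ^ j) (g ^ i' * c ^ j') :=
          (((Commute.refl g).pow_pow i i').mul_right (hcg.symm.pow_pow i j')).mul_left
            ((hcg.pow_pow j i').mul_right ((Commute.refl c).pow_pow j j'))
        exact e
      let _ : CommGroup G := CommGroup.mk hcomm
      obtain ⟨U, hU, hUc⟩ := h6
      have h2p : Fact (Nat.Prime 2) := ⟨Nat.prime_two⟩
      have := hU.card_lt_of_two_generators (p := 2) (a := g) (b := c) (m := 2) (n := 1) (h4 g)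
        (by simpa using hc1) hform
      omega
    · rcases hbb with h | h
      · right; right; right; right; left
        exact nonempty_mulEquiv_dihedral (h4 g) h hconj hgen (by rw [hc])
      · right; right; right; right; right
        exact nonempty_mulEquiv_quaternion (h4 g) h hconj hgen (by rw [hc])
  · -- order sixteen
    right; right; left
    have hcomm : ∀ a b : G, a * b = b * a := by
      by_contra hnc
      exact false_of_card_eq_sixteen hD hc h4 hnc
    let _ : CommGroup G := CommGroup.mk hcomm
    exact nonempty_mulEquiv_four_two_two hc (h4 g) hg2
      fun x => sq_eq_of_commute hD (hcomm g x) (h4 g) (h4 x) hg2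

end Classification

/-! ### Separating the groups by their sets of lengths -/

section Characterization

/-- Some `L ∈ 𝓛` contains all elements of `s` and no element of `t`. -/
def ContainsPattern (𝓛 : Set (Set ℕ)) (s t : Set ℕ) : Prop :=
  ∃ L ∈ 𝓛, s ⊆ L ∧ Disjoint t L

theorem containsPattern_iff {G : Type*} [Group G] {s t : Set ℕ} (hs : s.Nonempty) :
    ContainsPattern (groupSystemOfSetsOfLengths G) s t ↔ ∃ S : Multiset G,
      (∀ k ∈ s, HasFactorizationLength S k) ∧ ∀ k ∈ t, ¬ HasFactorizationLength S k := by
  rw [ContainsPattern, ← exists_hasFactorizationLength_iff]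
  constructor
  · rintro ⟨S, -, h1, h2⟩
    exact ⟨S, h1, fun k hk h => Set.disjoint_left.1 h2 hk h⟩
  · rintro ⟨S, h1, h2⟩
    obtain ⟨k, hk⟩ := hs
    exact ⟨S, (h1 k hk).isProductOne, h1, Set.disjoint_left.2 h2⟩

theorem AtomCardLE.of_mulEquiv {G H : Type*} [Group G] [Group H] {n : ℕ} (h : AtomCardLE G n)
    (e : G ≃* H) : AtomCardLE H n := by
  intro U hU
  simpa using h _ (hU.map_equiv e.symm)

variable {G : Type*} [Group G]

/-- For $C_6$ and $C_2^5$. -/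
theorem patterns_of_lengths_eq_two_or_six
    (h : ∀ S : Multiset G, HasFactorizationLength S 2 → HasFactorizationLength S 6 →
      ∀ k, HasFactorizationLength S k → k = 2 ∨ k = 6) :
    ¬ ContainsPattern (groupSystemOfSetsOfLengths G) {2, 4, 6} {3} ∧
      ¬ ContainsPattern (groupSystemOfSetsOfLengths G) {2, 3, 6} ∅ := by
  rw [containsPattern_iff (by simp), containsPattern_iff (by simp)]
  constructor
  · rintro ⟨S, h1, -⟩
    have := h S (h1 2 (by simp)) (h1 6 (by simp)) 4 (h1 4 (by simp))
    omega
  · rintro ⟨S, h1, -⟩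
    have := h S (h1 2 (by simp)) (h1 6 (by simp)) 3 (h1 3 (by simp))
    omega

/-- For $D_4$ and $Q_8$. The existence part uses $U U^{-1}$ for a six-term atom $U$. -/
theorem patterns_of_three_of_two_of_six
    (h6 : ∃ U : Multiset G, IsProductOneAtom U ∧ U.card = 6)
    (h : ∀ S : Multiset G, HasFactorizationLength S 2 → HasFactorizationLength S 6 →
      HasFactorizationLength S 3) :
    ¬ ContainsPattern (groupSystemOfSetsOfLengths G) {2, 4, 6} {3} ∧
      ContainsPattern (groupSystemOfSetsOfLengths G) {2, 3, 6} ∅ ∧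
      ¬ ContainsPattern (groupSystemOfSetsOfLengths G) {2, 6} {3} := by
  rw [containsPattern_iff (by simp), containsPattern_iff (by simp), containsPattern_iff (by simp)]
  refine ⟨?_, ?_, ?_⟩
  · rintro ⟨S, h1, h2⟩
    exact h2 3 rfl (h S (h1 2 (by simp)) (h1 6 (by simp)))
  · obtain ⟨S, h2, h6⟩ := exists_two_of_six h6
    refine ⟨S, ?_, by simp⟩
    rintro k (rfl | rfl | rfl)
    exacts [h2, h S h2 h6, h6]
  · rintro ⟨S, h1, h2⟩
    exact h2 3 rfl (h S (h1 2 (by simp)) (h1 6 (by simp)))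

/-- The groups with large Davenport constant six, together with properties of their systems of sets
of lengths telling them apart. -/
theorem classification_with_patterns [Finite G] (hD : AtomCardLE G 6)
    (h6 : ∃ U : Multiset G, IsProductOneAtom U ∧ U.card = 6) {𝓛 : Set (Set ℕ)}
    (h𝓛 : groupSystemOfSetsOfLengths G = 𝓛) :
    (Nonempty (G ≃* Multiplicative (ZMod 6)) ∧ ¬ ContainsPattern 𝓛 {2, 4, 6} {3} ∧
      ¬ ContainsPattern 𝓛 {2, 3, 6} ∅ ∧ ¬ ContainsPattern 𝓛 {3, 9} ∅) ∨
    (Nonempty (G ≃* Multiplicative (Fin 5 → ZMod 2)) ∧ ¬ ContainsPattern 𝓛 {2, 4, 6} {3} ∧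
      ¬ ContainsPattern 𝓛 {2, 3, 6} ∅ ∧ ContainsPattern 𝓛 {3, 9} ∅) ∨
    (Nonempty (G ≃* Multiplicative (ZMod 4 × ZMod 2 × ZMod 2)) ∧
      ContainsPattern 𝓛 {2, 4, 6} {3}) ∨
    (Nonempty (G ≃* DihedralGroup 3) ∧ ¬ ContainsPattern 𝓛 {2, 4, 6} {3} ∧
      ContainsPattern 𝓛 {2, 3, 6} ∅ ∧ ContainsPattern 𝓛 {2, 6} {3}) ∨
    (Nonempty (G ≃* DihedralGroup 4) ∧ ¬ ContainsPattern 𝓛 {2, 4, 6} {3} ∧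
      ContainsPattern 𝓛 {2, 3, 6} ∅ ∧ ¬ ContainsPattern 𝓛 {2, 6} {3} ∧
      ContainsPattern 𝓛 {2, 5} {3, 4}) ∨
    (Nonempty (G ≃* QuaternionGroup 2) ∧ ¬ ContainsPattern 𝓛 {2, 4, 6} {3} ∧
      ContainsPattern 𝓛 {2, 3, 6} ∅ ∧ ¬ ContainsPattern 𝓛 {2, 6} {3} ∧
      ¬ ContainsPattern 𝓛 {2, 5} {3, 4}) := by
  rcases classification hD h6 with ⟨⟨e⟩⟩ | ⟨⟨e⟩⟩ | ⟨⟨e⟩⟩ | ⟨⟨e⟩⟩ | ⟨⟨e⟩⟩ | ⟨⟨e⟩⟩ <;>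
    rw [groupSystemOfSetsOfLengths_congr e] at h𝓛 <;> subst h𝓛 <;>
    have hD' := hD.of_mulEquiv e
  · obtain ⟨h1, h2⟩ := patterns_of_lengths_eq_two_or_six fun S h2 h6 k hk =>
      cyclicSix_lengths_of_two_of_six hD' h2 h6 hk
    refine Or.inl ⟨⟨e⟩, h1, h2, ?_⟩
    rw [containsPattern_iff (by simp)]
    rintro ⟨S, h, -⟩
    exact cyclicSix_not_three_nine hD' (h 3 (by simp)) (h 9 (by simp))
  · obtain ⟨h1, h2⟩ := patterns_of_lengths_eq_two_or_six fun S h2 h6 k hk =>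
      lengths_of_two_of_six_of_exponent_two (by decide +kernel) hD' h2 h6 hk
    refine Or.inr (Or.inl ⟨⟨e⟩, h1, h2, ?_⟩)
    rw [containsPattern_iff (by simp)]
    obtain ⟨S, h3, h9⟩ := elementary_exists_three_nine
    refine ⟨S, ?_, by simp⟩
    rintro k (rfl | rfl)
    exacts [h3, h9]
  · refine Or.inr (Or.inr (Or.inl ⟨⟨e⟩, ?_⟩))
    rw [containsPattern_iff (by simp)]
    obtain ⟨S, h2, h4, h6, h3⟩ := cyclicFour_exists_two_four_six
    refine ⟨S, ?_, ?_⟩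
    · rintro k (rfl | rfl | rfl)
      exacts [h2, h4, h6]
    · rintro k rfl
      exact h3
  · refine Or.inr (Or.inr (Or.inr (Or.inl ⟨⟨e⟩, ?_⟩)))
    rw [containsPattern_iff (by simp), containsPattern_iff (by simp),
      containsPattern_iff (by simp)]
    refine ⟨?_, ?_, ?_⟩
    · rintro ⟨S, h, h3⟩
      exact h3 3 rfl (dihedralThree_three_of_two_four_six hD' (h 2 (by simp)) (h 4 (by simp))
        (h 6 (by simp)))
    · obtain ⟨S, h2, h3, h6⟩ := dihedralThree_exists_two_three_six
      refine ⟨S, ?_, by simp⟩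
      rintro k (rfl | rfl | rfl)
      exacts [h2, h3, h6]
    · obtain ⟨S, h2, h6, h3⟩ := dihedralThree_exists_two_six
      refine ⟨S, ?_, ?_⟩
      · rintro k (rfl | rfl)
        exacts [h2, h6]
      · rintro k rfl
        exact h3
  · obtain ⟨U, hU, hc⟩ := h6
    obtain ⟨h1, h2, h3⟩ := patterns_of_three_of_two_of_six ⟨_, hU.map_equiv e, by simpa using hc⟩
      fun S => dihedralFour_three_of_two_of_six hD'
    refine Or.inr (Or.inr (Or.inr (Or.inr (Or.inl ⟨⟨e⟩, h1, h2, h3, ?_⟩))))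
    rw [containsPattern_iff (by simp)]
    obtain ⟨S, h2, h5, h3, h4⟩ := dihedralFour_exists_two_five
    refine ⟨S, ?_, ?_⟩
    · rintro k (rfl | rfl)
      exacts [h2, h5]
    · rintro k (rfl | rfl)
      exacts [h3, h4]
  · obtain ⟨U, hU, hc⟩ := h6
    obtain ⟨h1, h2, h3⟩ := patterns_of_three_of_two_of_six ⟨_, hU.map_equiv e, by simpa using hc⟩
      fun S => quaternion_three_of_two_of_six hD'
    refine Or.inr (Or.inr (Or.inr (Or.inr (Or.inr ⟨⟨e⟩, h1, h2, h3, ?_⟩))))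
    rw [containsPattern_iff (by simp)]
    rintro ⟨S, h, h'⟩
    rcases quaternion_not_two_five hD' (h 2 (by simp)) (h 5 (by simp)) with h | h
    exacts [h' 3 (by simp) h, h' 4 (by simp) h]

end Characterization

theorem theorem4p7 {G : Type*} [Group G] [Finite G] (hG : largeDavenport G = 6)
    {G' : Type*} [Group G'] [Finite G']
    (hL : groupSystemOfSetsOfLengths G' = groupSystemOfSetsOfLengths G) :
    Nonempty (G' ≃* G) := by
  have hG' : largeDavenport G' = 6 := largeDavenport_eq_of_system_eq (n := 6) (by norm_num) hG hL
  obtain ⟨hD, h6⟩ := (largeDavenport_eq_iff (n := 6) (by norm_num)).1 hG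
  obtain ⟨hD', h6'⟩ := (largeDavenport_eq_iff (n := 6) (by norm_num)).1 hG'
  rcases classification_with_patterns hD h6 rfl with ⟨⟨e⟩, h⟩ | ⟨⟨e⟩, h⟩ | ⟨⟨e⟩, h⟩ | ⟨⟨e⟩, h⟩ |
      ⟨⟨e⟩, h⟩ | ⟨⟨e⟩, h⟩ <;>
    rcases classification_with_patterns hD' h6' hL with ⟨⟨e'⟩, h'⟩ | ⟨⟨e'⟩, h'⟩ | ⟨⟨e'⟩, h'⟩ |
      ⟨⟨e'⟩, h'⟩ | ⟨⟨e'⟩, h'⟩ | ⟨⟨e'⟩, h'⟩ <;>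
    -- Equal cases of the classification give the isomorphism. Two different cases disagree on some
    -- pattern of the common system.
    first
    | exact ⟨e'.trans e.symm⟩
    | (exfalso; tauto)
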